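/- Let $\Gamma$ be a finite commutative group, written multiplicatively. Let $\mathbb{Q}\langle X\rangle$ be the free associative unital $\mathbb{Q}$-algebra on $X=\{x_0\}\sqcup\{x_\gamma \mid \gamma\in\Gamma\}$, and let $\mathfrak{Lib}(X)\subset\mathbb{Q}\langle X\rangle$ be the Lie subalgebra (for the commutator) generated by $X$. For $\sigma\in\Gamma$ let $t_\sigma$ be the algebra automorphism of $\mathbb{Q}\langle X\rangle$ with $x_0\mapsto x_0$, $x_\gamma\mapsto x_{\sigma\gamma}$. For $\psi\in\mathbb{Q}\langle X\rangle$ let $d_\psi$ be the derivation of $\mathbb{Q}\langle X\rangle$ with $d_\psi(x_0)=0$ and $d_\psi(x_\sigma)=[x_\sigma,t_\sigma(\psi)]$ for $\sigma\in\Gamma$, and put $s_\psi(v)=\psi v+d_\psi(v)$. The Ihara bracket $\langle\psi_1,\psi_2\rangle:=s_{\psi_1}(\psi_2)-s_{\psi_2}(\psi_1)$ makes the vector space $\mathfrak{Lib}(X)$ a Lie algebra $(\mathfrak{Lib}(X),\langle\,,\rangle)$. Let $\mathbb{Q}\langle Y\rangle$ be the free associative unital $\mathbb{Q}$-algebra on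 $Y=\{y_{n,\sigma}\mid n\ge 1,\ \sigma\in\Gamma\}$, and write $(f|w)$ for the coefficient of a word $w$ in $f$. Define linear maps as follows. - $\pi_Y:\mathbb{Q}\langle X\rangle\to\mathbb{Q}\langle Y\rangle$ sends $x_0^{n_1-1}x_{\sigma_1}\cdots x_0^{n_r-1}x_{\sigma_r}$ to $y_{n_1,\sigma_1}\cdots y_{n_r,\sigma_r}$ (and $1$ to $1$), and every word ending in $x_0$ to $0$. - $\mathbf q:\mathbb{Q}\langle Y\rangle\to\mathbb{Q}\langle Y\rangle$ sends $1$ to $1$ and $y_{n_1,\sigma_1}\cdots y_{n_r,\sigma_r}$ to $y_{n_1,\sigma_1}y_{n_2,\sigma_2\sigma_1^{-1}}\cdots y_{n_r,\sigma_r\sigma_{r-1}^{-1}}$. - $\mathrm{corr}:\mathbb{Q}\langle X\rangle\to\mathbb{Q}\langle Y\rangle$ sends $x_0^{n-1}x_1$ to $\frac{(-1)^{n-1}}{n}(y_{1,1})^n$ for $n\ge1$ (here $x_1$ is the letter $x_\gamma$ with $\gamma=1\in\Gamma$), and every other word to $0$. Put $\psi_*:=\mathbf q(\pi_Y(\psi))+\mathrm{corr}(\psi)$.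 Let $\Delta_*:\mathbb{Q}\langle Y\rangle\to\mathbb{Q}\langle Y\rangle^{\otimes 2}$ be the algebra morphism with $$\Delta_*(y_{n,\sigma})=y_{n,\sigma}\otimes1+1\otimes y_{n,\sigma}+\sum_{\substack{n'+n''=n,\ n',n''>0\\ \sigma'\sigma''=\sigma}}y_{n',\sigma'}\otimes y_{n'',\sigma''}.$$ Let $\mathfrak{dmr}$ be the space of all $\psi\in\mathfrak{Lib}(X)$ with $(\psi|x_0)=(\psi|x_1)=0$ and $\Delta_*(\psi_*)=\psi_*\otimes1+1\otimes\psi_*$. Let $\mathfrak{dmr}_0$ be the subspace of all $\psi\in\mathfrak{dmr}$ such that $(\psi_*|y_{n,\sigma})+(-1)^n(\psi_*|y_{n,\sigma^{-1}})=0$ holds for $n=1$ and all $\sigma\in\Gamma$ if $|\Gamma|\ge3$, and for $(n,\sigma)=(2,1)$ if $|\Gamma|\le2$. Then $\mathfrak{dmr}_0$ is a Lie subalgebra of $(\mathfrak{Lib}(X),\langle\,,\rangle)$. -/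

import Mathlib

open scoped TensorProduct

namespace DoubleShuffle

/-- The alphabet `X = {x₀} ⊔ {x_γ | γ ∈ Γ}`: `none` is the letter `x₀` and `some γ` is the
letter `x_γ`. -/
abbrev XLetter (Γ : Type*) := Option Γ

/-- The alphabet `Y = {y_{n,σ} | n ≥ 1, σ ∈ Γ}`: the pair `(n, σ)` is the letter `y_{n,σ}`. -/
abbrev YLetter (Γ : Type*) := ℕ+ × Γ

/-- The free noncommutative unital algebra `ℚ⟨X⟩`. -/
abbrev QX (Γ : Type*) := FreeAlgebra ℚ (XLetter Γ)

/-- The free noncommutative unital algebra `ℚ⟨Y⟩`. -/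
abbrev QY (Γ : Type*) := FreeAlgebra ℚ (YLetter Γ)

noncomputable section

section Words

variable {A : Type*}

/-- The coefficient `(f|w)` of the word `w` in the noncommutative polynomial `f`. -/
def coeff (w : List A) : FreeAlgebra ℚ A →ₗ[ℚ] ℚ :=
  (FreeAlgebra.basisFreeMonoid ℚ A).coord (FreeMonoid.ofList w)

/-- The linear map out of the free algebra with prescribed values on the words. -/
def onWords {M : Type*} [AddCommGroup M] [Module ℚ M] (F : List A → M) :
    FreeAlgebra ℚ A →ₗ[ℚ] M :=
  (FreeAlgebra.basisFreeMonoid ℚ A).constr ℚ fun w => F w.toList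

/-- The word `w`, as an element of the free algebra. -/
def word (w : List A) : FreeAlgebra ℚ A := (w.map (FreeAlgebra.ι ℚ)).prod

theorem basis_apply (w : List A) :
    FreeAlgebra.basisFreeMonoid ℚ A (FreeMonoid.ofList w) = word w := by
  simp only [FreeAlgebra.basisFreeMonoid, Module.Basis.map_apply, Finsupp.coe_basisSingleOne]
  change FreeAlgebra.equivMonoidAlgebraFreeMonoid.symm
    (MonoidAlgebra.single (FreeMonoid.ofList w) 1) = word w
  simp [FreeAlgebra.equivMonoidAlgebraFreeMonoid, word, FreeMonoid.lift_apply]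

theorem onWords_word {M : Type*} [AddCommGroup M] [Module ℚ M] (F : List A → M) (w : List A) :
    onWords F (word w) = F w := by
  rw [← basis_apply, onWords, Module.Basis.constr_basis]
  rfl

theorem coeff_word [DecidableEq A] (w v : List A) :
    coeff w (word v) = if v = w then 1 else 0 := by
  rw [← basis_apply, coeff, Module.Basis.coord_apply, Module.Basis.repr_self]
  split_ifs with h
  · rw [h, Finsupp.single_eq_same]
  · exact Finsupp.single_eq_of_ne' h

/-- The algebra morphism `x ↦ x + ε D x` from the free algebra to its dual numbers. -/
def derHom (D : A → FreeAlgebra ℚ A) :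
    FreeAlgebra ℚ A →ₐ[ℚ] TrivSqZeroExt (FreeAlgebra ℚ A) (FreeAlgebra ℚ A) :=
  FreeAlgebra.lift ℚ fun x => TrivSqZeroExt.inl (FreeAlgebra.ι ℚ x) + TrivSqZeroExt.inr (D x)

/-- The derivation of the free algebra with prescribed values `D` on the letters: the
coefficient of `ε` in the algebra morphism `x ↦ x + ε D x`. See `der_ι` and `der_mul`. -/
def der (D : A → FreeAlgebra ℚ A) : FreeAlgebra ℚ A →ₗ[ℚ] FreeAlgebra ℚ A where
  toFun v := (derHom D v).snd
  map_add' u v := by simp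
  map_smul' c v := by simp

theorem der_ι (D : A → FreeAlgebra ℚ A) (x : A) : der D (FreeAlgebra.ι ℚ x) = D x := by
  simp [der, derHom]

theorem fst_derHom (D : A → FreeAlgebra ℚ A) (v : FreeAlgebra ℚ A) :
    (derHom D v).fst = v := by
  have h : (TrivSqZeroExt.fstHom ℚ (FreeAlgebra ℚ A) (FreeAlgebra ℚ A)).comp (derHom D)
      = AlgHom.id ℚ _ := by
    ext x
    simp [derHom]
  exact DFunLike.congr_fun h v

theorem der_mul (D : A → FreeAlgebra ℚ A) (u v : FreeAlgebra ℚ A) :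
    der D (u * v) = der D u * v + u * der D v := by
  simp [der, fst_derHom, add_comm]

theorem der_algebraMap (D : A → FreeAlgebra ℚ A) (r : ℚ) :
    der D (algebraMap ℚ _ r) = 0 := by
  simp [der, TrivSqZeroExt.algebraMap_eq_inl']

end Words

section Ihara

attribute [local instance] LieRing.ofAssociativeRing

variable {Γ : Type*}

variable (Γ) in
/-- `𝔏𝔦𝔟(X)`: the Lie subalgebra of `ℚ⟨X⟩` (with the commutator bracket) generated by `X`. -/
def Lib : LieSubalgebra ℚ (QX Γ) :=
  LieSubalgebra.lieSpan ℚ (QX Γ) (Set.range (FreeAlgebra.ι ℚ))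

theorem ι_mem_Lib (x : XLetter Γ) : FreeAlgebra.ι ℚ x ∈ Lib Γ :=
  LieSubalgebra.subset_lieSpan ⟨x, rfl⟩

theorem mul_sub_mem_Lib {a b : QX Γ} (ha : a ∈ Lib Γ) (hb : b ∈ Lib Γ) :
    a * b - b * a ∈ Lib Γ := (Lib Γ).lie_mem ha hb

variable (Γ) in
/-- The Lie algebra `(𝔏𝔦𝔟(X), ⟨,⟩)`: the vector space `𝔏𝔦𝔟(X)`, to be equipped with the Ihara
bracket below, in place of the commutator. -/
def IharaLib : Type _ := Lib Γ

instance : AddCommGroup (IharaLib Γ) := inferInstanceAs (AddCommGroup (Lib Γ))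

instance : Module ℚ (IharaLib Γ) := inferInstanceAs (Module ℚ (Lib Γ))

variable (Γ) in
/-- The inclusion of `𝔏𝔦𝔟(X)` in `ℚ⟨X⟩`. -/
def incl : IharaLib Γ →ₗ[ℚ] QX Γ := (Lib Γ).toSubmodule.subtype

theorem incl_injective : Function.Injective (incl Γ) := Subtype.val_injective

variable [CommGroup Γ]

/-- The action `t_σ` of `σ ∈ Γ` on `ℚ⟨X⟩`: the algebra morphism with `x₀ ↦ x₀` and
`x_γ ↦ x_{σγ}`. -/
def tAct (σ : Γ) : QX Γ →ₐ[ℚ] QX Γ :=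
  FreeAlgebra.lift ℚ fun
    | none => FreeAlgebra.ι ℚ none
    | some γ => FreeAlgebra.ι ℚ (some (σ * γ))

/-- The derivation `d_ψ` of `ℚ⟨X⟩` with `x₀ ↦ 0` and `x_σ ↦ [x_σ, t_σ(ψ)]`. -/
def dDer (ψ : QX Γ) : QX Γ →ₗ[ℚ] QX Γ :=
  der fun
    | none => 0
    | some σ => FreeAlgebra.ι ℚ (some σ) * tAct σ ψ - tAct σ ψ * FreeAlgebra.ι ℚ (some σ)

/-- The linear endomorphism `s_ψ : v ↦ ψ v + d_ψ(v)` of `ℚ⟨X⟩`. -/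
def sAct (ψ : QX Γ) : QX Γ →ₗ[ℚ] QX Γ := LinearMap.mulLeft ℚ ψ + dDer ψ

/-- The Ihara bracket `⟨ψ₁, ψ₂⟩ = s_{ψ₁}(ψ₂) - s_{ψ₂}(ψ₁)`. -/
def ihara (ψ₁ ψ₂ : QX Γ) : QX Γ := sAct ψ₁ ψ₂ - sAct ψ₂ ψ₁

theorem tAct_none (σ : Γ) : tAct σ (FreeAlgebra.ι ℚ none) = FreeAlgebra.ι ℚ none := by
  simp [tAct]

theorem tAct_some (σ γ : Γ) :
    tAct σ (FreeAlgebra.ι ℚ (some γ)) = FreeAlgebra.ι ℚ (some (σ * γ)) := by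
  simp [tAct]

theorem tAct_tAct (σ τ : Γ) (v : QX Γ) : tAct σ (tAct τ v) = tAct (σ * τ) v := by
  have h : (tAct σ).comp (tAct τ) = tAct (σ * τ) := by
    ext x
    cases x <;> simp [tAct_none, tAct_some, mul_assoc]
  exact DFunLike.congr_fun h v

theorem dDer_none (ψ : QX Γ) : dDer ψ (FreeAlgebra.ι ℚ none) = 0 := by
  simp [dDer, der_ι]

theorem dDer_some (ψ : QX Γ) (σ : Γ) : dDer ψ (FreeAlgebra.ι ℚ (some σ)) =
    FreeAlgebra.ι ℚ (some σ) * tAct σ ψ - tAct σ ψ * FreeAlgebra.ι ℚ (some σ) := by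
  simp [dDer, der_ι]

theorem dDer_mul (ψ u v : QX Γ) : dDer ψ (u * v) = dDer ψ u * v + u * dDer ψ v :=
  der_mul _ u v

theorem dDer_algebraMap (ψ : QX Γ) (r : ℚ) : dDer ψ (algebraMap ℚ _ r) = 0 :=
  der_algebraMap _ r

theorem dDer_add_left (a b v : QX Γ) : dDer (a + b) v = dDer a v + dDer b v := by
  induction v using FreeAlgebra.induction with
  | grade0 r => simp [dDer_algebraMap]
  | grade1 x => cases x <;> simp [dDer_none, dDer_some]; noncomm_ring
  | mul u v hu hv => simp only [dDer_mul, hu, hv]; noncomm_ring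
  | add u v hu hv => simp only [map_add, hu, hv]; abel

theorem dDer_smul_left (c : ℚ) (a v : QX Γ) : dDer (c • a) v = c • dDer a v := by
  induction v using FreeAlgebra.induction with
  | grade0 r => simp [dDer_algebraMap]
  | grade1 x => cases x <;> simp [dDer_none, dDer_some, smul_sub]
  | mul u v hu hv => simp [dDer_mul, hu, hv]
  | add u v hu hv => simp [hu, hv]

theorem dDer_sub_left (a b v : QX Γ) : dDer (a - b) v = dDer a v - dDer b v := by
  rw [eq_sub_iff_add_eq, ← dDer_add_left, sub_add_cancel]

theorem tAct_dDer (σ : Γ) (ψ v : QX Γ) : tAct σ (dDer ψ v) = dDer ψ (tAct σ v) := by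
  induction v using FreeAlgebra.induction with
  | grade0 r => simp [dDer_algebraMap]
  | grade1 x => cases x <;> simp [dDer_none, dDer_some, tAct_none, tAct_some, tAct_tAct]
  | mul u v hu hv => simp only [dDer_mul, map_mul, map_add, hu, hv]
  | add u v hu hv => simp only [map_add, hu, hv]

theorem ihara_eq (a b : QX Γ) : ihara a b = a * b - b * a + (dDer a b - dDer b a) := by
  simp only [ihara, sAct, LinearMap.add_apply, LinearMap.mulLeft_apply]
  abel

theorem dDer_ihara (a b v : QX Γ) :
    dDer (ihara a b) v = dDer a (dDer b v) - dDer b (dDer a v) := by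
  induction v using FreeAlgebra.induction with
  | grade0 r => simp [dDer_algebraMap]
  | grade1 x =>
    cases x with
    | none => simp [dDer_none]
    | some σ =>
      simp only [dDer_some, ihara_eq, map_add, map_sub, map_mul, dDer_mul, tAct_dDer]
      noncomm_ring
  | mul u v hu hv => simp only [dDer_mul, map_add, hu, hv]; noncomm_ring
  | add u v hu hv => simp only [map_add, hu, hv]; abel

theorem ihara_jacobi (a b c : QX Γ) :
    ihara a (ihara b c) = ihara (ihara a b) c + ihara b (ihara a c) := by
  rw [ihara_eq a (ihara b c), ihara_eq (ihara a b) c, ihara_eq b (ihara a c)]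
  simp only [dDer_ihara]
  simp only [ihara_eq, map_add, map_sub, dDer_mul]
  noncomm_ring

theorem tAct_mem_Lib (σ : Γ) {v : QX Γ} (hv : v ∈ Lib Γ) : tAct σ v ∈ Lib Γ := by
  have h : Lib Γ ≤ (Lib Γ).comap (tAct σ).toLieHom := by
    refine LieSubalgebra.lieSpan_le.2 ?_
    rintro _ ⟨x, rfl⟩
    change tAct σ (FreeAlgebra.ι ℚ x) ∈ Lib Γ
    cases x with
    | none => rw [tAct_none]; exact ι_mem_Lib _
    | some γ => rw [tAct_some]; exact ι_mem_Lib _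
  exact h hv

theorem dDer_mem_Lib {ψ v : QX Γ} (hψ : ψ ∈ Lib Γ) (hv : v ∈ Lib Γ) : dDer ψ v ∈ Lib Γ := by
  let K : LieSubalgebra ℚ (QX Γ) :=
    { (Lib Γ).toSubmodule ⊓ (Lib Γ).toSubmodule.comap (dDer ψ) with
      lie_mem' := by
        rintro a b ⟨ha, ha'⟩ ⟨hb, hb'⟩
        refine ⟨(Lib Γ).lie_mem ha hb, ?_⟩
        change dDer ψ (a * b - b * a) ∈ Lib Γ
        have e : dDer ψ (a * b - b * a) =
            (dDer ψ a * b - b * dDer ψ a) + (a * dDer ψ b - dDer ψ b * a) := by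
          simp only [map_sub, dDer_mul]
          abel
        rw [e]
        exact add_mem (mul_sub_mem_Lib ha' hb) (mul_sub_mem_Lib ha hb') }
  have h : Lib Γ ≤ K := by
    refine LieSubalgebra.lieSpan_le.2 ?_
    rintro _ ⟨x, rfl⟩
    refine ⟨ι_mem_Lib x, ?_⟩
    change dDer ψ (FreeAlgebra.ι ℚ x) ∈ Lib Γ
    cases x with
    | none => rw [dDer_none]; exact zero_mem _
    | some γ => rw [dDer_some]; exact mul_sub_mem_Lib (ι_mem_Lib _) (tAct_mem_Lib γ hψ)
  exact (h hv).2

theorem ihara_mem_Lib {a b : QX Γ} (ha : a ∈ Lib Γ) (hb : b ∈ Lib Γ) : ihara a b ∈ Lib Γ := by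
  rw [ihara_eq]
  exact add_mem (mul_sub_mem_Lib ha hb) (sub_mem (dDer_mem_Lib ha hb) (dDer_mem_Lib hb ha))

instance : Bracket (IharaLib Γ) (IharaLib Γ) :=
  ⟨fun a b => ⟨ihara (incl Γ a) (incl Γ b), ihara_mem_Lib a.2 b.2⟩⟩

theorem incl_lie (a b : IharaLib Γ) : incl Γ ⁅a, b⁆ = ihara (incl Γ a) (incl Γ b) := rfl

instance : LieRing (IharaLib Γ) where
  add_lie a b c := incl_injective <| by
    simp only [incl_lie, ihara_eq, map_add, dDer_add_left]
    noncomm_ring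
  lie_add a b c := incl_injective <| by
    simp only [incl_lie, ihara_eq, map_add, dDer_add_left]
    noncomm_ring
  lie_self a := incl_injective <| by
    simp [incl_lie, ihara_eq]
  leibniz_lie a b c := incl_injective <| by
    rw [map_add, incl_lie, incl_lie, incl_lie, incl_lie, incl_lie, incl_lie, ihara_jacobi]

instance : LieAlgebra ℚ (IharaLib Γ) where
  lie_smul c a b := incl_injective <| by
    simp only [incl_lie, ihara_eq, map_smul, dDer_smul_left, mul_smul_comm, smul_mul_assoc,
      smul_add, smul_sub]

end Ihara

section DoubleShuffle

variable {Γ : Type*} [CommGroup Γ]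

/-- The value of `π_Y` on the word `x₀^k w`: read `w` from left to right, where `k` is the number
of letters `x₀` since the last letter `x_σ`; each block `x₀^{n-1} x_σ` becomes `y_{n,σ}`, and a
word which ends in `x₀` is sent to `0`. -/
def piYWord : ℕ → List (XLetter Γ) → QY Γ
  | 0, [] => 1
  | _ + 1, [] => 0
  | k, none :: w => piYWord (k + 1) w
  | k, some σ :: w => FreeAlgebra.ι ℚ (k.succPNat, σ) * piYWord 0 w

/-- The linear map `π_Y : ℚ⟨X⟩ → ℚ⟨Y⟩`. -/
def piY : QX Γ →ₗ[ℚ] QY Γ := onWords (piYWord 0)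

open Classical in
/-- The linear map `corr : ℚ⟨X⟩ → ℚ⟨Y⟩` which sends the word `x₀^{n-1} x₁` to
`((-1)^{n-1}/n) y_{1,1}^n` for `n ≥ 1`, and every other word to `0`. -/
def corr : QX Γ →ₗ[ℚ] QY Γ :=
  onWords fun w =>
    if w ≠ [] ∧ w = List.replicate (w.length - 1) none ++ [some 1] then
      ((-1) ^ (w.length - 1) / (w.length : ℚ)) • FreeAlgebra.ι ℚ ((1 : ℕ+), (1 : Γ)) ^ w.length
    else 0

/-- The word `y_{s₁,σ₁τ⁻¹} y_{s₂,σ₂σ₁⁻¹} ⋯ y_{s_r,σ_rσ_{r-1}⁻¹}`, for the word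
`y_{s₁,σ₁} ⋯ y_{s_r,σ_r}`. -/
def qList : Γ → List (YLetter Γ) → List (YLetter Γ)
  | _, [] => []
  | τ, (s, σ) :: w => (s, σ * τ⁻¹) :: qList σ w

/-- The linear map `𝐪 : ℚ⟨Y⟩ → ℚ⟨Y⟩` with `1 ↦ 1` and
`y_{s₁,σ₁} ⋯ y_{s_r,σ_r} ↦ y_{s₁,σ₁} y_{s₂,σ₂σ₁⁻¹} ⋯ y_{s_r,σ_rσ_{r-1}⁻¹}`. -/
def qMap : QY Γ →ₗ[ℚ] QY Γ := onWords fun w => word (qList 1 w)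

/-- The linear map `ψ ↦ ψ_* = 𝐪(π_Y(ψ)) + corr(ψ)`. -/
def lowerStar : QX Γ →ₗ[ℚ] QY Γ := qMap ∘ₗ piY + corr

/-- The harmonic coproduct `Δ_* : ℚ⟨Y⟩ → ℚ⟨Y⟩ ⊗ ℚ⟨Y⟩`: the algebra morphism which sends
`y_{n,σ}` to `y_{n,σ} ⊗ 1 + 1 ⊗ y_{n,σ} + ∑ y_{n',σ'} ⊗ y_{n'',σ''}`, the sum over
`n' + n'' = n` with `n', n'' > 0` and `σ' σ'' = σ`; here `(n'', σ'') = (n - n', σ'⁻¹ σ)`. -/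
def harmonicCoproduct [Fintype Γ] : QY Γ →ₐ[ℚ] QY Γ ⊗[ℚ] QY Γ :=
  FreeAlgebra.lift ℚ fun y =>
    FreeAlgebra.ι ℚ y ⊗ₜ[ℚ] 1 + 1 ⊗ₜ[ℚ] FreeAlgebra.ι ℚ y +
      ∑ n' ∈ Finset.Ico 1 y.1, ∑ σ' : Γ,
        FreeAlgebra.ι ℚ (n', σ') ⊗ₜ[ℚ] FreeAlgebra.ι ℚ (y.1 - n', σ'⁻¹ * y.2)

variable (Γ) in
/-- `𝔡𝔪𝔯`: the `ψ ∈ 𝔏𝔦𝔟(X)` with `(ψ|x₀) = (ψ|x₁) = 0` and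
`Δ_*(ψ_*) = ψ_* ⊗ 1 + 1 ⊗ ψ_*`. -/
def dmr [Fintype Γ] : Submodule ℚ (IharaLib Γ) where
  carrier := {ψ |
    coeff [none] (incl Γ ψ) = 0 ∧ coeff [some 1] (incl Γ ψ) = 0 ∧
    harmonicCoproduct (lowerStar (incl Γ ψ)) =
      lowerStar (incl Γ ψ) ⊗ₜ[ℚ] 1 + 1 ⊗ₜ[ℚ] lowerStar (incl Γ ψ)}
  add_mem' := by
    rintro a b ⟨ha, ha', ha''⟩ ⟨hb, hb', hb''⟩
    refine ⟨by simp [ha, hb], by simp [ha', hb'], ?_⟩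
    simp only [map_add, ha'', hb'', TensorProduct.add_tmul, TensorProduct.tmul_add]
    abel
  zero_mem' := by simp
  smul_mem' := by
    rintro c a ⟨ha, ha', ha''⟩
    refine ⟨by simp [ha], by simp [ha'], ?_⟩
    simp only [map_smul, ha'', smul_add, TensorProduct.smul_tmul', TensorProduct.tmul_smul]

/-- The condition `(ψ_*|y_{n,σ}) + (-1)^n (ψ_*|y_{n,σ⁻¹}) = 0` on `ψ`. -/
def ParityCondition (n : ℕ+) (σ : Γ) (ψ : IharaLib Γ) : Prop :=
  coeff [(n, σ)] (lowerStar (incl Γ ψ)) + (-1) ^ (n : ℕ) * coeff [(n, σ⁻¹)] (lowerStar (incl Γ ψ)) = 0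

variable (Γ) in
/-- `𝔡𝔪𝔯₀`: the `ψ ∈ 𝔡𝔪𝔯` which satisfy the parity condition for `n = 1` and all `σ ∈ Γ` if
`|Γ| ≥ 3`, and for `(n, σ) = (2, 1)` if `|Γ| ≤ 2`. -/
def dmr₀ [Fintype Γ] : Submodule ℚ (IharaLib Γ) where
  carrier := {ψ | ψ ∈ dmr Γ ∧
    (3 ≤ Fintype.card Γ → ∀ σ : Γ, ParityCondition 1 σ ψ) ∧
    (Fintype.card Γ ≤ 2 → ParityCondition 2 (1 : Γ) ψ)}
  add_mem' := by
    rintro a b ⟨ha, ha', ha''⟩ ⟨hb, hb', hb''⟩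
    refine ⟨add_mem ha hb, fun h σ => ?_, fun h => ?_⟩
    · have h1 := ha' h σ
      have h2 := hb' h σ
      simp only [ParityCondition, map_add] at h1 h2 ⊢
      linear_combination h1 + h2
    · have h1 := ha'' h
      have h2 := hb'' h
      simp only [ParityCondition, map_add] at h1 h2 ⊢
      linear_combination h1 + h2
  zero_mem' := by simp [ParityCondition]
  smul_mem' := by
    rintro c a ⟨ha, ha', ha''⟩
    refine ⟨Submodule.smul_mem _ c ha, fun h σ => ?_, fun h => ?_⟩
    · have h1 := ha' h σ
      simp only [ParityCondition, map_smul, smul_eq_mul] at h1 ⊢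
      linear_combination c * h1
    · have h1 := ha'' h
      simp only [ParityCondition, map_smul, smul_eq_mul] at h1 ⊢
      linear_combination c * h1

end DoubleShuffle

end

end DoubleShuffle

/-! Write θ for `theta`, that is 𝐪 ∘ π_Y, and D_ψ for `iharaDer ψ`, a derivation of ℚ⟨Y⟩. Under θ
the action s_ψ becomes D_ψ plus right multiplication by θψ (`theta_sAct`), so that θ⟨ψ,φ⟩ = D_ψ(θφ)
− D_φ(θψ) − [θψ,θφ]. This is primitive for Δ_* as soon as θψ, θφ are primitive and D_ψ, D_φ are
coderivations. Adding a suitable polynomial in x₁ to ψ (`corrected`) turns θψ into ψ_* and does not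
change the bracket (`ihara_corrected`). The bracket contains no word x₀^n or x₀^n x_g
(`deep_ihara`), so its own correction term vanishes and the parity conditions hold trivially.

It remains to see that D_ψ is a coderivation (`Balanced.coderivationAt_ι`). Sorting the words of ψ
by the letters x₀ at their ends gives D_ψ(y_{m,g}) = ∑ (P_{i,a} y_{m+i,a⁻¹g} − y_{m+i,a⁻¹g} Q_{i,a})
with P_{i,a} and Q_{i,a} primitive. With y_{0,g} = δ_{g,1} and y_{m,g} = 0 for m < 0, the coproduct
of a letter is a convolution, and D_ψ is a coderivation if the formula holds for all integers m. For
m ≤ 0 it says that its right side vanishes, and this follows from a symmetry between the last and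
the first letters of ψ: `endDefect ψ g = 0`.

This symmetry comes from the double shuffle hypothesis. The antipode of the harmonic Hopf algebra,
applied to the primitive element ψ_*, relates the first letters of ψ to its last letters up to the
involution x₀ ↔ y₀ = ∑ x_σ − x₀ and an error k(x₁) (`EndRelation`). One then studies the Lie
polynomial `specialDefect ψ`. Stripped at both ends, it yields the end defects or k, according to
the strips used. It has no linear part, so every derivation with scalar values on the letters kills
it. This forces k to have degree at most one (`EndRelation.coeff_eq_zero`). The constant term of k
vanishes by evenness of p(T) + p(−T), where p is `corrPoly ψ`, and the linear one by a computation
in degree two if |Γ| ≥ 3 (`EndRelation.coeff_one_eq_zero`), by the parity condition otherwise. Once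
k = 0, the derivations x_c ↦ y₀ show that each end defect is a polynomial in x₀ (`yder_endDefect`),
scalar derivations reduce it to a constant, and the constant is zero by the parity condition in
degree one, or because g = g⁻¹ when |Γ| ≤ 2. -/

namespace DoubleShuffle

set_option linter.unusedSectionVars false

noncomputable section

/-! ### Removing the first or the last letter of words. -/

section Strip

variable {A : Type*}

theorem word_nil : word ([] : List A) = 1 := rfl

theorem word_cons (a : A) (w : List A) : word (a :: w) = FreeAlgebra.ι ℚ a * word w := by
  simp [word]

theorem word_append (v w : List A) : word (v ++ w) = word v * word w := by
  simp [word]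

theorem word_singleton (a : A) : word [a] = FreeAlgebra.ι ℚ a := by
  simp [word]

theorem induction_words {P : FreeAlgebra ℚ A → Prop} (word_mem : ∀ w, P (word w))
    (add : ∀ u v, P u → P v → P (u + v)) (smul : ∀ (c : ℚ) v, P v → P (c • v)) (v) : P v := by
  have h0 : P 0 := by simpa using smul 0 _ (word_mem [])
  have hv := (FreeAlgebra.basisFreeMonoid ℚ A).mem_span v
  induction hv using Submodule.span_induction with
  | mem x hx =>
    obtain ⟨w, rfl⟩ := hx
    exact (basis_apply w.toList) ▸ word_mem w.toList
  | zero => exact h0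
  | add x y _ _ hx hy => exact add x y hx hy
  | smul c x _ hx => exact smul c x hx

theorem left_induction {P : FreeAlgebra ℚ A → Prop} (one : P 1)
    (ι_mul : ∀ a v, P v → P (FreeAlgebra.ι ℚ a * v))
    (add : ∀ u v, P u → P v → P (u + v)) (smul : ∀ (c : ℚ) v, P v → P (c • v)) (v) : P v := by
  induction v using induction_words with
  | word_mem w =>
    induction w with
    | nil => exact one
    | cons a w ih => rw [word_cons]; exact ι_mul _ _ ih
  | add u v hu hv => exact add u v hu hv
  | smul c v hv => exact smul c v hv

theorem right_induction {P : FreeAlgebra ℚ A → Prop} (one : P 1)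
    (mul_ι : ∀ a v, P v → P (v * FreeAlgebra.ι ℚ a))
    (add : ∀ u v, P u → P v → P (u + v)) (smul : ∀ (c : ℚ) v, P v → P (c • v)) (v) : P v := by
  induction v using induction_words with
  | word_mem w =>
    induction w using List.reverseRecOn with
    | nil => exact one
    | append_singleton w a ih => rw [word_append, word_singleton]; exact mul_ι _ _ ih
  | add u v hu hv => exact add u v hu hv
  | smul c v hv => exact smul c v hv

/-- The constant term of a noncommutative polynomial. -/
def cst : FreeAlgebra ℚ A →ₐ[ℚ] ℚ := FreeAlgebra.lift ℚ fun _ => 0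

@[simp] theorem cst_ι (a : A) : cst (FreeAlgebra.ι ℚ a) = 0 := by simp [cst]

open Classical in
/-- The linear map which removes the first letter of a word if it is `a`, and kills the other
words. -/
def lStrip (a : A) : FreeAlgebra ℚ A →ₗ[ℚ] FreeAlgebra ℚ A :=
  onWords fun
    | [] => 0
    | b :: w => if b = a then word w else 0

open Classical in
/-- The linear map which removes the last letter of a word if it is `a`, and kills the other
words. -/
def rStrip (a : A) : FreeAlgebra ℚ A →ₗ[ℚ] FreeAlgebra ℚ A :=
  onWords fun w =>
    match w.reverse with
    | [] => 0
    | b :: u => if b = a then word u.reverse else 0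

@[simp] theorem lStrip_one (a : A) : lStrip a 1 = 0 := by
  rw [← word_nil, lStrip, onWords_word]

@[simp] theorem rStrip_one (a : A) : rStrip a 1 = 0 := by
  rw [← word_nil, rStrip, onWords_word]; rfl

@[simp] theorem lStrip_algebraMap (a : A) (r : ℚ) : lStrip a (algebraMap ℚ _ r) = 0 := by
  rw [Algebra.algebraMap_eq_smul_one, map_smul, lStrip_one, smul_zero]

@[simp] theorem rStrip_algebraMap (a : A) (r : ℚ) : rStrip a (algebraMap ℚ _ r) = 0 := by
  rw [Algebra.algebraMap_eq_smul_one, map_smul, rStrip_one, smul_zero]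

open Classical in
theorem lStrip_ι_mul (a b : A) (v : FreeAlgebra ℚ A) :
    lStrip a (FreeAlgebra.ι ℚ b * v) = if b = a then v else 0 := by
  induction v using induction_words with
  | word_mem w => rw [← word_cons, lStrip, onWords_word]
  | add u v hu hv => rw [mul_add, map_add, hu, hv]; split_ifs <;> simp
  | smul c v hv => rw [mul_smul_comm, map_smul, hv]; split_ifs <;> simp

open Classical in
theorem rStrip_mul_ι (a b : A) (v : FreeAlgebra ℚ A) :
    rStrip a (v * FreeAlgebra.ι ℚ b) = if b = a then v else 0 := by
  induction v using induction_words with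
  | word_mem w =>
    rw [← word_singleton, ← word_append, rStrip, onWords_word]
    simp
  | add u v hu hv => rw [add_mul, map_add, hu, hv]; split_ifs <;> simp
  | smul c v hv => rw [smul_mul_assoc, map_smul, hv]; split_ifs <;> simp

/-- Fox calculus: the first letter of a product comes from the left factor unless the word taken
there is empty. -/
theorem lStrip_mul (a : A) (u v : FreeAlgebra ℚ A) :
    lStrip a (u * v) = lStrip a u * v + cst u • lStrip a v := by
  classical
  induction u using left_induction with
  | one => simp
  | ι_mul b u _ => rw [mul_assoc, lStrip_ι_mul, lStrip_ι_mul]; split_ifs <;> simp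
  | add x y hx hy => simp only [add_mul, map_add, hx, hy, add_smul]; abel
  | smul c x hx =>
    simp only [smul_mul_assoc, map_smul, hx, smul_add, smul_eq_mul, mul_smul]

theorem rStrip_mul (a : A) (u v : FreeAlgebra ℚ A) :
    rStrip a (u * v) = u * rStrip a v + cst v • rStrip a u := by
  classical
  induction v using right_induction with
  | one => simp
  | mul_ι b u _ => rw [← mul_assoc, rStrip_mul_ι, rStrip_mul_ι]; split_ifs <;> simp
  | add x y hx hy => simp only [mul_add, map_add, hx, hy, add_smul]; abel
  | smul c x hx =>
    simp only [mul_smul_comm, map_smul, hx, smul_add, smul_eq_mul, mul_smul]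

open Classical in
theorem lStrip_ι (a b : A) : lStrip a (FreeAlgebra.ι ℚ b) = if b = a then 1 else 0 := by
  simpa using lStrip_ι_mul a b 1

open Classical in
theorem rStrip_ι (a b : A) : rStrip a (FreeAlgebra.ι ℚ b) = if b = a then 1 else 0 := by
  simpa using rStrip_mul_ι a b 1

theorem lStrip_rStrip (a b : A) (v : FreeAlgebra ℚ A) :
    lStrip a (rStrip b v) = rStrip b (lStrip a v) := by
  classical
  induction v using right_induction with
  | one => simp
  | mul_ι c v _ =>
    rw [rStrip_mul_ι, lStrip_mul, map_add, rStrip_mul_ι, map_smul, lStrip_ι]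
    split_ifs <;> simp
  | add x y hx hy => simp only [map_add, hx, hy]
  | smul c x hx => simp only [map_smul, hx]

theorem eq_sum_rStrip [Fintype A] (v : FreeAlgebra ℚ A) :
    v = ∑ a, rStrip a v * FreeAlgebra.ι ℚ a + algebraMap ℚ _ (cst v) := by
  classical
  induction v using right_induction with
  | one => simp
  | mul_ι c v _ => simp [rStrip_mul_ι, ite_mul]
  | add x y hx hy =>
    simp only [map_add, add_mul, Finset.sum_add_distrib]
    nth_rewrite 1 [hx, hy]
    abel
  | smul c x hx =>
    simp only [map_smul, smul_mul_assoc, ← Finset.smul_sum, smul_eq_mul, map_mul,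
      ← Algebra.smul_def, ← smul_add]
    rw [← hx]

theorem eq_sum_lStrip [Fintype A] (v : FreeAlgebra ℚ A) :
    v = ∑ a, FreeAlgebra.ι ℚ a * lStrip a v + algebraMap ℚ _ (cst v) := by
  classical
  induction v using left_induction with
  | one => simp
  | ι_mul c v _ => simp [lStrip_ι_mul, mul_ite]
  | add x y hx hy =>
    simp only [map_add, mul_add, Finset.sum_add_distrib]
    nth_rewrite 1 [hx, hy]
    abel
  | smul c x hx =>
    simp only [map_smul, mul_smul_comm, ← Finset.smul_sum, smul_eq_mul, map_mul,
      ← Algebra.smul_def, ← smul_add]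
    rw [← hx]

theorem coeff_nil (v : FreeAlgebra ℚ A) : coeff [] v = cst v := by
  classical
  induction v using induction_words with
  | word_mem w => rw [coeff_word]; cases w <;> simp [word_nil, word_cons]
  | add x y hx hy => simp only [map_add, hx, hy]
  | smul c x hx => simp only [map_smul, hx]

theorem coeff_cons (a : A) (w : List A) (v : FreeAlgebra ℚ A) :
    coeff (a :: w) v = coeff w (lStrip a v) := by
  classical
  induction v using induction_words with
  | word_mem u =>
    rw [coeff_word]
    cases u with
    | nil => simp [word_nil]
    | cons b u =>
      rw [word_cons, lStrip_ι_mul]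
      split_ifs <;> simp_all [coeff_word]
  | add x y hx hy => simp only [map_add, hx, hy]
  | smul c x hx => simp only [map_smul, hx]

theorem coeff_append_singleton (a : A) (w : List A) (v : FreeAlgebra ℚ A) :
    coeff (w ++ [a]) v = coeff w (rStrip a v) := by
  induction w generalizing v with
  | nil =>
    rw [List.nil_append, coeff_cons, coeff_nil, coeff_nil]
    classical
    induction v using induction_words with
    | word_mem w =>
      induction w using List.reverseRecOn with
      | nil => simp [word_nil]
      | append_singleton w b ih =>
        rw [word_append, word_singleton, rStrip_mul_ι, lStrip_mul, lStrip_ι]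
        split_ifs <;> simp
    | add x y hx hy => simp only [map_add, hx, hy]
    | smul c x hx => simp only [map_smul, hx]
  | cons b w ih => rw [List.cons_append, coeff_cons, ih, coeff_cons, lStrip_rStrip]

theorem eq_zero_of_coeff (v : FreeAlgebra ℚ A) (h : ∀ w, coeff w v = 0) : v = 0 := by
  refine (FreeAlgebra.basisFreeMonoid ℚ A).ext_elem fun w => ?_
  rw [map_zero]
  exact h w.toList

/-- Induction on the degree: the vectors obtained from `v` by removing the last letter are of
lower degree. -/
theorem strip_induction {P : FreeAlgebra ℚ A → Prop} (zero : P 0)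
    (step : ∀ v, (∀ a, P (rStrip a v)) → P v) (v) : P v := by
  have key : ∀ (n : ℕ) v, (∀ w : List A, n ≤ w.length → coeff w v = 0) → P v := by
    intro n
    induction n with
    | zero => intro v hv; rw [eq_zero_of_coeff v fun w => hv w (Nat.zero_le _)]; exact zero
    | succ n ih =>
      intro v hv
      refine step v fun a => ih _ fun w hw => ?_
      rw [← coeff_append_singleton]
      exact hv _ (by simpa using hw)
  have hs : ∃ n : ℕ, ∀ w : List A, n ≤ w.length → coeff w v = 0 := by
    classical
    induction v using induction_words with
    | word_mem u =>
      refine ⟨u.length + 1, fun w hw => ?_⟩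
      rw [coeff_word, if_neg]
      rintro rfl
      omega
    | add x y hx hy =>
      obtain ⟨m, hm⟩ := hx
      obtain ⟨n, hn⟩ := hy
      refine ⟨max m n, fun w hw => ?_⟩
      rw [map_add, hm w (le_trans (le_max_left _ _) hw), hn w (le_trans (le_max_right _ _) hw),
        add_zero]
    | smul c x hx =>
      obtain ⟨m, hm⟩ := hx
      exact ⟨m, fun w hw => by rw [map_smul, hm w hw, smul_zero]⟩
  obtain ⟨n, hn⟩ := hs
  exact key n v hn

theorem eq_zero_of_strips [Fintype A] (v : FreeAlgebra ℚ A) (h : ∀ a, rStrip a v = 0)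
    (h0 : cst v = 0) : v = 0 := by
  rw [eq_sum_rStrip v]
  simp [h, h0]

/-- The hypothesis `hD` says that each `D b` is a linear form in the letters with coefficients `d a
b`. Such a derivation preserves the degree, and it fails to commute with a strip only where it acts
on the last letter. -/
theorem rStrip_der (D : A → FreeAlgebra ℚ A) [Fintype A] (d : A → A → ℚ)
    (hD : ∀ a b v, rStrip a (v * D b) = d a b • v) (a : A) (v : FreeAlgebra ℚ A) :
    rStrip a (der D v) = der D (rStrip a v) + ∑ b, d a b • rStrip b v := by
  classical
  induction v using right_induction with
  | one => rw [← map_one (algebraMap ℚ _), der_algebraMap]; simp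
  | mul_ι c v _ =>
    rw [der_mul, map_add, rStrip_mul_ι, rStrip_mul_ι, der_ι, hD]
    simp only [rStrip_mul_ι, smul_ite, smul_zero, Finset.sum_ite_eq, Finset.mem_univ, if_true]
    split_ifs <;> simp
  | add x y hx hy => simp only [map_add, hx, hy, smul_add, Finset.sum_add_distrib]; abel
  | smul c x hx =>
    simp only [map_smul, hx, smul_add, Finset.smul_sum, smul_comm c]

theorem lStrip_der (D : A → FreeAlgebra ℚ A) [Fintype A] (d : A → A → ℚ)
    (hD : ∀ a b v, lStrip a (D b * v) = d a b • v) (a : A) (v : FreeAlgebra ℚ A) :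
    lStrip a (der D v) = der D (lStrip a v) + ∑ b, d a b • lStrip b v := by
  classical
  induction v using left_induction with
  | one => rw [← map_one (algebraMap ℚ _), der_algebraMap]; simp
  | ι_mul c v _ =>
    rw [der_mul, map_add, lStrip_ι_mul, lStrip_ι_mul, der_ι, hD]
    simp only [lStrip_ι_mul, smul_ite, smul_zero, Finset.sum_ite_eq, Finset.mem_univ, if_true]
    split_ifs <;> simp [add_comm]
  | add x y hx hy => simp only [map_add, hx, hy, smul_add, Finset.sum_add_distrib]; abel
  | smul c x hx =>
    simp only [map_smul, hx, smul_add, Finset.smul_sum, smul_comm c]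

/-- The derivation which sends each letter `a` to the scalar `d a`. -/
def sder (d : A → ℚ) : FreeAlgebra ℚ A →ₗ[ℚ] FreeAlgebra ℚ A :=
  der fun a => algebraMap ℚ _ (d a)

theorem sder_ι (d : A → ℚ) (a : A) : sder d (FreeAlgebra.ι ℚ a) = algebraMap ℚ _ (d a) :=
  der_ι _ _

theorem sder_mul (d : A → ℚ) (u v : FreeAlgebra ℚ A) :
    sder d (u * v) = sder d u * v + u * sder d v := der_mul _ _ _

@[simp] theorem sder_one (d : A → ℚ) : sder d 1 = 0 := by
  rw [← map_one (algebraMap ℚ (FreeAlgebra ℚ A))]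
  exact der_algebraMap _ _

/-- The extra term arises when the derivation consumes the last letter, so that the letter before it
becomes the last one. -/
theorem rStrip_sder [Fintype A] (d : A → ℚ) (a : A) (v : FreeAlgebra ℚ A) :
    rStrip a (sder d v) = sder d (rStrip a v) + rStrip a (∑ b, d b • rStrip b v) := by
  classical
  induction v using right_induction with
  | one => simp
  | mul_ι c v _ =>
    rw [sder_mul, map_add, rStrip_mul_ι, rStrip_mul_ι, sder_ι, ← Algebra.commutes,
      ← Algebra.smul_def, map_smul]
    simp only [rStrip_mul_ι, smul_ite, smul_zero, Finset.sum_ite_eq, Finset.mem_univ, if_true,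
      map_smul]
    split_ifs <;> simp
  | add x y hx hy => simp only [map_add, hx, hy, smul_add, Finset.sum_add_distrib]; abel
  | smul c x hx =>
    simp only [map_smul, hx, smul_add, Finset.smul_sum, smul_comm c, map_sum]

theorem lStrip_sder [Fintype A] (d : A → ℚ) (a : A) (v : FreeAlgebra ℚ A) :
    lStrip a (sder d v) = sder d (lStrip a v) + lStrip a (∑ b, d b • lStrip b v) := by
  classical
  induction v using left_induction with
  | one => simp
  | ι_mul c v _ =>
    rw [sder_mul, map_add, lStrip_ι_mul, lStrip_ι_mul, sder_ι, ← Algebra.smul_def, map_smul]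
    simp only [lStrip_ι_mul, smul_ite, smul_zero, Finset.sum_ite_eq, Finset.mem_univ, if_true,
      map_smul]
    split_ifs <;> simp [add_comm]
  | add x y hx hy => simp only [map_add, hx, hy, smul_add, Finset.sum_add_distrib]; abel
  | smul c x hx =>
    simp only [map_smul, hx, smul_add, Finset.smul_sum, smul_comm c, map_sum]

theorem cst_sder [Fintype A] (d : A → ℚ) (v : FreeAlgebra ℚ A) :
    cst (sder d v) = cst (∑ b, d b • rStrip b v) := by
  classical
  induction v using right_induction with
  | one => simp
  | mul_ι c v _ =>
    rw [sder_mul, sder_ι]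
    simp [rStrip_mul_ι, mul_comm]
  | add x y hx hy => simp only [map_add, hx, hy, smul_add, Finset.sum_add_distrib]
  | smul c x hx => simp only [map_smul, hx, smul_comm _ c, ← Finset.smul_sum]

end Strip

/-! ### Antimorphisms, the antipode and the adjoint action. -/

section Anti

variable {A : Type*}

/-- The antimorphism of the free algebra with prescribed values on the letters. -/
def antiLift (f : A → FreeAlgebra ℚ A) : FreeAlgebra ℚ A →ₗ[ℚ] FreeAlgebra ℚ A :=
  (MulOpposite.opLinearEquiv ℚ).symm.toLinearMap ∘ₗ
    (FreeAlgebra.lift ℚ fun a => MulOpposite.op (f a)).toLinearMap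

@[simp] theorem antiLift_ι (f : A → FreeAlgebra ℚ A) (a : A) :
    antiLift f (FreeAlgebra.ι ℚ a) = f a := by
  simp [antiLift]

@[simp] theorem antiLift_one (f : A → FreeAlgebra ℚ A) : antiLift f 1 = 1 := by
  simp [antiLift]

theorem antiLift_mul (f : A → FreeAlgebra ℚ A) (u v : FreeAlgebra ℚ A) :
    antiLift f (u * v) = antiLift f v * antiLift f u := by
  simp [antiLift]

/-- The antipode of the free algebra: the antimorphism which sends each letter to its
opposite. -/
def antipode : FreeAlgebra ℚ A →ₗ[ℚ] FreeAlgebra ℚ A := antiLift fun a => -FreeAlgebra.ι ℚ a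

theorem lStrip_antipode (a : A) (v : FreeAlgebra ℚ A) :
    lStrip a (antipode v) = -antipode (rStrip a v) := by
  classical
  induction v using right_induction with
  | one => simp [antipode]
  | mul_ι b v _ =>
    rw [antipode, antiLift_mul, antiLift_ι, neg_mul, map_neg, lStrip_ι_mul, rStrip_mul_ι]
    split_ifs <;> simp
  | add x y hx hy => simp only [map_add, hx, hy]; abel
  | smul c x hx => simp only [map_smul, hx, smul_neg]

/-- The adjoint action of the free algebra on itself: letters act by commutators. -/
def adHom : FreeAlgebra ℚ A →ₐ[ℚ] Module.End ℚ (FreeAlgebra ℚ A) :=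
  FreeAlgebra.lift ℚ fun a =>
    LinearMap.mulLeft ℚ (FreeAlgebra.ι ℚ a) - LinearMap.mulRight ℚ (FreeAlgebra.ι ℚ a)

theorem adHom_ι (a : A) (v : FreeAlgebra ℚ A) :
    adHom (FreeAlgebra.ι ℚ a) v = FreeAlgebra.ι ℚ a * v - v * FreeAlgebra.ι ℚ a := by
  simp [adHom]

theorem adHom_one (v : FreeAlgebra ℚ A) : adHom v 1 = algebraMap ℚ _ (cst v) := by
  induction v using right_induction with
  | one => simp
  | mul_ι a v _ => simp [adHom_ι]
  | add x y hx hy => simp only [map_add, LinearMap.add_apply, hx, hy]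
  | smul c x hx =>
    rw [map_smul, LinearMap.smul_apply, hx, map_smul, smul_eq_mul, map_mul, Algebra.smul_def]

end Anti

/-! ### Lie polynomials. -/

section Lib

attribute [local instance] LieRing.ofAssociativeRing

variable {Γ : Type*}

theorem smul_mem_Lib (c : ℚ) {v : QX Γ} (hv : v ∈ Lib Γ) : c • v ∈ Lib Γ :=
  (Lib Γ).smul_mem c hv

theorem Lib_induction {P : (v : QX Γ) → v ∈ Lib Γ → Prop}
    (ι : ∀ a, P (FreeAlgebra.ι ℚ a) (ι_mem_Lib a))
    (add : ∀ u v hu hv, P u hu → P v hv → P (u + v) (add_mem hu hv))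
    (smul : ∀ (c : ℚ) v hv, P v hv → P (c • v) (smul_mem_Lib c hv))
    (lie : ∀ u v hu hv, P u hu → P v hv → P (u * v - v * u) (mul_sub_mem_Lib hu hv))
    {v : QX Γ} (hv : v ∈ Lib Γ) : P v hv := by
  refine LieSubalgebra.lieSpan_induction (p := P) (mem := ?_) (zero := ?_) (add := add)
    (smul := smul) (lie := lie) (hx := hv)
  · rintro _ ⟨a, rfl⟩
    exact ι a
  · simpa using smul 0 _ _ (ι none)

theorem cst_of_mem_Lib {v : QX Γ} (hv : v ∈ Lib Γ) : cst v = 0 := by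
  induction hv using Lib_induction with
  | ι a => simp
  | add u v _ _ hu hv => simp [hu, hv]
  | smul c v _ hv => simp [hv]
  | lie u v _ _ hu hv => simp [hu, hv]

theorem adHom_of_mem_Lib {f : QX Γ} (hf : f ∈ Lib Γ) (v : QX Γ) :
    adHom f v = f * v - v * f := by
  induction hf using Lib_induction generalizing v with
  | ι a => rw [adHom_ι]
  | add x y _ _ hx hy => rw [map_add, LinearMap.add_apply, hx, hy]; noncomm_ring
  | smul c x _ hx => rw [map_smul, LinearMap.smul_apply, hx]; simp [smul_sub]
  | lie x y _ _ hx hy =>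
    rw [map_sub, map_mul, map_mul, LinearMap.sub_apply, Module.End.mul_apply,
      Module.End.mul_apply]
    simp only [hx, hy]
    noncomm_ring

/-- Both sides obey the Leibniz rule for brackets: Lie polynomials have no constant term, so a last
letter of `u * v` is stripped from `v`, and multiplication by `u` becomes `ad u`. -/
theorem der_of_mem_Lib [Fintype Γ] (D : XLetter Γ → QX Γ) {f : QX Γ} (hf : f ∈ Lib Γ) :
    der D f = ∑ b, adHom (rStrip b f) (D b) := by
  classical
  induction hf using Lib_induction with
  | ι a =>
    rw [der_ι, Finset.sum_eq_single a (fun b _ hb => by rw [rStrip_ι, if_neg hb.symm]; simp)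
      (by simp)]
    simp [rStrip_ι]
  | add x y _ _ hx hy => simp only [map_add, LinearMap.add_apply, hx, hy, Finset.sum_add_distrib]
  | smul c x _ hx => simp only [map_smul, LinearMap.smul_apply, hx, Finset.smul_sum]
  | lie x y hx' hy' hx hy =>
    have h : ∀ u ∈ Lib Γ, ∀ v ∈ Lib Γ, ∑ b, adHom (rStrip b (u * v)) (D b)
        = u * ∑ b, adHom (rStrip b v) (D b) - (∑ b, adHom (rStrip b v) (D b)) * u := by
      intro u hu v hv
      rw [Finset.mul_sum, Finset.sum_mul, ← Finset.sum_sub_distrib]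
      refine Finset.sum_congr rfl fun b _ => ?_
      rw [rStrip_mul, cst_of_mem_Lib hv, zero_smul, add_zero, map_mul, Module.End.mul_apply,
        adHom_of_mem_Lib hu]
    simp only [map_sub, LinearMap.sub_apply, Finset.sum_sub_distrib, h x hx' y hy',
      h y hy' x hx', ← hx, ← hy, der_mul]
    noncomm_ring

/-- The adjoint action kills scalars, so only the linear part of a Lie polynomial contributes. -/
theorem sder_of_mem_Lib [Fintype Γ] (d : XLetter Γ → ℚ) {f : QX Γ} (hf : f ∈ Lib Γ) :
    sder d f = algebraMap ℚ _ (cst (∑ b, d b • rStrip b f)) := by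
  rw [sder, der_of_mem_Lib _ hf]
  simp only [Algebra.algebraMap_eq_smul_one, map_smul, adHom_one, map_sum]
  simp [smul_smul]

theorem antipode_of_mem_Lib {f : QX Γ} (hf : f ∈ Lib Γ) : antipode f = -f := by
  induction hf using Lib_induction with
  | ι a => simp [antipode]
  | add x y _ _ hx hy => rw [map_add, hx, hy]; abel
  | smul c x _ hx => rw [map_smul, hx, smul_neg]
  | lie x y _ _ hx hy =>
    unfold antipode at *
    rw [map_sub, antiLift_mul, antiLift_mul, hx, hy]
    noncomm_ring

theorem lStrip_of_mem_Lib {f : QX Γ} (hf : f ∈ Lib Γ) (a : XLetter Γ) :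
    lStrip a f = antipode (rStrip a f) := by
  have h := lStrip_antipode a f
  rw [antipode_of_mem_Lib hf, map_neg, neg_inj] at h
  exact h

end Lib

/-! ### Translations, the element y₀ and the involution exchanging x₀ and y₀. -/

section Letters

variable {Γ : Type*} [CommGroup Γ]

theorem rStrip_tAct_some (σ b : Γ) (v : QX Γ) :
    rStrip (some b) (tAct σ v) = tAct σ (rStrip (some (σ⁻¹ * b)) v) := by
  classical
  induction v using right_induction with
  | one => simp
  | mul_ι c v _ =>
    cases c with
    | none => simp [tAct_none, rStrip_mul_ι]
    | some c =>
      simp only [map_mul, tAct_some, rStrip_mul_ι, Option.some_inj, eq_inv_mul_iff_mul_eq]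
      split_ifs <;> simp
  | add x y hx hy => simp only [map_add, hx, hy]
  | smul c x hx => simp only [map_smul, hx]

theorem rStrip_tAct_none (σ : Γ) (v : QX Γ) :
    rStrip none (tAct σ v) = tAct σ (rStrip none v) := by
  classical
  induction v using right_induction with
  | one => simp
  | mul_ι c v _ => cases c <;> simp [tAct_none, tAct_some, rStrip_mul_ι]
  | add x y hx hy => simp only [map_add, hx, hy]
  | smul c x hx => simp only [map_smul, hx]

theorem lStrip_tAct_some (σ b : Γ) (v : QX Γ) :
    lStrip (some b) (tAct σ v) = tAct σ (lStrip (some (σ⁻¹ * b)) v) := by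
  classical
  induction v using left_induction with
  | one => simp
  | ι_mul c v _ =>
    cases c with
    | none => simp [tAct_none, lStrip_ι_mul]
    | some c =>
      simp only [map_mul, tAct_some, lStrip_ι_mul, Option.some_inj, eq_inv_mul_iff_mul_eq]
      split_ifs <;> simp
  | add x y hx hy => simp only [map_add, hx, hy]
  | smul c x hx => simp only [map_smul, hx]

theorem lStrip_tAct_none (σ : Γ) (v : QX Γ) :
    lStrip none (tAct σ v) = tAct σ (lStrip none v) := by
  classical
  induction v using left_induction with
  | one => simp
  | ι_mul c v _ => cases c <;> simp [tAct_none, tAct_some, lStrip_ι_mul]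
  | add x y hx hy => simp only [map_add, hx, hy]
  | smul c x hx => simp only [map_smul, hx]

@[simp] theorem cst_tAct (σ : Γ) (v : QX Γ) : cst (tAct σ v) = cst v := by
  have h : cst.comp (tAct σ) = cst := by
    ext x
    cases x <;> simp [tAct_none, tAct_some]
  exact DFunLike.congr_fun h v

@[simp] theorem tAct_one_left (v : QX Γ) : tAct 1 v = v := by
  have h : tAct (1 : Γ) = AlgHom.id ℚ _ := by
    ext x
    cases x <;> simp [tAct_none, tAct_some]
  exact DFunLike.congr_fun h v

theorem tAct_inv_self (σ : Γ) (v : QX Γ) : tAct σ⁻¹ (tAct σ v) = v := by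
  rw [tAct_tAct, inv_mul_cancel, tAct_one_left]

theorem tAct_self_inv (σ : Γ) (v : QX Γ) : tAct σ (tAct σ⁻¹ v) = v := by
  rw [tAct_tAct, mul_inv_cancel, tAct_one_left]

theorem tAct_antipode (σ : Γ) (v : QX Γ) : tAct σ (antipode v) = antipode (tAct σ v) := by
  unfold antipode
  induction v using left_induction with
  | one => simp
  | ι_mul c v hv => cases c <;> simp [antiLift_mul, hv, tAct_none, tAct_some]
  | add x y hx hy => simp only [map_add, hx, hy]
  | smul c x hx => simp only [map_smul, hx]

variable [Fintype Γ]

variable (Γ) in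
/-- The element `y₀ = ∑ x_σ - x₀`. -/
def yInf : QX Γ := ∑ σ : Γ, FreeAlgebra.ι ℚ (some σ) - FreeAlgebra.ι ℚ none

theorem yInf_mem_Lib : yInf Γ ∈ Lib Γ :=
  sub_mem (sum_mem fun _ _ => ι_mem_Lib _) (ι_mem_Lib _)

@[simp] theorem cst_yInf : cst (yInf Γ) = 0 := cst_of_mem_Lib yInf_mem_Lib

@[simp] theorem tAct_yInf (σ : Γ) : tAct σ (yInf Γ) = yInf Γ := by
  simp only [yInf, map_sub, map_sum, tAct_none, tAct_some]
  congr 1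
  exact Fintype.sum_equiv (Equiv.mulLeft σ) _ _ fun _ => rfl

@[simp] theorem rStrip_none_mul_yInf (v : QX Γ) : rStrip none (v * yInf Γ) = -v := by
  classical
  simp [yInf, mul_sub, Finset.mul_sum, rStrip_mul_ι]

@[simp] theorem rStrip_some_mul_yInf (b : Γ) (v : QX Γ) :
    rStrip (some b) (v * yInf Γ) = v := by
  classical
  simp [yInf, mul_sub, Finset.mul_sum, rStrip_mul_ι]

@[simp] theorem lStrip_none_yInf_mul (v : QX Γ) : lStrip none (yInf Γ * v) = -v := by
  classical
  simp [yInf, sub_mul, Finset.sum_mul, lStrip_ι_mul]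

@[simp] theorem lStrip_some_yInf_mul (b : Γ) (v : QX Γ) :
    lStrip (some b) (yInf Γ * v) = v := by
  classical
  simp [yInf, sub_mul, Finset.sum_mul, lStrip_ι_mul]

@[simp] theorem rStrip_some_yInf (b : Γ) : rStrip (some b) (yInf Γ) = 1 := by
  simpa using rStrip_some_mul_yInf b 1

@[simp] theorem rStrip_none_yInf : rStrip none (yInf Γ) = -1 := by
  simpa using rStrip_none_mul_yInf (1 : QX Γ)

@[simp] theorem lStrip_some_yInf (b : Γ) : lStrip (some b) (yInf Γ) = 1 := by
  simpa using lStrip_some_yInf_mul b 1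

@[simp] theorem lStrip_none_yInf : lStrip none (yInf Γ) = -1 := by
  simpa using lStrip_none_yInf_mul (1 : QX Γ)

/-- The sum of the maps which remove a last letter `x_b` and a last letter `x₀`. -/
def rSum (b : Γ) : QX Γ →ₗ[ℚ] QX Γ := rStrip (some b) + rStrip none

/-- The sum of the maps which remove a first letter `x_b` and a first letter `x₀`. -/
def lSum (b : Γ) : QX Γ →ₗ[ℚ] QX Γ := lStrip (some b) + lStrip none

theorem rSum_apply (b : Γ) (v : QX Γ) : rSum b v = rStrip (some b) v + rStrip none v := rfl

theorem lSum_apply (b : Γ) (v : QX Γ) : lSum b v = lStrip (some b) v + lStrip none v := rfl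

@[simp] theorem rSum_mul_yInf (b : Γ) (v : QX Γ) : rSum b (v * yInf Γ) = 0 := by
  simp [rSum_apply]

@[simp] theorem lSum_yInf_mul (b : Γ) (v : QX Γ) : lSum b (yInf Γ * v) = 0 := by
  simp [lSum_apply]

@[simp] theorem rSum_yInf (b : Γ) : rSum b (yInf Γ) = 0 := by
  simp [rSum_apply]

@[simp] theorem lSum_yInf (b : Γ) : lSum b (yInf Γ) = 0 := by
  simp [lSum_apply]

theorem rSum_mul (b : Γ) (u v : QX Γ) : rSum b (u * v) = u * rSum b v + cst v • rSum b u := by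
  simp only [rSum_apply, rStrip_mul, mul_add, smul_add]
  abel

theorem lSum_mul (b : Γ) (u v : QX Γ) : lSum b (u * v) = lSum b u * v + cst u • lSum b v := by
  simp only [lSum_apply, lStrip_mul, add_mul, smul_add]
  abel

theorem rSum_tAct (σ b : Γ) (v : QX Γ) : rSum b (tAct σ v) = tAct σ (rSum (σ⁻¹ * b) v) := by
  simp [rSum_apply, rStrip_tAct_none, rStrip_tAct_some]

theorem lSum_tAct (σ b : Γ) (v : QX Γ) : lSum b (tAct σ v) = tAct σ (lSum (σ⁻¹ * b) v) := by
  simp [lSum_apply, lStrip_tAct_none, lStrip_tAct_some]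

variable (Γ) in
/-- The involution of `ℚ⟨X⟩` with `x₀ ↦ y₀` and `x_σ ↦ x_{σ⁻¹}`. -/
def swap : QX Γ →ₐ[ℚ] QX Γ :=
  FreeAlgebra.lift ℚ fun
    | none => yInf Γ
    | some σ => FreeAlgebra.ι ℚ (some σ⁻¹)

@[simp] theorem swap_none : swap Γ (FreeAlgebra.ι ℚ none) = yInf Γ := by simp [swap]

@[simp] theorem swap_some (σ : Γ) :
    swap Γ (FreeAlgebra.ι ℚ (some σ)) = FreeAlgebra.ι ℚ (some σ⁻¹) := by simp [swap]

@[simp] theorem swap_yInf : swap Γ (yInf Γ) = FreeAlgebra.ι ℚ none := by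
  have h : ∑ σ : Γ, (FreeAlgebra.ι ℚ (some σ⁻¹) : QX Γ) = ∑ σ : Γ, FreeAlgebra.ι ℚ (some σ) :=
    Fintype.sum_equiv (Equiv.inv Γ) _ _ fun _ => rfl
  rw [yInf, map_sub, map_sum, swap_none, yInf]
  simp [h]

theorem swap_swap (v : QX Γ) : swap Γ (swap Γ v) = v := by
  have h : (swap Γ).comp (swap Γ) = AlgHom.id ℚ _ := by
    ext x
    cases x <;> simp
  exact DFunLike.congr_fun h v

theorem swap_tAct (σ : Γ) (v : QX Γ) : swap Γ (tAct σ v) = tAct σ⁻¹ (swap Γ v) := by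
  have h : (swap Γ).comp (tAct σ) = (tAct σ⁻¹).comp (swap Γ) := by
    ext x
    cases x <;> simp [tAct_none, tAct_some, mul_comm]
  exact DFunLike.congr_fun h v

@[simp] theorem cst_swap (v : QX Γ) : cst (swap Γ v) = cst v := by
  have h : cst.comp (swap Γ) = cst := by
    ext x
    cases x <;> simp
  exact DFunLike.congr_fun h v

theorem swap_mem_Lib {v : QX Γ} (hv : v ∈ Lib Γ) : swap Γ v ∈ Lib Γ := by
  induction hv using Lib_induction with
  | ι a =>
    cases a with
    | none => rw [swap_none]; exact yInf_mem_Lib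
    | some a => rw [swap_some]; exact ι_mem_Lib _
  | add x y _ _ hx hy => rw [map_add]; exact add_mem hx hy
  | smul c x _ hx => rw [map_smul]; exact smul_mem_Lib c hx
  | lie x y _ _ hx hy =>
    rw [map_sub, map_mul, map_mul]
    exact mul_sub_mem_Lib hx hy

/-- In terms of the free generators y₀ and x_σ one has x₀ = ∑ x_σ − y₀, so `rSum b` is the removal
of a last x_b for these generators. The involution exchanges the two systems of generators. -/
theorem rSum_swap (b : Γ) (v : QX Γ) : rSum b (swap Γ v) = swap Γ (rStrip (some b⁻¹) v) := by
  classical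
  induction v using right_induction with
  | one => simp [rSum_apply]
  | mul_ι c v _ =>
    cases c with
    | none => simp [rStrip_mul_ι]
    | some c => by_cases h : c = b⁻¹ <;> simp [rStrip_mul_ι, rSum_apply, inv_eq_iff_eq_inv, h]
  | add x y hx hy => simp only [map_add, hx, hy]
  | smul c x hx => simp only [map_smul, hx]

theorem lSum_swap (b : Γ) (v : QX Γ) : lSum b (swap Γ v) = swap Γ (lStrip (some b⁻¹) v) := by
  classical
  induction v using left_induction with
  | one => simp [lSum_apply]
  | ι_mul c v _ =>
    cases c with
    | none => simp [lStrip_ι_mul]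
    | some c => by_cases h : c = b⁻¹ <;> simp [lStrip_ι_mul, lSum_apply, inv_eq_iff_eq_inv, h]
  | add x y hx hy => simp only [map_add, hx, hy]
  | smul c x hx => simp only [map_smul, hx]

theorem rStrip_swap (b : Γ) (v : QX Γ) :
    rStrip (some b) (swap Γ v) = swap Γ (rSum b⁻¹ v) := by
  classical
  induction v using right_induction with
  | one => simp [rSum_apply]
  | mul_ι c v _ =>
    cases c with
    | none => simp [rStrip_mul_ι, rSum_apply]
    | some c => by_cases h : c = b⁻¹ <;> simp [rStrip_mul_ι, rSum_apply, inv_eq_iff_eq_inv, h]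
  | add x y hx hy => simp only [map_add, hx, hy]
  | smul c x hx => simp only [map_smul, hx]

end Letters

/-! ### Polynomials in a single letter. -/

section PolyLetter

open Polynomial

variable {A : Type*}

theorem rStrip_aeval_self (a : A) (f : ℚ[X]) :
    rStrip a (aeval (FreeAlgebra.ι ℚ a) f) = aeval (FreeAlgebra.ι ℚ a) f.divX := by
  nth_rewrite 1 [← divX_mul_X_add f]
  simp [rStrip_mul_ι]

theorem lStrip_aeval_self (a : A) (f : ℚ[X]) :
    lStrip a (aeval (FreeAlgebra.ι ℚ a) f) = aeval (FreeAlgebra.ι ℚ a) f.divX := by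
  nth_rewrite 1 [← X_mul_divX_add f]
  rw [map_add, map_mul, aeval_X, map_add, lStrip_ι_mul]
  simp

theorem rStrip_aeval_of_ne {a b : A} (h : b ≠ a) (f : ℚ[X]) :
    rStrip b (aeval (FreeAlgebra.ι ℚ a) f) = 0 := by
  rw [← divX_mul_X_add f]
  simp [rStrip_mul_ι, h.symm]

theorem lStrip_aeval_of_ne {a b : A} (h : b ≠ a) (f : ℚ[X]) :
    lStrip b (aeval (FreeAlgebra.ι ℚ a) f) = 0 := by
  rw [← X_mul_divX_add f, map_add, map_mul, aeval_X, map_add, lStrip_ι_mul, if_neg h.symm]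
  simp

theorem sder_aeval (d : A → ℚ) (a : A) (f : ℚ[X]) :
    sder d (aeval (FreeAlgebra.ι ℚ a) f) = d a • aeval (FreeAlgebra.ι ℚ a) f.derivative := by
  induction f using Polynomial.induction_on' with
  | add p q hp hq => simp only [map_add, hp, hq, smul_add]
  | monomial n c =>
    rw [← C_mul_X_pow_eq_monomial]
    have h : ∀ n : ℕ, sder d (FreeAlgebra.ι ℚ a ^ n)
        = (d a * n) • FreeAlgebra.ι ℚ a ^ (n - 1) := by
      intro n
      induction n with
      | zero => simp
      | succ n ih =>
        rw [pow_succ, sder_mul, ih, sder_ι, ← Algebra.commutes, ← Algebra.smul_def,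
          smul_mul_assoc, ← pow_succ]
        rcases n with _ | n
        · simp
        · rw [Nat.add_sub_cancel, Nat.add_sub_cancel, ← add_smul]
          congr 1
          push_cast
          ring
    rw [derivative_C_mul_X_pow, ← smul_eq_C_mul, ← smul_eq_C_mul, map_smul, map_smul, map_smul,
      aeval_X_pow, aeval_X_pow, h, smul_smul, smul_smul]
    congr 1
    ring

theorem aeval_ι_injective (a : A) :
    Function.Injective (aeval (R := ℚ) (FreeAlgebra.ι ℚ a) : ℚ[X] → FreeAlgebra ℚ A) := by
  have h : (FreeAlgebra.lift ℚ fun _ => (X : ℚ[X])).comp (aeval (FreeAlgebra.ι ℚ a))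
      = AlgHom.id ℚ ℚ[X] := by
    ext
    simp
  exact Function.LeftInverse.injective fun f => DFunLike.congr_fun h f

end PolyLetter

/-! ### The special defect, and a bound on the degree of the error k. -/

section Special

open Polynomial

variable {Γ : Type*} [CommGroup Γ] [Fintype Γ]

open Classical in
/-- The derivation with `x_c ↦ 1` which kills the other letters. -/
def pder (c : Γ) : QX Γ →ₗ[ℚ] QX Γ :=
  sder fun
    | none => 0
    | some b => if b = c then 1 else 0

open Classical in
/-- The derivation with `x_c ↦ 1` and `x₀ ↦ 1` which kills the other letters. -/
def pderSum (c : Γ) : QX Γ →ₗ[ℚ] QX Γ :=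
  sder fun
    | none => 1
    | some b => if b = c then 1 else 0

theorem rStrip_pder (a : XLetter Γ) (c : Γ) (v : QX Γ) :
    rStrip a (pder c v) = pder c (rStrip a v) + rStrip a (rStrip (some c) v) := by
  classical
  rw [pder, rStrip_sder]
  simp [-map_sum]

theorem lStrip_pder (a : XLetter Γ) (c : Γ) (v : QX Γ) :
    lStrip a (pder c v) = pder c (lStrip a v) + lStrip a (lStrip (some c) v) := by
  classical
  rw [pder, lStrip_sder]
  simp [-map_sum]

theorem rStrip_pderSum (a : XLetter Γ) (c : Γ) (v : QX Γ) :
    rStrip a (pderSum c v) = pderSum c (rStrip a v) + rStrip a (rSum c v) := by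
  classical
  rw [pderSum, rStrip_sder]
  simp [-map_sum, rSum_apply, add_comm]

theorem lStrip_pderSum (a : XLetter Γ) (c : Γ) (v : QX Γ) :
    lStrip a (pderSum c v) = pderSum c (lStrip a v) + lStrip a (lSum c v) := by
  classical
  rw [pderSum, lStrip_sder]
  simp [-map_sum, lSum_apply, add_comm]

theorem rSum_pder (a c : Γ) (v : QX Γ) :
    rSum a (pder c v) = pder c (rSum a v) + rSum a (rStrip (some c) v) := by
  simp only [rSum_apply, rStrip_pder, map_add]
  abel

theorem rSum_pderSum (a c : Γ) (v : QX Γ) :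
    rSum a (pderSum c v) = pderSum c (rSum a v) + rSum a (rSum c v) := by
  simp only [rSum_apply, rStrip_pderSum, map_add]
  abel

theorem lSum_pderSum (a c : Γ) (v : QX Γ) :
    lSum a (pderSum c v) = pderSum c (lSum a v) + lSum a (lSum c v) := by
  simp only [lSum_apply, lStrip_pderSum, map_add]
  abel

theorem lSum_rSum (a b : Γ) (v : QX Γ) : lSum a (rSum b v) = rSum b (lSum a v) := by
  simp only [lSum_apply, rSum_apply, map_add, lStrip_rStrip]
  abel

theorem lStrip_rSum (a : XLetter Γ) (b : Γ) (v : QX Γ) :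
    lStrip a (rSum b v) = rSum b (lStrip a v) := by
  simp only [rSum_apply, map_add, lStrip_rStrip]

/-- The defect `Z_g` of the symmetry between the right and left ends of the words of `ψ`. -/
def endDefect (ψ : QX Γ) (g : Γ) : QX Γ := rSum g ψ - tAct g (lSum g⁻¹ ψ)

/-- The Lie polynomial `∑ [x_σ, t_σ(ψ)] - [y₀, ψ - swap ψ]`. -/
def specialDefect (ψ : QX Γ) : QX Γ :=
  ∑ σ : Γ, (FreeAlgebra.ι ℚ (some σ) * tAct σ ψ - tAct σ ψ * FreeAlgebra.ι ℚ (some σ)) -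
    (yInf Γ * (ψ - swap Γ ψ) - (ψ - swap Γ ψ) * yInf Γ)

variable {ψ : QX Γ}

theorem specialDefect_mem_Lib (hψ : ψ ∈ Lib Γ) : specialDefect ψ ∈ Lib Γ :=
  sub_mem (sum_mem fun σ _ => mul_sub_mem_Lib (ι_mem_Lib _) (tAct_mem_Lib σ hψ))
    (mul_sub_mem_Lib yInf_mem_Lib (sub_mem hψ (swap_mem_Lib hψ)))

/-- All terms are brackets of Lie polynomials, hence there is no linear part. -/
theorem sder_specialDefect (d : XLetter Γ → ℚ) (hψ : ψ ∈ Lib Γ) :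
    sder d (specialDefect ψ) = 0 := by
  have h : ∀ a, cst (rStrip a (specialDefect ψ)) = 0 := by
    intro a
    simp [specialDefect, rStrip_mul, cst_of_mem_Lib hψ]
  rw [sder_of_mem_Lib d (specialDefect_mem_Lib hψ)]
  simp [h]

theorem rStrip_specialDefect (hψ : ψ ∈ Lib Γ) (b : Γ) :
    rStrip (some b) (specialDefect ψ) =
      ∑ σ : Γ, FreeAlgebra.ι ℚ (some σ) * tAct σ (rStrip (some (σ⁻¹ * b)) ψ) - tAct b ψ -
        yInf Γ * rStrip (some b) (ψ - swap Γ ψ) + (ψ - swap Γ ψ) := by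
  classical
  simp only [specialDefect, map_sub, map_sum, rStrip_mul, rStrip_ι, cst_tAct,
    cst_of_mem_Lib hψ, rStrip_tAct_some, rStrip_some_yInf, cst_yInf]
  simp only [cst_of_mem_Lib hψ, cst_ι, zero_smul, add_zero, Option.some_inj, mul_ite, mul_one, mul_zero,
    Finset.sum_sub_distrib, Finset.sum_ite_eq', Finset.mem_univ, if_true, cst_swap,
    sub_zero]
  abel

theorem rSum_specialDefect (hψ : ψ ∈ Lib Γ) (b : Γ) :
    rSum b (specialDefect ψ) =
      ∑ σ : Γ, FreeAlgebra.ι ℚ (some σ) * tAct σ (rSum (σ⁻¹ * b) ψ) - tAct b ψ -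
        yInf Γ * rSum b (ψ - swap Γ ψ) := by
  classical
  have h : ∀ σ, rSum b (FreeAlgebra.ι ℚ (some σ)) = if σ = b then 1 else 0 := by
    intro σ
    simp [rSum_apply, rStrip_ι]
  simp only [specialDefect, map_sub, map_sum, rSum_mul, h, cst_tAct,
    cst_of_mem_Lib hψ, rSum_tAct, rSum_yInf, cst_yInf]
  simp only [cst_of_mem_Lib hψ, cst_ι, zero_smul, mul_zero, add_zero, mul_ite, mul_one,
    Finset.sum_sub_distrib, Finset.sum_ite_eq', Finset.mem_univ, if_true, cst_swap,
    sub_zero]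

/-- The sums kill y₀ at either end, so the bracket with y₀ disappears. Of the other brackets there
remain the one with x_a in front and the one with x_b at the end; their difference is a translated
end defect. -/
theorem lSum_rSum_specialDefect (hψ : ψ ∈ Lib Γ) (a b : Γ) :
    lSum a (rSum b (specialDefect ψ)) = tAct a (endDefect ψ (a⁻¹ * b)) := by
  classical
  have h : ∀ σ, lSum a (FreeAlgebra.ι ℚ (some σ)) = if σ = a then 1 else 0 := by
    intro σ
    simp [lSum_apply, lStrip_ι]
  rw [rSum_specialDefect hψ, endDefect]
  simp only [map_sub, map_sum, lSum_mul, h, lSum_yInf, cst_yInf, lSum_tAct, cst_ι, zero_smul, add_zero,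
    ite_mul, one_mul, zero_mul, Finset.sum_ite_eq', Finset.mem_univ, if_true, sub_zero, tAct_tAct,
    mul_inv_cancel_left, mul_inv_rev, inv_inv]

/-- The relation between the two ends of the words of `ψ`, up to a polynomial `k` in `x₁`, which
comes from the antipode of the harmonic Hopf algebra. -/
def EndRelation (ψ : QX Γ) (k : ℚ[X]) : Prop :=
  lStrip (some 1) ψ = swap Γ (rStrip (some 1) ψ) + aeval (FreeAlgebra.ι ℚ (some (1 : Γ))) k ∧
    ∀ σ : Γ, σ ≠ 1 → lStrip (some σ) ψ = tAct σ (swap Γ (rStrip (some σ) ψ))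

variable {k : ℚ[X]}

theorem swap_aeval_one (f : ℚ[X]) :
    swap Γ (aeval (FreeAlgebra.ι ℚ (some (1 : Γ))) f)
      = aeval (FreeAlgebra.ι ℚ (some (1 : Γ))) f := by
  rw [← aeval_algHom_apply]
  simp

/-- Stripping x₁ from the front y₀ leaves a term in `swap ψ`, which the end relation cancels against
the first letters of ψ, up to k. -/
theorem lStrip_rSum_specialDefect (hψ : ψ ∈ Lib Γ) (h : EndRelation ψ k) :
    lStrip (some 1) (rSum 1 (specialDefect ψ))
      = -aeval (FreeAlgebra.ι ℚ (some (1 : Γ))) k := by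
  classical
  rw [rSum_specialDefect hψ]
  simp only [map_sub, map_sum, lStrip_ι_mul, lStrip_some_yInf_mul, Option.some_inj,
    Finset.sum_ite_eq', Finset.mem_univ, if_true, rSum_swap, tAct_one_left, inv_one, mul_one, h.1]
  abel

theorem lSum_rStrip_specialDefect (hψ : ψ ∈ Lib Γ) (h : EndRelation ψ k) :
    lSum 1 (rStrip (some 1) (specialDefect ψ))
      = -aeval (FreeAlgebra.ι ℚ (some (1 : Γ))) k := by
  classical
  have h' : ∀ σ, lSum (1 : Γ) (FreeAlgebra.ι ℚ (some σ)) = if σ = 1 then 1 else 0 := by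
    intro σ
    simp [lSum_apply, lStrip_ι]
  rw [rStrip_specialDefect hψ]
  simp only [map_add, map_sub, map_sum, lSum_mul, h', lSum_yInf, cst_yInf, lSum_swap, cst_ι, zero_smul,
    add_zero, ite_mul, one_mul, zero_mul, Finset.sum_ite_eq', Finset.mem_univ, if_true,
    tAct_one_left, inv_one, mul_one, h.1, swap_swap, swap_aeval_one]
  simp

/-- The terms without a visible front y₀ are ∑ x_σ t_σ(…) − `swap ψ`. By the end relation this sum
is the part of `swap ψ` that begins with some x_σ, in the generators y₀, x_σ. So the result is left
divisible by y₀. -/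
theorem rStrip_one_specialDefect (hψ : ψ ∈ Lib Γ) (h : EndRelation ψ 0) :
    rStrip (some 1) (specialDefect ψ) =
      -(yInf Γ * (swap Γ (lStrip none ψ) + rStrip (some 1) (ψ - swap Γ ψ))) := by
  classical
  have h1 : ∀ σ : Γ, swap Γ (lStrip (some σ) ψ) = tAct σ⁻¹ (rStrip (some σ) ψ) := by
    intro σ
    by_cases hσ : σ = 1
    · subst hσ
      rw [h.1]
      simp [swap_swap]
    · rw [h.2 σ hσ, swap_tAct, swap_swap]
  have h2 : swap Γ ψ = ∑ σ : Γ, FreeAlgebra.ι ℚ (some σ) * tAct σ (rStrip (some σ⁻¹) ψ)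
      + yInf Γ * swap Γ (lStrip none ψ) := by
    nth_rewrite 1 [eq_sum_lStrip ψ]
    rw [cst_of_mem_Lib hψ, map_zero, add_zero, Fintype.sum_option, map_add, map_mul, swap_none,
      map_sum, add_comm]
    congr 1
    refine Fintype.sum_equiv (Equiv.inv Γ) _ _ fun σ => ?_
    rw [map_mul, swap_some, h1]
    simp
  rw [rStrip_specialDefect hψ]
  simp only [mul_one, tAct_one_left]
  nth_rewrite 2 [h2]
  simp only [map_sub, mul_add]
  abel

/-- The polynomial `k` of the end relation has degree at most one. -/
theorem EndRelation.coeff_eq_zero (hψ : ψ ∈ Lib Γ) (h : EndRelation ψ k) (j : ℕ) :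
    k.coeff (j + 2) = 0 := by
  set x : QX Γ := FreeAlgebra.ι ℚ (some (1 : Γ)) with hx
  set v := specialDefect ψ with hv
  have e1 := lStrip_rSum_specialDefect hψ h
  have e2 := lSum_rStrip_specialDefect hψ h
  rw [← hv, ← hx] at e1 e2
  set B := lStrip (some 1) (rStrip (some 1) v) with hB
  have hp : ∀ f : ℚ[X], pder (1 : Γ) (aeval x f) = aeval x f.derivative := by
    intro f; rw [pder, hx, sder_aeval]; simp
  have hps : ∀ f : ℚ[X], pderSum (1 : Γ) (aeval x f) = aeval x f.derivative := by
    intro f; rw [pderSum, hx, sder_aeval]; simp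
  have hl : ∀ f : ℚ[X], lStrip (some (1 : Γ)) (aeval x f) = aeval x f.divX := by
    intro f; rw [hx, lStrip_aeval_self]
  have hr : ∀ f : ℚ[X], rStrip (some (1 : Γ)) (aeval x f) = aeval x f.divX := by
    intro f; rw [hx, rStrip_aeval_self]
  have hrs : ∀ f : ℚ[X], rSum (1 : Γ) (aeval x f) = aeval x f.divX := by
    intro f; rw [rSum_apply, hx, rStrip_aeval_self, rStrip_aeval_of_ne (by simp), add_zero]
  -- Obtained by stripping the ends of the equality `pder 1 v = 0`; `e4` uses `pderSum 1 v = 0` in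
  -- the same way.
  have e3 : rSum 1 B = aeval x (k.derivative + k.divX) := by
    have h0 : pder (1 : Γ) v = 0 := sder_specialDefect _ hψ
    have h1 : lStrip (some 1) (rSum 1 (pder (1 : Γ) v)) = 0 := by rw [h0]; simp
    rw [rSum_pder, map_add, lStrip_pder, e1, lStrip_rSum, ← hB, map_neg, map_neg, hp, hl] at h1
    rw [map_add]
    rw [← sub_eq_zero]
    refine Eq.trans ?_ h1
    abel
  have e4 : pderSum 1 B = aeval x (k.divX + k.divX) := by
    have h0 : pderSum (1 : Γ) v = 0 := sder_specialDefect _ hψ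
    have h1 : lStrip (some 1) (rStrip (some 1) (pderSum (1 : Γ) v)) = 0 := by rw [h0]; simp
    rw [rStrip_pderSum, map_add, lStrip_pderSum, e2, ← hB, lStrip_rStrip, e1, map_neg, map_neg,
      hl, hr] at h1
    rw [map_add]
    rw [← sub_eq_zero]
    refine Eq.trans ?_ h1
    abel
  -- Comparing the two orders of `rSum` and `pderSum` on B eliminates B and leaves a linear
  -- differential equation for k alone.
  have e5 := rSum_pderSum 1 1 B
  rw [e4, e3, hrs, hps, hrs, ← map_add] at e5
  have e6 := congrArg (fun f => Polynomial.coeff f j) (aeval_ι_injective _ e5)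
  simp only [coeff_divX, coeff_add, coeff_derivative, Nat.cast_add, Nat.cast_one] at e6
  -- The factor equals (j + 1)(j + 4), which is positive.
  have h7 : k.coeff (j + 2) * (((j : ℚ) + 2) * (j + 3) - 2) = 0 := by
    rw [show j + 2 = j + 1 + 1 from rfl]
    linear_combination -e6
  rcases mul_eq_zero.1 h7 with h8 | h8
  · exact h8
  · exfalso
    have : (0 : ℚ) ≤ j := Nat.cast_nonneg j
    nlinarith

end Special

/-! ### The vanishing of the end defects. -/

section EndSymmetry

open Polynomial

variable {Γ : Type*} [CommGroup Γ] [Fintype Γ]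

open Classical in
/-- The derivation with `x_c ↦ y₀` which kills the other letters. -/
def yder (c : Γ) : QX Γ →ₗ[ℚ] QX Γ :=
  der fun
    | none => 0
    | some b => if b = c then yInf Γ else 0

theorem rStrip_none_yder (c : Γ) (v : QX Γ) :
    rStrip none (yder c v) = yder c (rStrip none v) - rStrip (some c) v := by
  classical
  rw [yder, rStrip_der _ fun a b => match b with
    | none => 0
    | some b => if b = c then (match a with | none => -1 | some _ => 1) else 0]
  · simp [Fintype.sum_option, ite_smul, sub_eq_add_neg]
  · rintro (_ | a) (_ | b) v
    · simp
    · by_cases h : b = c <;> simp [h]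
    · simp
    · by_cases h : b = c <;> simp [h]

theorem rStrip_some_yder (b c : Γ) (v : QX Γ) :
    rStrip (some b) (yder c v) = yder c (rStrip (some b) v) + rStrip (some c) v := by
  classical
  rw [yder, rStrip_der _ fun a b => match b with
    | none => 0
    | some b => if b = c then (match a with | none => -1 | some _ => 1) else 0]
  · simp [Fintype.sum_option, ite_smul]
  · rintro (_ | a) (_ | b) v
    · simp
    · by_cases h : b = c <;> simp [h]
    · simp
    · by_cases h : b = c <;> simp [h]

theorem lStrip_none_yder (c : Γ) (v : QX Γ) :
    lStrip none (yder c v) = yder c (lStrip none v) - lStrip (some c) v := by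
  classical
  rw [yder, lStrip_der _ fun a b => match b with
    | none => 0
    | some b => if b = c then (match a with | none => -1 | some _ => 1) else 0]
  · simp [Fintype.sum_option, ite_smul, sub_eq_add_neg]
  · rintro (_ | a) (_ | b) v
    · simp
    · by_cases h : b = c <;> simp [h]
    · simp
    · by_cases h : b = c <;> simp [h]

theorem lStrip_some_yder (b c : Γ) (v : QX Γ) :
    lStrip (some b) (yder c v) = yder c (lStrip (some b) v) + lStrip (some c) v := by
  classical
  rw [yder, lStrip_der _ fun a b => match b with
    | none => 0
    | some b => if b = c then (match a with | none => -1 | some _ => 1) else 0]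
  · simp [Fintype.sum_option, ite_smul]
  · rintro (_ | a) (_ | b) v
    · simp
    · by_cases h : b = c <;> simp [h]
    · simp
    · by_cases h : b = c <;> simp [h]

/-- In y₀ the letters x_b and x₀ have opposite coefficients, so the corrections of the two strips
cancel. -/
theorem rSum_yder (b c : Γ) (v : QX Γ) : rSum b (yder c v) = yder c (rSum b v) := by
  simp only [rSum_apply, rStrip_none_yder, rStrip_some_yder, map_add]
  abel

theorem lSum_yder (b c : Γ) (v : QX Γ) : lSum b (yder c v) = yder c (lSum b v) := by
  simp only [lSum_apply, lStrip_none_yder, lStrip_some_yder, map_add]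
  abel

theorem yder_tAct (σ c : Γ) (v : QX Γ) : yder c (tAct σ v) = tAct σ (yder (σ⁻¹ * c) v) := by
  classical
  unfold yder
  induction v using left_induction with
  | one => rw [map_one, ← map_one (algebraMap ℚ (QX Γ)), der_algebraMap, der_algebraMap, map_zero]
  | ι_mul a v hv =>
    cases a with
    | none => simp only [map_mul, tAct_none, der_mul, der_ι, hv, map_add, map_zero]
    | some a =>
      simp only [map_mul, tAct_some, der_mul, der_ι, hv, map_add, eq_inv_mul_iff_mul_eq]
      split_ifs <;> simp
  | add x y hx hy => simp only [map_add, hx, hy]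
  | smul c x hx => simp only [map_smul, hx]

theorem cst_yder (c : Γ) (v : QX Γ) : cst (yder c v) = 0 := by
  classical
  unfold yder
  induction v using left_induction with
  | one => rw [← map_one (algebraMap ℚ (QX Γ)), der_algebraMap, map_zero]
  | ι_mul a v hv =>
    cases a with
    | none => simp [der_mul, der_ι]
    | some a => simp [der_mul, der_ι, apply_ite cst]
  | add x y hx hy => simp only [map_add, hx, hy, add_zero]
  | smul c x hx => simp only [map_smul, hx, smul_zero]

/-- The derivation `x_c ↦ y₀` has no negative integral eigenvalue. -/
theorem eq_zero_of_yder_add_smul (c : Γ) (v : QX Γ) :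
    ∀ n : ℕ, yder c v + ((n : ℚ) + 1) • v = 0 → v = 0 := by
  induction v using strip_induction with
  | zero => exact fun _ _ => rfl
  | step v ih =>
    intro n hv
    have hn : (n : ℚ) + 1 ≠ 0 := by positivity
    have h1 : rStrip (some c) v = 0 := by
      -- Stripping x_c lowers the eigenvalue from −(n + 1) to −(n + 2). Once this strip is known to
      -- vanish, the other strips keep the eigenvalue.
      refine ih (some c) (n + 1) ?_
      have h := congrArg (rStrip (some c)) hv
      rw [map_add, rStrip_some_yder, map_smul, map_zero] at h
      rw [← h]
      push_cast
      module
    refine eq_zero_of_strips v ?_ ?_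
    · rintro (_ | b)
      · refine ih none n ?_
        have h := congrArg (rStrip none) hv
        rwa [map_add, rStrip_none_yder, h1, sub_zero, map_smul, map_zero] at h
      · refine ih (some b) n ?_
        have h := congrArg (rStrip (some b)) hv
        rwa [map_add, rStrip_some_yder, h1, add_zero, map_smul, map_zero] at h
    · have h := congrArg cst hv
      rw [map_add, cst_yder, map_smul, map_zero, zero_add, smul_eq_mul] at h
      exact (mul_eq_zero.1 h).resolve_left hn

/-- Removing a last x_c yields an eigenvector of `yder c` for the eigenvalue −1, hence zero. Only x₀
can be a last letter, and the induction goes on. -/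
theorem exists_polynomial_of_yder (v : QX Γ) :
    (∀ c : Γ, yder c v = 0) → ∃ f : ℚ[X], v = aeval (FreeAlgebra.ι ℚ none) f := by
  induction v using strip_induction with
  | zero => exact fun _ => ⟨0, by simp⟩
  | step v ih =>
    intro hv
    have h1 : ∀ c : Γ, rStrip (some c) v = 0 := by
      intro c
      refine eq_zero_of_yder_add_smul c _ 0 ?_
      have h := congrArg (rStrip (some c)) (hv c)
      rw [rStrip_some_yder, map_zero] at h
      rw [← h]
      simp
    obtain ⟨f, hf⟩ := ih none fun c => by
      have h := congrArg (rStrip none) (hv c)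
      rwa [rStrip_none_yder, h1, sub_zero, map_zero] at h
    refine ⟨f * X + C (cst v), ?_⟩
    rw [eq_sum_rStrip v, Fintype.sum_option, hf]
    simp [h1]

variable {ψ : QX Γ}

/-- By `der_of_mem_Lib`, the derivation x₁ ↦ y₀ sends the special defect to ad of its x₁-strip,
applied to y₀. That strip is left divisible by y₀, so the image is a bracket with y₀, which the two
sums at the ends kill. -/
theorem yder_endDefect (hψ : ψ ∈ Lib Γ) (h : EndRelation ψ 0) (c g : Γ) :
    yder c (endDefect ψ g) = 0 := by
  classical
  have h1 : ∃ M, yder 1 (specialDefect ψ) = -(yInf Γ * M - M * yInf Γ) := by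
    refine ⟨adHom (swap Γ (lStrip none ψ) + rStrip (some 1) (ψ - swap Γ ψ)) (yInf Γ), ?_⟩
    rw [yder, der_of_mem_Lib _ (specialDefect_mem_Lib hψ), Finset.sum_eq_single (some 1)
      (fun b _ hb => by rcases b with _ | b <;> simp_all) (by simp),
      rStrip_one_specialDefect hψ h, map_neg, map_mul, LinearMap.neg_apply,
      Module.End.mul_apply, adHom_of_mem_Lib yInf_mem_Lib]
    simp
  obtain ⟨M, hM⟩ := h1
  -- These ends produce the translate by c⁻¹ of the end defect at g; moving the translation outside
  -- turns `yder 1` into `yder c`.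
  have h2 : lSum c⁻¹ (rSum (c⁻¹ * g) (yder 1 (specialDefect ψ))) = 0 := by
    rw [hM]
    simp [rSum_mul, lSum_mul]
  rw [rSum_yder, lSum_yder, lSum_rSum_specialDefect hψ, yder_tAct] at h2
  simp only [inv_inv, mul_one, mul_inv_cancel_left] at h2
  have h3 := congrArg (tAct c) h2
  rwa [tAct_self_inv, map_zero] at h3

/-- The symmetry between the right and left ends of the words of `ψ`. -/
theorem endDefect_eq_zero (hψ : ψ ∈ Lib Γ) (h : EndRelation ψ 0)
    (h0 : ∀ g, cst (endDefect ψ g) = 0) (g : Γ) : endDefect ψ g = 0 := by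
  choose F hF using fun g => exists_polynomial_of_yder (endDefect ψ g)
    fun c => yder_endDefect hψ h c g
  set x : QX Γ := FreeAlgebra.ι ℚ none with hx
  have hps : ∀ f : ℚ[X], pderSum (1 : Γ) (aeval x f) = aeval x f.derivative := by
    intro f; rw [pderSum, hx, sder_aeval]; simp
  have hrs : ∀ b (f : ℚ[X]), rSum (b : Γ) (aeval x f) = aeval x f.divX := by
    intro b f; rw [rSum_apply, hx, rStrip_aeval_self, rStrip_aeval_of_ne (by simp), zero_add]
  have hls : ∀ b (f : ℚ[X]), lSum (b : Γ) (aeval x f) = aeval x f.divX := by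
    intro b f; rw [lSum_apply, hx, lStrip_aeval_self, lStrip_aeval_of_ne (by simp), zero_add]
  -- Stripping both ends of `pderSum 1 (specialDefect ψ) = 0` gives a differential equation for the
  -- polynomials F. It is solved first for b = 1, then for all b.
  have hE : ∀ b, (F b).derivative + (F 1).divX + (F b).divX = 0 := by
    intro b
    have h1 : pderSum (1 : Γ) (specialDefect ψ) = 0 := sder_specialDefect _ hψ
    have h2 : lSum 1 (rSum b (pderSum (1 : Γ) (specialDefect ψ))) = 0 := by rw [h1]; simp
    rw [rSum_pderSum, map_add, lSum_pderSum, lSum_rSum 1 b (rSum 1 _)] at h2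
    simp only [lSum_rSum_specialDefect hψ, tAct_one_left, inv_one, one_mul, hF, hps, hrs, hls,
      ← map_add] at h2
    have h3 := aeval_ι_injective _ (h2.trans (map_zero (aeval x)).symm)
    rw [← h3]
    abel
  have hc : ∀ b (n : ℕ), ((n : ℚ) + 2) * (F b).coeff (n + 1) + (F 1).coeff (n + 1) = 0 := by
    intro b n
    have h1 := congrArg (fun f => Polynomial.coeff f n) (hE b)
    simp only [coeff_add, coeff_derivative, coeff_divX, Polynomial.coeff_zero] at h1
    linear_combination h1
  have hz : ∀ b (n : ℕ), (F b).coeff (n + 1) = 0 := by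
    intro b n
    have hn : (0 : ℚ) ≤ n := Nat.cast_nonneg n
    have h1 : (F 1).coeff (n + 1) = 0 := by
      have h1 := hc 1 n
      have h2 : ((n : ℚ) + 3) * (F 1).coeff (n + 1) = 0 := by linear_combination h1
      exact (mul_eq_zero.1 h2).resolve_left (by positivity)
    have h2 := hc b n
    rw [h1, add_zero] at h2
    exact (mul_eq_zero.1 h2).resolve_left (by positivity)
  have hC : F g = C ((F g).coeff 0) := by
    ext n
    rcases n with _ | n
    · simp
    · rw [hz, coeff_C_succ]
  have h1 := h0 g
  rw [hF, hC] at h1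
  rw [hF, hC]
  simp only [aeval_C] at h1 ⊢
  rw [AlgHom.commutes] at h1
  rw [show (F g).coeff 0 = 0 from h1, map_zero]

end EndSymmetry

/-! ### The map θ on blocks x₀^n x_g. -/

section Theta

variable {Γ : Type*} [CommGroup Γ]

theorem tAct_word (σ : Γ) (w : List (XLetter Γ)) :
    tAct σ (word w) = word (w.map (Option.map (σ * ·))) := by
  induction w with
  | nil => simp [word_nil]
  | cons a w ih => cases a <;> simp [word_cons, ih, tAct_none, tAct_some]

/-- Induction on noncommutative polynomials in `X`, by blocks `x₀^n x_g`. -/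
theorem block_induction {P : QX Γ → Prop} (pow : ∀ n, P (FreeAlgebra.ι ℚ none ^ n))
    (block : ∀ n g v, P v →
      P (FreeAlgebra.ι ℚ none ^ n * FreeAlgebra.ι ℚ (some g) * tAct g v))
    (add : ∀ u v, P u → P v → P (u + v)) (smul : ∀ (c : ℚ) v, P v → P (c • v)) (v) : P v := by
  have key : ∀ (m : ℕ) (w : List (XLetter Γ)), w.length = m → ∀ n : ℕ,
      P (FreeAlgebra.ι ℚ none ^ n * word w) := by
    intro m
    induction m with
    | zero =>
      intro w hw n
      rw [List.length_eq_zero_iff.1 hw, word_nil, mul_one]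
      exact pow n
    | succ m ih =>
      intro w hw n
      rcases w with _ | ⟨_ | g, w⟩
      · simp at hw
      · rw [word_cons, ← mul_assoc, ← pow_succ]
        exact ih w (by simpa using hw) _
      · have h := ih (w.map (Option.map (g⁻¹ * ·))) (by simpa using hw) 0
        rw [pow_zero, one_mul, ← tAct_word] at h
        have h' := block n g _ h
        rwa [tAct_self_inv, mul_assoc, ← word_cons] at h'
  induction v using induction_words with
  | word_mem w => simpa using key _ w rfl 0
  | add u v hu hv => exact add u v hu hv
  | smul c v hv => exact smul c v hv

variable (Γ) in
/-- The linear map `𝐪 ∘ π_Y : ℚ⟨X⟩ → ℚ⟨Y⟩`. -/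
def theta : QX Γ →ₗ[ℚ] QY Γ := qMap ∘ₗ piY

theorem piYWord_replicate (k n : ℕ) (w : List (XLetter Γ)) :
    piYWord k (List.replicate n none ++ w) = piYWord (k + n) w := by
  induction n generalizing k with
  | zero => simp
  | succ n ih =>
    rw [List.replicate_succ, List.cons_append, piYWord, ih]
    congr 1
    omega

/-- Translations commute with π_Y on words. Since 𝐪 only keeps quotients of successive group
elements, this makes θ insensitive to translations except in the first letter. -/
theorem piYWord_map (w : List (XLetter Γ)) (k : ℕ) :
    (∀ σ : Γ, piYWord k (w.map (Option.map (σ * ·))) = 0) ∨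
      ∃ u : List (YLetter Γ), ∀ σ : Γ,
        piYWord k (w.map (Option.map (σ * ·))) = word (u.map (Prod.map id (σ * ·))) := by
  induction w generalizing k with
  | nil =>
    rcases k with _ | k
    · exact Or.inr ⟨[], fun σ => by simp [piYWord, word_nil]⟩
    · exact Or.inl fun σ => by simp [piYWord]
  | cons a w ih =>
    rcases a with _ | g
    · simp only [List.map_cons, Option.map_none, piYWord]
      exact ih (k + 1)
    · simp only [List.map_cons, Option.map_some, piYWord]
      rcases ih 0 with h | ⟨u, hu⟩
      · exact Or.inl fun σ => by rw [h, mul_zero]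
      · exact Or.inr ⟨(k.succPNat, g) :: u, fun σ => by rw [hu, List.map_cons, word_cons]; rfl⟩

theorem qList_map (σ τ : Γ) (u : List (YLetter Γ)) :
    qList (σ * τ) (u.map (Prod.map id (σ * ·))) = qList τ u := by
  induction u generalizing τ with
  | nil => rfl
  | cons a u ih =>
    obtain ⟨s, g⟩ := a
    simp only [List.map_cons, Prod.map_apply, id, qList, ih]
    congr 2
    rw [mul_inv_rev, mul_comm τ⁻¹, ← mul_assoc, mul_comm σ g, mul_inv_cancel_right]

theorem theta_one : theta Γ 1 = 1 := by
  rw [← word_nil, theta, LinearMap.comp_apply, piY, onWords_word, piYWord, ← word_nil, qMap,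
    onWords_word, qList]

theorem theta_pow (n : ℕ) : theta Γ (FreeAlgebra.ι ℚ none ^ (n + 1)) = 0 := by
  have h : (FreeAlgebra.ι ℚ none ^ (n + 1) : QX Γ) = word (List.replicate (n + 1) none ++ []) := by
    simp [word]
  rw [h, theta, LinearMap.comp_apply, piY, onWords_word, piYWord_replicate, Nat.zero_add,
    piYWord, map_zero]

/-- Translating `v` by g compensates the division by g in the next letter. This recursion determines
θ together with its values on powers of x₀. -/
theorem theta_block (n : ℕ) (g : Γ) (v : QX Γ) :
    theta Γ (FreeAlgebra.ι ℚ none ^ n * FreeAlgebra.ι ℚ (some g) * tAct g v) =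
      FreeAlgebra.ι ℚ (n.succPNat, g) * theta Γ v := by
  induction v using induction_words with
  | word_mem w =>
    have h : (FreeAlgebra.ι ℚ none ^ n * FreeAlgebra.ι ℚ (some g) * tAct g (word w) : QX Γ) =
        word (List.replicate n none ++ (some g :: w.map (Option.map (g * ·)))) := by
      rw [tAct_word]
      simp [word, mul_assoc]
    rw [h, theta, LinearMap.comp_apply, piY, onWords_word, piYWord_replicate, piYWord,
      LinearMap.comp_apply, onWords_word, Nat.zero_add]
    have hw : w = w.map (Option.map ((1 : Γ) * ·)) := by simp
    rcases piYWord_map w 0 with h | ⟨u, hu⟩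
    · rw [h g, hw, h 1]
      simp
    · rw [hu g]
      have hu1 := hu 1
      rw [← hw] at hu1
      rw [hu1, ← word_cons, qMap, onWords_word, onWords_word, qList]
      have h1 := qList_map g 1 u
      have h2 := qList_map 1 1 u
      rw [mul_one] at h1 h2
      rw [h1, h2, word_cons]
      simp
  | add x y hx hy => simp only [map_add, mul_add, hx, hy]
  | smul c x hx => simp only [map_smul, mul_smul_comm, hx]

theorem theta_pow_mul (n : ℕ) (g : Γ) :
    theta Γ (FreeAlgebra.ι ℚ none ^ n * FreeAlgebra.ι ℚ (some g)) =
      FreeAlgebra.ι ℚ (n.succPNat, g) := by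
  simpa [theta_one] using theta_block n g 1

theorem theta_mul_none (v : QX Γ) : theta Γ (v * FreeAlgebra.ι ℚ none) = 0 := by
  induction v using block_induction with
  | pow n => rw [← pow_succ, theta_pow]
  | block n g v hv =>
    have h := theta_block n g (v * FreeAlgebra.ι ℚ none)
    rwa [map_mul (tAct g), tAct_none, ← mul_assoc, hv, mul_zero] at h
  | add x y hx hy => rw [add_mul, map_add, hx, hy, add_zero]
  | smul c x hx => rw [smul_mul_assoc, map_smul, hx, smul_zero]

theorem theta_mul_some_mul (v : QX Γ) (σ : Γ) (w : QX Γ) :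
    theta Γ (v * FreeAlgebra.ι ℚ (some σ) * w) =
      theta Γ (v * FreeAlgebra.ι ℚ (some σ)) * theta Γ (tAct σ⁻¹ w) := by
  induction v using block_induction generalizing σ w with
  | pow n =>
    rw [theta_pow_mul, ← theta_block, tAct_self_inv]
  | block n g v hv =>
    have h := theta_block n g (v * FreeAlgebra.ι ℚ (some (g⁻¹ * σ)) * tAct g⁻¹ w)
    have h' := theta_block n g (v * FreeAlgebra.ι ℚ (some (g⁻¹ * σ)))
    simp only [map_mul, tAct_some, mul_inv_cancel_left, tAct_self_inv] at h h'
    simp only [← mul_assoc (_ * _) _ _] at h h'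
    rw [h, hv, h', mul_assoc, tAct_tAct, mul_inv_rev, inv_inv, mul_assoc, mul_inv_cancel,
      mul_one]
  | add x y hx hy => simp only [add_mul, map_add, hx, hy]
  | smul c x hx => simp only [smul_mul_assoc, map_smul, hx]

theorem theta_some_mul (σ : Γ) (w : QX Γ) :
    theta Γ (FreeAlgebra.ι ℚ (some σ) * w) =
      FreeAlgebra.ι ℚ (1, σ) * theta Γ (tAct σ⁻¹ w) := by
  have h := theta_block 0 σ (tAct σ⁻¹ w)
  rwa [pow_zero, one_mul, tAct_self_inv] at h

variable (Γ) in
/-- The linear section of `theta`, with values in the span of the words which do not end in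
`x₀`. -/
def thetaInv : QY Γ →ₗ[ℚ] QX Γ :=
  onWords (List.foldr (fun y v => FreeAlgebra.ι ℚ none ^ (y.1.natPred) *
    FreeAlgebra.ι ℚ (some y.2) * tAct y.2 v) 1)

theorem thetaInv_one : thetaInv Γ 1 = 1 := by
  rw [← word_nil, thetaInv, onWords_word]
  rfl

theorem thetaInv_ι_mul (n : ℕ) (g : Γ) (w : QY Γ) :
    thetaInv Γ (FreeAlgebra.ι ℚ (n.succPNat, g) * w) =
      FreeAlgebra.ι ℚ none ^ n * FreeAlgebra.ι ℚ (some g) * tAct g (thetaInv Γ w) := by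
  induction w using induction_words with
  | word_mem w => rw [← word_cons, thetaInv, onWords_word, onWords_word]; simp
  | add x y hx hy => simp only [map_add, mul_add, hx, hy]
  | smul c x hx => simp only [map_smul, mul_smul_comm, hx]

theorem thetaInv_theta (v : QX Γ) (σ : Γ) :
    thetaInv Γ (theta Γ (v * FreeAlgebra.ι ℚ (some σ))) = v * FreeAlgebra.ι ℚ (some σ) := by
  induction v using block_induction generalizing σ with
  | pow n =>
    have h := thetaInv_ι_mul n σ 1
    rwa [mul_one, thetaInv_one, map_one, mul_one, ← theta_pow_mul] at h
  | block n g v hv =>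
    have h' := theta_block n g (v * FreeAlgebra.ι ℚ (some (g⁻¹ * σ)))
    rw [map_mul (tAct g), tAct_some, mul_inv_cancel_left, ← mul_assoc] at h'
    rw [h', thetaInv_ι_mul, hv, map_mul, tAct_some, mul_inv_cancel_left, mul_assoc, mul_assoc,
      mul_assoc]
  | add x y hx hy => simp only [map_add, add_mul, hx, hy]
  | smul c x hx => simp only [map_smul, smul_mul_assoc, hx]

/-- θ is injective on the span of the words that do not end in x₀, where `thetaInv` inverts it. -/
theorem eq_zero_of_sum_theta [Fintype Γ] {f : Γ → QX Γ} {c : ℚ}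
    (h : ∑ σ, theta Γ (f σ * FreeAlgebra.ι ℚ (some σ)) = algebraMap ℚ _ c) (σ : Γ) : f σ = 0 := by
  classical
  have h1 := congrArg (fun v => rStrip (some σ) (thetaInv Γ v)) h
  simpa [map_sum, thetaInv_theta, rStrip_mul_ι, Algebra.algebraMap_eq_smul_one, thetaInv_one]
    using h1

theorem theta_eq_sum [Fintype Γ] (v : QX Γ) :
    theta Γ v = ∑ σ, theta Γ (rStrip (some σ) v * FreeAlgebra.ι ℚ (some σ)) +
      algebraMap ℚ _ (cst v) := by
  nth_rewrite 1 [eq_sum_rStrip v]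
  rw [Fintype.sum_option, map_add, map_add, theta_mul_none, zero_add, map_sum,
    Algebra.algebraMap_eq_smul_one, map_smul, theta_one, ← Algebra.algebraMap_eq_smul_one]

end Theta

/-! ### The correction term as a polynomial in one variable. -/

section Correction

open Polynomial

variable {Γ : Type*} [CommGroup Γ]

open Classical in
/-- The polynomial `∑ ((-1)^{n-1}/n) (ψ|x₀^{n-1}x₁) T^n`, from which `corr ψ` is obtained by
evaluation at `y_{1,1}`. -/
def corrPoly : QX Γ →ₗ[ℚ] ℚ[X] :=
  onWords fun w =>
    if w ≠ [] ∧ w = List.replicate (w.length - 1) none ++ [some 1] then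
      ((-1) ^ (w.length - 1) / (w.length : ℚ)) • X ^ w.length
    else 0

theorem corr_eq_aeval (v : QX Γ) :
    corr v = aeval (FreeAlgebra.ι ℚ ((1 : ℕ+), (1 : Γ))) (corrPoly v) := by
  induction v using induction_words with
  | word_mem w =>
    rw [corr, corrPoly, onWords_word, onWords_word]
    split_ifs
    · rw [map_smul, aeval_X_pow]
    · rw [map_zero]
  | add x y hx hy => simp only [map_add, hx, hy]
  | smul c x hx => simp only [map_smul, hx]

theorem corrPoly_coeff_zero (v : QX Γ) : (corrPoly v).coeff 0 = 0 := by
  induction v using induction_words with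
  | word_mem w =>
    rw [corrPoly, onWords_word]
    split_ifs with h
    · rw [coeff_smul, coeff_X_pow, if_neg, smul_zero]
      exact fun h' => h.1 (List.length_eq_zero_iff.1 h'.symm)
    · rfl
  | add x y hx hy => rw [map_add, coeff_add, hx, hy, add_zero]
  | smul c x hx => rw [map_smul, coeff_smul, hx, smul_zero]

theorem corrPoly_coeff_succ (n : ℕ) (v : QX Γ) :
    (corrPoly v).coeff (n + 1) =
      ((-1) ^ n / ((n : ℚ) + 1)) * coeff (List.replicate n none ++ [some 1]) v := by
  classical
  induction v using induction_words with
  | word_mem w =>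
    rw [corrPoly, onWords_word, coeff_word]
    by_cases hw : w = List.replicate n none ++ [some 1]
    · subst hw
      simp
    · rw [if_neg hw, mul_zero]
      split_ifs with h
      · rw [coeff_smul, coeff_X_pow, if_neg, smul_zero]
        intro h'
        rw [← h', Nat.add_sub_cancel] at h
        exact hw h.2
      · rfl
  | add x y hx hy => rw [map_add, coeff_add, hx, hy, map_add]; ring
  | smul c x hx => rw [map_smul, coeff_smul, hx, map_smul, smul_eq_mul, smul_eq_mul]; ring

theorem lowerStar_eq (v : QX Γ) :
    lowerStar v =
      theta Γ v + aeval (FreeAlgebra.ι ℚ ((1 : ℕ+), (1 : Γ))) (corrPoly v) := by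
  rw [← corr_eq_aeval]
  rfl

theorem theta_aeval (f : ℚ[X]) :
    theta Γ (aeval (FreeAlgebra.ι ℚ (some 1)) f) =
      aeval (FreeAlgebra.ι ℚ ((1 : ℕ+), (1 : Γ))) f := by
  have h : ∀ n : ℕ, theta Γ (FreeAlgebra.ι ℚ (some 1) ^ n) =
      FreeAlgebra.ι ℚ ((1 : ℕ+), (1 : Γ)) ^ n := by
    intro n
    induction n with
    | zero => simp [theta_one]
    | succ n ih => rw [pow_succ', theta_some_mul, inv_one, tAct_one_left, ih, pow_succ']
  induction f using Polynomial.induction_on' with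
  | add p q hp hq => simp only [map_add, hp, hq]
  | monomial n c =>
    rw [← C_mul_X_pow_eq_monomial, ← smul_eq_C_mul, map_smul, map_smul, map_smul, aeval_X_pow,
      aeval_X_pow, h]

end Correction

/-! ### The antipode identity of the harmonic Hopf algebra. -/

section Antipode

open Polynomial

variable {Γ : Type*} [CommGroup Γ]

variable (Γ) in
/-- The antimorphism of `ℚ⟨Y⟩` with `y_{n,σ} ↦ (-1)^n y_{n,σ⁻¹}`. -/
def tau : QY Γ →ₗ[ℚ] QY Γ :=
  antiLift fun y => (-1 : ℚ) ^ (y.1 : ℕ) • FreeAlgebra.ι ℚ (y.1, y.2⁻¹)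

theorem tau_mul (a b : QY Γ) : tau Γ (a * b) = tau Γ b * tau Γ a := antiLift_mul _ _ _

/-- Reversing a word in Y amounts to reversing, in X, the part before the last letter. The sign of τ
counts all letters of X including the last one, whence the minus sign in front of the antipode. -/
theorem tau_theta (v : QX Γ) (σ : Γ) :
    tau Γ (theta Γ (v * FreeAlgebra.ι ℚ (some σ))) =
      -theta Γ (tAct σ⁻¹ (antipode v) * FreeAlgebra.ι ℚ (some σ⁻¹)) := by
  have hpow : ∀ n : ℕ, antipode (FreeAlgebra.ι ℚ none ^ n : QX Γ) =
      (-1 : ℚ) ^ n • FreeAlgebra.ι ℚ none ^ n := by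
    intro n
    unfold antipode
    induction n with
    | zero => simp
    | succ n ih =>
      rw [pow_succ, antiLift_mul, ih, antiLift_ι, pow_succ (-1 : ℚ), mul_smul_comm, neg_mul,
        (pow_succ' _ _).symm.trans (pow_succ _ _), mul_neg_one, neg_smul, smul_neg]
  induction v using block_induction generalizing σ with
  | pow n =>
    rw [theta_pow_mul, hpow, map_smul, smul_mul_assoc, map_smul, map_pow, tAct_none,
      theta_pow_mul, tau, antiLift_ι]
    simp [pow_succ]
  | block n g v hv =>
    have h := theta_block n g (v * FreeAlgebra.ι ℚ (some (g⁻¹ * σ)))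
    rw [map_mul (tAct g), tAct_some, mul_inv_cancel_left, ← mul_assoc] at h
    have h2 : antipode (FreeAlgebra.ι ℚ none ^ n * FreeAlgebra.ι ℚ (some g) * tAct g v) =
        (-1 : ℚ) ^ (n + 1) • (tAct g (antipode v) * FreeAlgebra.ι ℚ (some g) *
          FreeAlgebra.ι ℚ none ^ n) := by
      have h3 := hpow n
      rw [tAct_antipode]
      unfold antipode at *
      rw [antiLift_mul, antiLift_mul, h3, antiLift_ι, pow_succ]
      simp [mul_assoc]
    have h4 : tau Γ (FreeAlgebra.ι ℚ (n.succPNat, g)) =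
        (-1 : ℚ) ^ (n + 1) • FreeAlgebra.ι ℚ (n.succPNat, g⁻¹) := by
      rw [tau, antiLift_ι]
      rfl
    have h5 := hv (g⁻¹ * σ)
    rw [mul_inv_rev, inv_inv] at h5
    have h6 : tau Γ (FreeAlgebra.ι ℚ (n.succPNat, g) *
        theta Γ (v * FreeAlgebra.ι ℚ (some (g⁻¹ * σ)))) =
        tau Γ (theta Γ (v * FreeAlgebra.ι ℚ (some (g⁻¹ * σ)))) *
          tau Γ (FreeAlgebra.ι ℚ (n.succPNat, g)) := antiLift_mul _ _ _
    have h7 : theta Γ (tAct σ⁻¹ (tAct g (antipode v) * FreeAlgebra.ι ℚ (some g) *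
        FreeAlgebra.ι ℚ none ^ n) * FreeAlgebra.ι ℚ (some σ⁻¹)) =
        theta Γ (tAct (σ⁻¹ * g) (antipode v) * FreeAlgebra.ι ℚ (some (σ⁻¹ * g))) *
          FreeAlgebra.ι ℚ (n.succPNat, g⁻¹) := by
      rw [map_mul (tAct _), map_mul (tAct _), map_pow, tAct_none, tAct_some, tAct_tAct,
        mul_assoc (_ * _), theta_mul_some_mul, map_mul (tAct _), map_pow, tAct_none, tAct_some,
        theta_pow_mul, mul_inv_rev, inv_inv, mul_inv_cancel_right]
    rw [h, h6, h5, h4, h2, map_smul, smul_mul_assoc, map_smul, h7, neg_mul,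
      mul_smul_comm]
  | add x y hx hy => simp only [map_add, add_mul, hx, hy]; abel
  | smul c x hx => simp only [map_smul, smul_mul_assoc, hx, smul_neg]

variable [Fintype Γ]

variable (Γ) in
/-- The algebra morphism of `ℚ⟨Y⟩` with `y_{n,σ} ↦ 𝐪π_Y(y₀^{n-1} x_{σ⁻¹})`. -/
def swapY : QY Γ →ₐ[ℚ] QY Γ :=
  FreeAlgebra.lift ℚ fun y => theta Γ (yInf Γ ^ y.1.natPred * FreeAlgebra.ι ℚ (some y.2⁻¹))

theorem swapY_ι (n : ℕ) (g : Γ) : swapY Γ (FreeAlgebra.ι ℚ (n.succPNat, g)) =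
    theta Γ (yInf Γ ^ n * FreeAlgebra.ι ℚ (some g⁻¹)) := by
  simp [swapY]

theorem swapY_theta (v : QX Γ) (σ : Γ) :
    swapY Γ (theta Γ (v * FreeAlgebra.ι ℚ (some σ))) =
      theta Γ (swap Γ v * FreeAlgebra.ι ℚ (some σ⁻¹)) := by
  induction v using block_induction generalizing σ with
  | pow n => rw [theta_pow_mul, swapY_ι, map_pow, swap_none]
  | block n g v hv =>
    have h := theta_block n g (v * FreeAlgebra.ι ℚ (some (g⁻¹ * σ)))
    rw [map_mul (tAct g), tAct_some, mul_inv_cancel_left, ← mul_assoc] at h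
    rw [h, map_mul (swapY Γ), swapY_ι, hv, map_mul (swap Γ), map_mul (swap Γ), map_pow, swap_none, swap_some, swap_tAct,
      mul_assoc (yInf Γ ^ n * _), theta_mul_some_mul, map_mul (tAct _), tAct_tAct, tAct_some,
      inv_inv, mul_inv_cancel, tAct_one_left, mul_inv_rev, inv_inv, mul_comm g]
  | add x y hx hy => simp only [map_add, add_mul, hx, hy]
  | smul c x hx => simp only [map_smul, smul_mul_assoc, hx]

/-- Expand y₀^m = (∑ x_c − x₀)^m by the first factor that contributes some x_c; j is the number of
letters x₀ before it. -/
theorem theta_yInf_pow_mul (m : ℕ) (h : Γ) :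
    theta Γ (yInf Γ ^ m * FreeAlgebra.ι ℚ (some h)) =
      (-1 : ℚ) ^ m • FreeAlgebra.ι ℚ (m.succPNat, h) +
        ∑ j ∈ Finset.range m, ∑ c : Γ, (-1 : ℚ) ^ j • (FreeAlgebra.ι ℚ (j.succPNat, c) *
          theta Γ (yInf Γ ^ (m - 1 - j) * FreeAlgebra.ι ℚ (some (c⁻¹ * h)))) := by
  -- The leading power of x₀ is needed because the induction on m moves letters x₀ to the front.
  have h1 : ∀ n v, theta Γ (FreeAlgebra.ι ℚ none ^ n * (yInf Γ ^ m * v)) =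
      (-1 : ℚ) ^ m • theta Γ (FreeAlgebra.ι ℚ none ^ (n + m) * v) +
        ∑ j ∈ Finset.range m, ∑ c : Γ, (-1 : ℚ) ^ j •
          (FreeAlgebra.ι ℚ ((n + j).succPNat, c) * theta Γ (yInf Γ ^ (m - 1 - j) * tAct c⁻¹ v)) := by
    induction m with
    | zero => intro n v; simp
    | succ m ih =>
      intro n v
      have h2 : FreeAlgebra.ι ℚ none ^ n * (yInf Γ ^ (m + 1) * v) =
          ∑ c : Γ, FreeAlgebra.ι ℚ none ^ n * FreeAlgebra.ι ℚ (some c) * (yInf Γ ^ m * v) -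
            FreeAlgebra.ι ℚ none ^ (n + 1) * (yInf Γ ^ m * v) := by
        rw [pow_succ', yInf, sub_mul, sub_mul, mul_sub, ← Finset.sum_mul, ← Finset.mul_sum]
        simp only [mul_assoc, pow_succ]
      have h3 : ∀ c : Γ, theta Γ (FreeAlgebra.ι ℚ none ^ n * FreeAlgebra.ι ℚ (some c) *
          (yInf Γ ^ m * v)) =
          FreeAlgebra.ι ℚ (n.succPNat, c) * theta Γ (yInf Γ ^ m * tAct c⁻¹ v) := by
        intro c
        rw [theta_mul_some_mul, theta_pow_mul, map_mul (tAct _), map_pow, tAct_yInf]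
      rw [h2, map_sub, map_sum, ih, Finset.sum_range_succ']
      simp only [h3, Nat.add_sub_cancel, pow_zero, one_smul, Nat.sub_zero, add_zero]
      have h4 : ∀ j ∈ Finset.range m, (∑ c : Γ, (-1 : ℚ) ^ (j + 1) •
          (FreeAlgebra.ι ℚ ((n + (j + 1)).succPNat, c) *
            theta Γ (yInf Γ ^ (m - (j + 1)) * tAct c⁻¹ v))) =
          -∑ c : Γ, (-1 : ℚ) ^ j • (FreeAlgebra.ι ℚ ((n + 1 + j).succPNat, c) *
            theta Γ (yInf Γ ^ (m - 1 - j) * tAct c⁻¹ v)) := by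
        intro j _
        rw [← Finset.sum_neg_distrib]
        refine Finset.sum_congr rfl fun c _ => ?_
        rw [show n + (j + 1) = n + 1 + j by omega, show m - (j + 1) = m - 1 - j by omega, pow_succ]
        simp
      rw [Finset.sum_congr rfl h4, Finset.sum_neg_distrib, show n + 1 + m = n + (m + 1) by omega,
        pow_succ (-1 : ℚ)]
      simp only [mul_neg, mul_one, neg_smul]
      abel
  have h2 := h1 0 (FreeAlgebra.ι ℚ (some h))
  simpa only [pow_zero, one_mul, Nat.zero_add, theta_pow_mul, tAct_some] using h2

theorem harmonicCoproduct_ι (m : ℕ) (g : Γ) :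
    harmonicCoproduct (FreeAlgebra.ι ℚ (m.succPNat, g)) =
      FreeAlgebra.ι ℚ (m.succPNat, g) ⊗ₜ[ℚ] 1 + 1 ⊗ₜ[ℚ] FreeAlgebra.ι ℚ (m.succPNat, g) +
        ∑ j ∈ Finset.range m, ∑ c : Γ, FreeAlgebra.ι ℚ (j.succPNat, c) ⊗ₜ[ℚ]
          FreeAlgebra.ι ℚ ((m - 1 - j).succPNat, c⁻¹ * g) := by
  rw [harmonicCoproduct, FreeAlgebra.lift_ι_apply]
  congr 1
  refine (Finset.sum_bij (fun j _ => j.succPNat) ?_ ?_ ?_ ?_).symm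
  · intro j hj
    rw [Finset.mem_range] at hj
    rw [Finset.mem_Ico]
    exact ⟨one_le, by rw [← PNat.coe_lt_coe]; simpa using hj⟩
  · intro i _ j _ hij
    exact Nat.succPNat_injective hij
  · intro b hb
    rw [Finset.mem_Ico, ← PNat.coe_lt_coe] at hb
    refine ⟨b.natPred, ?_, PNat.succPNat_natPred b⟩
    have h1 := PNat.natPred_add_one b
    have h2 := hb.2
    simp only [Nat.succPNat_coe, Nat.succ_eq_add_one] at h2
    rw [Finset.mem_range]
    omega
  · intro j hj
    rw [Finset.mem_range] at hj
    refine Finset.sum_congr rfl fun c _ => ?_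
    congr 3
    rw [← PNat.coe_inj, PNat.sub_coe, if_pos (by rw [← PNat.coe_lt_coe]; simpa using hj)]
    simp only [Nat.succPNat_coe, Nat.succ_eq_add_one]
    omega

/-- The linear map `a ⊗ b ↦ τ(b) swapY(a)`. -/
def antipodePairing : QY Γ ⊗[ℚ] QY Γ →ₗ[ℚ] QY Γ :=
  TensorProduct.lift
    ((LinearMap.mul ℚ (QY Γ)).flip.compl₁₂ (swapY Γ).toLinearMap (tau Γ))

theorem antipodePairing_tmul (a b : QY Γ) :
    antipodePairing (a ⊗ₜ[ℚ] b) = tau Γ b * swapY Γ a := rfl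

theorem antipodePairing_mul_tmul (T : QY Γ ⊗[ℚ] QY Γ) (a b : QY Γ) :
    antipodePairing (T * a ⊗ₜ[ℚ] b) = tau Γ b * antipodePairing T * swapY Γ a := by
  induction T using TensorProduct.induction_on with
  | zero => simp
  | tmul x y =>
    rw [Algebra.TensorProduct.tmul_mul_tmul, antipodePairing_tmul, antipodePairing_tmul,
      map_mul (swapY Γ), tau_mul]
    simp only [mul_assoc]
  | add x y hx hy => simp only [add_mul, map_add, mul_add, hx, hy]

/-- The expansion of θ(y₀^m x_{g⁻¹}) cancels, term by term, the mixed terms of the coproduct: it is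
the recursion which defines an antipode. -/
theorem antipodePairing_coproduct_ι (y : YLetter Γ) :
    antipodePairing (harmonicCoproduct (FreeAlgebra.ι ℚ y)) = 0 := by
  obtain ⟨n, g⟩ := y
  obtain ⟨m, rfl⟩ : ∃ m : ℕ, n = m.succPNat := ⟨n.natPred, (PNat.succPNat_natPred n).symm⟩
  have htau : ∀ (j : ℕ) (c : Γ), tau Γ (FreeAlgebra.ι ℚ (j.succPNat, c)) =
      (-1 : ℚ) ^ (j + 1) • FreeAlgebra.ι ℚ (j.succPNat, c⁻¹) := by
    intro j c
    rw [tau, antiLift_ι]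
    rfl
  rw [harmonicCoproduct_ι]
  simp only [map_add, map_sum, antipodePairing_tmul, htau, swapY_ι, map_one, mul_one]
  rw [show tau Γ 1 = 1 from antiLift_one _, one_mul, ← Finset.sum_range_reflect, theta_yInf_pow_mul m g⁻¹]
  have h : ∀ j ∈ Finset.range m, (∑ c : Γ, (-1 : ℚ) ^ (m - 1 - (m - 1 - j) + 1) •
      FreeAlgebra.ι ℚ ((m - 1 - (m - 1 - j)).succPNat, (c⁻¹ * g)⁻¹) *
        theta Γ (yInf Γ ^ (m - 1 - j) * FreeAlgebra.ι ℚ (some c⁻¹))) =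
      -∑ c : Γ, (-1 : ℚ) ^ j • (FreeAlgebra.ι ℚ (j.succPNat, c) *
          theta Γ (yInf Γ ^ (m - 1 - j) * FreeAlgebra.ι ℚ (some (c⁻¹ * g⁻¹)))) := by
    intro j hj
    rw [Finset.mem_range] at hj
    rw [← Finset.sum_neg_distrib]
    refine Fintype.sum_equiv (Equiv.mulRight g⁻¹) _ _ fun c => ?_
    rw [show m - 1 - (m - 1 - j) = j by omega]
    simp [pow_succ, mul_comm]
  rw [Finset.sum_congr rfl h, Finset.sum_neg_distrib, pow_succ]
  simp

/-- As τ reverses products and `swapY` keeps them, the pairing of a product nests the pairing of the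
left factor inside that of the right one. The inner pairing is a scalar, so checking letters
suffices. -/
theorem antipodePairing_coproduct (w : QY Γ) :
    antipodePairing (harmonicCoproduct w) = algebraMap ℚ _ (cst w) := by
  induction w using right_induction with
  | one => simp [Algebra.TensorProduct.one_def, antipodePairing_tmul,
      show tau Γ 1 = 1 from antiLift_one _]
  | mul_ι a w hw =>
    have key : ∀ T : QY Γ ⊗[ℚ] QY Γ, antipodePairing (harmonicCoproduct w * T) =
        algebraMap ℚ _ (cst w) * antipodePairing T := by
      intro T
      induction T using TensorProduct.induction_on with
      | zero => simp
      | tmul x y =>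
        rw [antipodePairing_mul_tmul, hw, antipodePairing_tmul, ← Algebra.commutes, mul_assoc]
      | add x y hx hy => simp only [map_add, mul_add, hx, hy]
    rw [map_mul, key, antipodePairing_coproduct_ι]
    simp
  | add x y hx hy => simp only [map_add, hx, hy]
  | smul c x hx => rw [map_smul, map_smul, hx, map_smul, smul_eq_mul, map_mul, Algebra.smul_def]

end Antipode

/-! ### From primitivity of ψ_* to the end relation; coefficients of ψ_*. -/

section PrimitiveEnds

open Polynomial

variable {Γ : Type*} [CommGroup Γ] [Fintype Γ]

/-- The primitive elements for the harmonic coproduct. -/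
def HarmonicPrimitive (v : QY Γ) : Prop :=
  harmonicCoproduct v = v ⊗ₜ[ℚ] 1 + 1 ⊗ₜ[ℚ] v

theorem antiLift_aeval {A : Type*} (F : A → FreeAlgebra ℚ A) (a : A)
    (h : F a = -FreeAlgebra.ι ℚ a) (f : ℚ[X]) :
    antiLift F (aeval (FreeAlgebra.ι ℚ a) f) = aeval (FreeAlgebra.ι ℚ a) (f.comp (-X)) := by
  have h : ∀ n : ℕ, antiLift F (FreeAlgebra.ι ℚ a ^ n) = (-FreeAlgebra.ι ℚ a) ^ n := by
    intro n
    induction n with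
    | zero => simp
    | succ n ih => rw [pow_succ, antiLift_mul, ih, antiLift_ι, h, pow_succ']
  induction f using Polynomial.induction_on' with
  | add p q hp hq => simp only [map_add, add_comp, hp, hq]
  | monomial n c =>
    rw [← C_mul_X_pow_eq_monomial, ← smul_eq_C_mul, smul_comp, map_smul, map_smul, map_smul,
      aeval_X_pow, X_pow_comp, h, map_pow (aeval _), map_neg (aeval _), aeval_X]

theorem tau_aeval (f : ℚ[X]) :
    tau Γ (aeval (FreeAlgebra.ι ℚ ((1 : ℕ+), (1 : Γ))) f) =
      aeval (FreeAlgebra.ι ℚ ((1 : ℕ+), (1 : Γ))) (f.comp (-X)) :=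
  antiLift_aeval _ _ (by simp) f

theorem antipode_aeval {A : Type*} (a : A) (f : ℚ[X]) :
    antipode (aeval (FreeAlgebra.ι ℚ a) f) = aeval (FreeAlgebra.ι ℚ a) (f.comp (-X)) :=
  antiLift_aeval _ _ rfl f

theorem swapY_aeval (f : ℚ[X]) :
    swapY Γ (aeval (FreeAlgebra.ι ℚ ((1 : ℕ+), (1 : Γ))) f) =
      aeval (FreeAlgebra.ι ℚ ((1 : ℕ+), (1 : Γ))) f := by
  have h := swapY_ι 0 (1 : Γ)
  rw [pow_zero, one_mul, inv_one] at h
  have h' := theta_pow_mul 0 (1 : Γ)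
  rw [pow_zero, one_mul] at h'
  rw [h'] at h
  rw [← aeval_algHom_apply]
  congr 2

/-- On a primitive element the antipode identity reads `swapY` + τ = constant. Transported to X by
θ, it compares the last letters of ψ under the involution with the antipodes of these strips, which
are the first-letter strips as ψ is Lie. The correction contributes p(T) + p(−T), from which a last
letter x₁ is split off. -/
theorem endRelation_of_harmonicPrimitive {ψ : QX Γ} (hψ : ψ ∈ Lib Γ)
    (h : HarmonicPrimitive (lowerStar ψ)) :
    EndRelation ψ (corrPoly ψ + (corrPoly ψ).comp (-X)).divX := by
  classical
  set p := corrPoly ψ with hp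
  set k := (p + p.comp (-X)).divX with hk
  set y : QY Γ := FreeAlgebra.ι ℚ ((1 : ℕ+), (1 : Γ)) with hy
  set x : QX Γ := FreeAlgebra.ι ℚ (some (1 : Γ)) with hx
  have h1 := antipodePairing_coproduct (lowerStar ψ)
  generalize cst (lowerStar ψ) = c at h1
  rw [h, map_add, antipodePairing_tmul, antipodePairing_tmul, map_one (swapY Γ), mul_one,
    show tau Γ 1 = 1 from antiLift_one _, one_mul, lowerStar_eq, map_add, map_add,
    ← hp, ← hy, tau_aeval, swapY_aeval, ← hy, theta_eq_sum ψ, cst_of_mem_Lib hψ] at h1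
  simp only [map_zero, add_zero, map_sum, swapY_theta, tau_theta] at h1
  have h2 : ∀ σ : Γ, antipode (rStrip (some σ) ψ) = lStrip (some σ) ψ := fun σ =>
    (lStrip_of_mem_Lib hψ _).symm
  simp only [h2] at h1
  have h3 : aeval y p + aeval y (p.comp (-X)) =
      theta Γ (aeval x k * x) + algebraMap ℚ _ ((p + p.comp (-X)).coeff 0) := by
    have h4 := congrArg (aeval y) (divX_mul_X_add (p + p.comp (-X)))
    rw [← hk, map_add, aeval_C, ← theta_aeval] at h4
    rw [← map_add, ← h4, map_mul, aeval_X]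
  have h5 : ∑ σ : Γ, theta Γ ((tAct σ (lStrip (some σ⁻¹) ψ) - swap Γ (rStrip (some σ⁻¹) ψ) -
      if σ = 1 then aeval x k else 0) * FreeAlgebra.ι ℚ (some σ)) =
      algebraMap ℚ _ ((p + p.comp (-X)).coeff 0 - c) := by
    have h6 : theta Γ (aeval x k * x) = ∑ σ : Γ, theta Γ ((if σ = 1 then aeval x k else 0) *
        FreeAlgebra.ι ℚ (some σ)) := by
      rw [Finset.sum_eq_single 1 (fun σ _ hσ => by simp [hσ]) (by simp), if_pos rfl]
    have h7 : ∑ σ : Γ, theta Γ (swap Γ (rStrip (some σ) ψ) * FreeAlgebra.ι ℚ (some σ⁻¹)) =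
        ∑ σ : Γ, theta Γ (swap Γ (rStrip (some σ⁻¹) ψ) * FreeAlgebra.ι ℚ (some σ)) :=
      Fintype.sum_equiv (Equiv.inv Γ) _ _ fun σ => by simp
    have h8 : ∑ σ : Γ, -theta Γ (tAct σ⁻¹ (lStrip (some σ) ψ) * FreeAlgebra.ι ℚ (some σ⁻¹)) =
        ∑ σ : Γ, -theta Γ (tAct σ (lStrip (some σ⁻¹) ψ) * FreeAlgebra.ι ℚ (some σ)) :=
      Fintype.sum_equiv (Equiv.inv Γ) _ _ fun σ => by simp
    rw [h7, h8] at h1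
    simp only [sub_mul, map_sub, Finset.sum_sub_distrib, ← h6]
    rw [← h1, Finset.sum_neg_distrib, eq_sub_of_add_eq' h3.symm]
    abel
  have h9 := fun σ => eq_zero_of_sum_theta h5 σ
  constructor
  · have h10 := h9 1
    rw [if_pos rfl, inv_one, tAct_one_left, sub_sub, sub_eq_zero] at h10
    exact h10
  · intro σ hσ
    have h10 := h9 σ⁻¹
    rw [if_neg (by simpa using hσ), sub_zero, inv_inv, sub_eq_zero] at h10
    rw [← h10, tAct_self_inv]

variable (Γ) in
/-- The removal of the first letters `x₀^n`. -/
def lZero (n : ℕ) : QX Γ →ₗ[ℚ] QX Γ := (lStrip none : Module.End ℚ (QX Γ)) ^ n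

variable (Γ) in
/-- The removal of the last letters `x₀^n`. -/
def rZero (n : ℕ) : QX Γ →ₗ[ℚ] QX Γ := (rStrip none : Module.End ℚ (QX Γ)) ^ n

@[simp] theorem lZero_zero (v : QX Γ) : lZero Γ 0 v = v := rfl

@[simp] theorem rZero_zero (v : QX Γ) : rZero Γ 0 v = v := rfl

theorem lZero_succ (n : ℕ) (v : QX Γ) : lZero Γ (n + 1) v = lZero Γ n (lStrip none v) := by
  rw [lZero, pow_succ]
  rfl

theorem rZero_succ (n : ℕ) (v : QX Γ) : rZero Γ (n + 1) v = rZero Γ n (rStrip none v) := by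
  rw [rZero, pow_succ]
  rfl

theorem lZero_succ' (n : ℕ) (v : QX Γ) : lZero Γ (n + 1) v = lStrip none (lZero Γ n v) := by
  rw [lZero, pow_succ']
  rfl

theorem rZero_succ' (n : ℕ) (v : QX Γ) : rZero Γ (n + 1) v = rStrip none (rZero Γ n v) := by
  rw [rZero, pow_succ']
  rfl

theorem coeff_replicate (n : ℕ) (a : XLetter Γ) (v : QX Γ) :
    coeff (List.replicate n none ++ [a]) v = cst (lStrip a (lZero Γ n v)) := by
  induction n generalizing v with
  | zero => rw [List.replicate_zero, List.nil_append, coeff_cons, coeff_nil]; rfl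
  | succ n ih => rw [List.replicate_succ, List.cons_append, coeff_cons, ih, lZero_succ]

theorem lStrip_theta (n : ℕ) (g : Γ) (v : QX Γ) :
    lStrip (n.succPNat, g) (theta Γ v) =
      theta Γ (tAct g⁻¹ (lStrip (some g) (lZero Γ n v))) := by
  classical
  have key : ∀ m (h : Γ) (w : QX Γ), lStrip (some g) (lZero Γ n
      (FreeAlgebra.ι ℚ none ^ m * FreeAlgebra.ι ℚ (some h) * w)) =
      if m = n ∧ h = g then w else 0 := by
    induction n with
    | zero =>
      intro m h w
      cases m <;> simp [lStrip_ι_mul, pow_succ', mul_assoc]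
    | succ n ih =>
      intro m h w
      cases m with
      | zero => simp [lStrip_ι_mul, lZero_succ]
      | succ m => simp [pow_succ', mul_assoc, lStrip_ι_mul, lZero_succ, ← ih]
  have key' : ∀ m, lStrip (some g) (lZero Γ n (FreeAlgebra.ι ℚ none ^ m)) = 0 := by
    clear key
    induction n with
    | zero =>
      intro m
      cases m <;> simp [lStrip_ι_mul, pow_succ']
    | succ n ih =>
      intro m
      cases m with
      | zero => simp [lZero_succ]
      | succ m => simp [pow_succ', lStrip_ι_mul, lZero_succ, ih]
  induction v using block_induction with
  | pow m =>
    rw [key']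
    cases m <;> simp [theta_pow, theta_one]
  | block m h v _ =>
    rw [theta_block, lStrip_ι_mul, key]
    by_cases h1 : m = n ∧ h = g
    · obtain ⟨rfl, rfl⟩ := h1
      simp [tAct_inv_self]
    · rw [if_neg h1, if_neg]
      · simp
      · intro h2
        rw [Prod.mk.injEq] at h2
        exact h1 ⟨Nat.succPNat_injective h2.1, h2.2⟩
  | add x y hx hy => simp only [map_add, hx, hy]
  | smul c x hx => simp only [map_smul, hx]

theorem cst_theta (v : QX Γ) : cst (theta Γ v) = cst v := by
  induction v using block_induction with
  | pow m => cases m <;> simp [theta_pow, theta_one]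
  | block m h v _ => rw [theta_block]; simp
  | add x y hx hy => simp only [map_add, hx, hy]
  | smul c x hx => simp only [map_smul, hx]

theorem coeff_lowerStar_one (g : Γ) (v : QX Γ) (h1 : coeff [some (1 : Γ)] v = 0) :
    coeff [((1 : ℕ+), g)] (lowerStar v) = coeff [some g] v := by
  have h2 := lStrip_theta 0 g v
  rw [show Nat.succPNat 0 = 1 from rfl] at h2
  rw [lowerStar_eq, coeff_cons, coeff_nil, map_add, h2, map_add, coeff_cons, coeff_nil]
  have h3 : cst (lStrip ((1 : ℕ+), g)
      (aeval (FreeAlgebra.ι ℚ ((1 : ℕ+), (1 : Γ))) (corrPoly v))) = 0 := by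
    by_cases hg : g = 1
    · subst hg
      rw [lStrip_aeval_self, ← aeval_algHom_apply, cst_ι, ← coeff_zero_eq_aeval_zero, coeff_divX,
        corrPoly_coeff_succ]
      simp [h1]
    · rw [lStrip_aeval_of_ne (by simpa using hg), map_zero]
  rw [h3, add_zero, cst_theta, cst_tAct, lZero_zero]

theorem coeff_lowerStar_succ (n : ℕ) (g : Γ) (v : QX Γ) :
    coeff [((n + 1).succPNat, g)] (lowerStar v) =
      coeff (List.replicate (n + 1) none ++ [some g]) v := by
  rw [lowerStar_eq, coeff_cons, coeff_nil, map_add, lStrip_theta, coeff_replicate,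
    lStrip_aeval_of_ne, add_zero, cst_theta, cst_tAct]
  intro h
  have h1 := congrArg (fun y : YLetter Γ => (y.1 : ℕ)) h
  simp at h1

end PrimitiveEnds

/-! ### Degree two, and the use of the parity conditions. -/

section ParityConsequences

open Polynomial

variable {Γ : Type*} [CommGroup Γ] [Fintype Γ] {ψ : QX Γ} {k : ℚ[X]}

theorem cst_rStrip_eq_cst_lStrip (a : XLetter Γ) (v : QX Γ) :
    cst (rStrip a v) = cst (lStrip a v) := by
  rw [← coeff_nil, ← coeff_nil, ← coeff_cons, ← coeff_append_singleton, List.nil_append]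

theorem cst_antipode (v : QX Γ) : cst (antipode v) = cst v := by
  induction v using right_induction with
  | one => simp [antipode]
  | mul_ι b v _ => simp [antipode, antiLift_mul]
  | add x y hx hy => simp only [map_add, hx, hy]
  | smul c x hx => simp only [map_smul, hx]

theorem coeff_pair_antisymm (hψ : ψ ∈ Lib Γ) (a b : XLetter Γ) :
    coeff [a, b] ψ = -coeff [b, a] ψ := by
  rw [coeff_cons, coeff_cons, coeff_nil, lStrip_of_mem_Lib hψ, lStrip_antipode, map_neg,
    cst_antipode, cst_rStrip_eq_cst_lStrip, lStrip_rStrip, cst_rStrip_eq_cst_lStrip, coeff_cons,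
    coeff_cons, coeff_nil]

theorem EndRelation.coeff_pair (h : EndRelation ψ k) {σ : Γ} (δ : Γ) (hσ : σ ≠ 1) :
    coeff [some σ, some δ] ψ = coeff [some (δ⁻¹ * σ), some σ] ψ + coeff [none, some σ] ψ := by
  simp only [coeff_cons, coeff_nil]
  rw [h.2 σ hσ, ← cst_rStrip_eq_cst_lStrip, rStrip_tAct_some, cst_tAct, rStrip_swap, cst_swap,
    rSum_apply, map_add, mul_inv_rev, inv_inv]
  simp only [cst_rStrip_eq_cst_lStrip, lStrip_rStrip]

theorem EndRelation.coeff_pair_one [DecidableEq Γ] (h : EndRelation ψ k) (δ : Γ) :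
    coeff [some 1, some δ] ψ = coeff [some δ⁻¹, some 1] ψ + coeff [none, some 1] ψ +
      if δ = 1 then k.coeff 1 else 0 := by
  simp only [coeff_cons, coeff_nil]
  have h1 : cst (lStrip (some δ) (aeval (FreeAlgebra.ι ℚ (some (1 : Γ))) k)) =
      if δ = 1 then k.coeff 1 else 0 := by
    split_ifs with hδ
    · subst hδ
      rw [lStrip_aeval_self, ← aeval_algHom_apply, cst_ι, ← coeff_zero_eq_aeval_zero, coeff_divX]
    · rw [lStrip_aeval_of_ne (by simpa using hδ), map_zero]
  rw [h.1, map_add, map_add, h1, ← cst_rStrip_eq_cst_lStrip, rStrip_swap, cst_swap,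
    rSum_apply, map_add]
  simp only [cst_rStrip_eq_cst_lStrip, lStrip_rStrip]

/-- Linear algebra in degree two. Take a, b with a, b, ab all different from 1, which three group
elements permit. In the sum of the relations `tri` at (a, b) and at (a⁻¹, b⁻¹) the left sides cancel
by antisymmetry, and the right sides add up to 3(ψ|x₀x₁) by `hone`; this coefficient is −k₁. -/
theorem EndRelation.coeff_one_eq_zero (hψ : ψ ∈ Lib Γ) (h : EndRelation ψ k)
    (hΓ : 3 ≤ Fintype.card Γ) : k.coeff 1 = 0 := by
  classical
  obtain ⟨a, ha⟩ : ∃ a : Γ, a ≠ 1 :=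
    haveI : Nontrivial Γ := Fintype.one_lt_card_iff_nontrivial.1 (by omega)
    exists_ne 1
  obtain ⟨b, hb⟩ : ∃ b : Γ, b ∉ ({1, a⁻¹} : Finset Γ) := by
    by_contra! hall
    have h1 := Finset.card_le_card (fun x _ => hall x : Finset.univ ⊆ ({1, a⁻¹} : Finset Γ))
    have h2 := Finset.card_le_two (a := (1 : Γ)) (b := a⁻¹)
    rw [Finset.card_univ] at h1
    omega
  simp only [Finset.mem_insert, Finset.mem_singleton, not_or] at hb
  have hab : a * b ≠ 1 := fun h => hb.2 (eq_inv_of_mul_eq_one_right h)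
  have anti := fun σ τ : Γ => coeff_pair_antisymm hψ (some σ) (some τ)
  have hself : ∀ σ : Γ, coeff [some σ, some σ] ψ = 0 := fun σ => by
    have := anti σ σ
    linarith
  have hzero : ∀ σ : Γ, σ ≠ 1 → coeff [none, some σ] ψ = -coeff [some 1, some σ] ψ := by
    intro σ hσ
    have h1 := h.coeff_pair σ hσ
    rw [inv_mul_cancel, hself] at h1
    linarith
  have hsum : ∀ u v : Γ, u * v ≠ 1 → coeff [some u, some (u * v)] ψ +
      coeff [some v, some (u * v)] ψ = coeff [some 1, some (u * v)] ψ := by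
    intro u v huv
    have h1 := h.coeff_pair u huv
    rw [inv_mul_cancel_left, hzero _ huv, anti] at h1
    linarith
  have hone : ∀ u : Γ, u ≠ 1 → coeff [some 1, some u] ψ + coeff [some 1, some u⁻¹] ψ =
      coeff [none, some 1] ψ := by
    intro u hu
    have h1 := h.coeff_pair_one u
    rw [if_neg hu, anti (u⁻¹)] at h1
    linarith
  have hk : k.coeff 1 = -coeff [none, some 1] ψ := by
    have h1 := h.coeff_pair_one 1
    rw [inv_one, if_pos rfl, hself] at h1
    linarith
  have tri : ∀ u v : Γ, u ≠ 1 → v ≠ 1 → u * v ≠ 1 →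
      coeff [some v⁻¹, some u] ψ + coeff [some u⁻¹, some v] ψ =
        coeff [some 1, some (u * v)] ψ + coeff [some 1, some u] ψ + coeff [some 1, some v] ψ := by
    intro u v hu hv huv
    have h1 := hsum u v huv
    have h2 := hsum (u * v) v⁻¹ (by simpa using hu)
    have h3 := hsum (u * v) u⁻¹ (by rw [mul_comm u v]; simpa using hv)
    rw [mul_inv_cancel_right] at h2
    rw [mul_comm u v, mul_inv_cancel_right, mul_comm v u] at h3
    have h4 := anti u (u * v)
    have h5 := anti v (u * v)
    linarith
  have t1 := tri a b ha hb.1 hab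
  have t2 := tri a⁻¹ b⁻¹ (by simpa using ha) (by simpa using hb.1)
    (by rw [← mul_inv]; exact inv_ne_one.2 hab)
  rw [inv_inv, inv_inv, ← mul_inv] at t2
  have o1 := hone _ ha
  have o2 := hone _ hb.1
  have o3 := hone _ hab
  have a1 := anti b⁻¹ a
  have a2 := anti a⁻¹ b
  linarith

/-- The consequences for the ends of words of membership in `𝔡𝔪𝔯₀`. -/
theorem ends_of_mem_dmr₀ {ψ : IharaLib Γ} (hψ : ψ ∈ dmr₀ Γ) :
    EndRelation (incl Γ ψ) 0 ∧
      (corrPoly (incl Γ ψ)).comp (-X) = -corrPoly (incl Γ ψ) ∧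
        ∀ g, endDefect (incl Γ ψ) g = 0 := by
  obtain ⟨⟨hx0, hx1, hprim⟩, hp1, hp2⟩ := hψ
  have hL : incl Γ ψ ∈ Lib Γ := ψ.2
  have hE := endRelation_of_harmonicPrimitive hL hprim
  set p := corrPoly (incl Γ ψ) with hp
  set k := (p + p.comp (-X)).divX with hk
  have hcoeff : ∀ n, (p + p.comp (-X)).coeff n = p.coeff n * (1 + (-1) ^ n) := by
    intro n
    rw [coeff_add, show (-X : ℚ[X]) = C (-1) * X by simp, comp_C_mul_X_coeff]
    ring
  have hk1 : k.coeff 1 = 0 := by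
    -- For |Γ| ≤ 2 the condition at (2, 1) says 2(ψ|x₀x₁) = 0, and this coefficient determines that
    -- of T² in p.
    rcases Nat.lt_or_ge 2 (Fintype.card Γ) with hc | hc
    · exact hE.coeff_one_eq_zero hL hc
    · have h1 := hp2 hc
      rw [ParityCondition, inv_one, show (2 : ℕ+) = (0 + 1).succPNat from rfl,
        coeff_lowerStar_succ] at h1
      have h2 : coeff (List.replicate (0 + 1) none ++ [some (1 : Γ)]) (incl Γ ψ) = 0 := by
        rw [Nat.succPNat_coe, neg_one_sq, one_mul] at h1
        linarith
      rw [hk, coeff_divX, hcoeff, hp, corrPoly_coeff_succ, h2, mul_zero, zero_mul]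
  have hk0 : k = 0 := by
    ext n
    rcases n with _ | _ | n
    · rw [hk, coeff_divX, hcoeff]
      simp
    · exact hk1
    · exact hE.coeff_eq_zero hL n
  rw [hk0] at hE
  refine ⟨hE, ?_, ?_⟩
  · rw [eq_neg_iff_add_eq_zero, add_comm, ← divX_mul_X_add (p + p.comp (-X)), ← hk, hk0, hcoeff,
      hp, corrPoly_coeff_zero]
    simp
  · refine endDefect_eq_zero hL hE fun g => ?_
    have hr0 : cst (rStrip none (incl Γ ψ)) = 0 := by
      rw [cst_rStrip_eq_cst_lStrip, ← coeff_nil, ← coeff_cons, hx0]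
    rw [endDefect, map_sub, cst_tAct, rSum_apply, lSum_apply, map_add, map_add,
      ← cst_rStrip_eq_cst_lStrip none, hr0, add_zero, add_zero, cst_rStrip_eq_cst_lStrip,
      ← coeff_nil, ← coeff_nil, ← coeff_cons, ← coeff_cons]
    -- What is left is (ψ|x_g) = (ψ|x_{g⁻¹}): the parity condition for n = 1, or trivial when every
    -- element is its own inverse.
    rcases Nat.lt_or_ge 2 (Fintype.card Γ) with hc | hc
    · have h1 := hp1 hc g
      rw [ParityCondition, coeff_lowerStar_one _ _ hx1, coeff_lowerStar_one _ _ hx1] at h1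
      simpa [sub_eq_add_neg] using h1
    · have hg : g⁻¹ = g := by
        by_contra hne
        have hg1 : g ≠ 1 := by
          rintro rfl
          simp at hne
        have := Fintype.two_lt_card_iff.2 ⟨1, g, g⁻¹, hg1.symm, by simpa using hg1, Ne.symm hne⟩
        omega
      rw [hg, sub_self]

end ParityConsequences

/-! ### Removing several letters x₀ at the ends. -/

section Iterates

variable {Γ : Type*} [CommGroup Γ] [Fintype Γ] {ψ : QX Γ}

variable (Γ) in
/-- The derivation with `x₀ ↦ 1` which kills the other letters. -/
def zder : QX Γ →ₗ[ℚ] QX Γ :=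
  sder fun
    | none => 1
    | some _ => 0

theorem rStrip_zder (a : XLetter Γ) (v : QX Γ) :
    rStrip a (zder Γ v) = zder Γ (rStrip a v) + rStrip a (rStrip none v) := by
  rw [zder, rStrip_sder]
  simp [-map_sum]

theorem lStrip_zder (a : XLetter Γ) (v : QX Γ) :
    lStrip a (zder Γ v) = zder Γ (lStrip a v) + lStrip a (lStrip none v) := by
  rw [zder, lStrip_sder]
  simp [-map_sum]

theorem cst_zder (v : QX Γ) : cst (zder Γ v) = cst (rStrip none v) := by
  rw [zder, cst_sder]
  simp [-map_sum]

theorem zder_tAct (σ : Γ) (v : QX Γ) : zder Γ (tAct σ v) = tAct σ (zder Γ v) := by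
  unfold zder
  induction v using left_induction with
  | one => simp
  | ι_mul a v hv => cases a <;> simp [sder_mul, sder_ι, tAct_none, tAct_some, hv]
  | add x y hx hy => simp only [map_add, hx, hy]
  | smul c x hx => simp only [map_smul, hx]

/-- As `zder` kills ψ, only its commutators with the n strips contribute, one for each strip. -/
theorem zder_rZero (h : zder Γ ψ = 0) (n : ℕ) :
    zder Γ (rZero Γ n ψ) = -(n : ℚ) • rZero Γ (n + 1) ψ := by
  induction n with
  | zero => simp [h]
  | succ n ih =>
    have h1 := rStrip_zder none (rZero Γ n ψ)
    rw [ih, ← rZero_succ', ← rZero_succ', map_smul, ← rZero_succ'] at h1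
    rw [eq_sub_of_add_eq h1.symm, Nat.cast_succ, neg_add, add_smul, neg_one_smul, sub_eq_add_neg]

theorem zder_lZero (h : zder Γ ψ = 0) (n : ℕ) :
    zder Γ (lZero Γ n ψ) = -(n : ℚ) • lZero Γ (n + 1) ψ := by
  induction n with
  | zero => simp [h]
  | succ n ih =>
    have h1 := lStrip_zder none (lZero Γ n ψ)
    rw [ih, ← lZero_succ', ← lZero_succ', map_smul, ← lZero_succ'] at h1
    rw [eq_sub_of_add_eq h1.symm, Nat.cast_succ, neg_add, add_smul, neg_one_smul, sub_eq_add_neg]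

theorem zder_rStrip_rZero (h : zder Γ ψ = 0) (a : XLetter Γ) (n : ℕ) :
    zder Γ (rStrip a (rZero Γ n ψ)) = -((n : ℚ) + 1) • rStrip a (rZero Γ (n + 1) ψ) := by
  have h1 := rStrip_zder a (rZero Γ n ψ)
  rw [zder_rZero h, ← rZero_succ', map_smul] at h1
  rw [eq_sub_of_add_eq h1.symm, neg_add, add_smul, neg_one_smul, sub_eq_add_neg]

theorem zder_lStrip_lZero (h : zder Γ ψ = 0) (a : XLetter Γ) (n : ℕ) :
    zder Γ (lStrip a (lZero Γ n ψ)) = -((n : ℚ) + 1) • lStrip a (lZero Γ (n + 1) ψ) := by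
  have h1 := lStrip_zder a (lZero Γ n ψ)
  rw [zder_lZero h, ← lZero_succ', map_smul] at h1
  rw [eq_sub_of_add_eq h1.symm, neg_add, add_smul, neg_one_smul, sub_eq_add_neg]

theorem zder_eq_zero (hψ : ψ ∈ Lib Γ) (h0 : coeff [none] ψ = 0) : zder Γ ψ = 0 := by
  rw [coeff_cons, coeff_nil, ← cst_rStrip_eq_cst_lStrip] at h0
  rw [zder, sder_of_mem_Lib _ hψ]
  simp [h0]

/-- This is the coefficient of x₀^n. Comparing constant terms in `zder_rZero` gives it with a
nonzero factor. -/
theorem cst_rZero (hc : cst ψ = 0) (h : zder Γ ψ = 0) (n : ℕ) : cst (rZero Γ n ψ) = 0 := by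
  cases n with
  | zero => exact hc
  | succ n =>
    have h1 := congrArg cst (zder_rZero h n)
    rw [cst_zder, ← rZero_succ', map_smul, smul_eq_mul] at h1
    have h2 : ((n : ℚ) + 1) * cst (rZero Γ (n + 1) ψ) = 0 := by linear_combination h1
    exact (mul_eq_zero.1 h2).resolve_left (by positivity)

theorem cst_lZero (hc : cst ψ = 0) (h : zder Γ ψ = 0) (n : ℕ) : cst (lZero Γ n ψ) = 0 := by
  cases n with
  | zero => exact hc
  | succ n =>
    have h1 := congrArg cst (zder_lZero h n)
    rw [cst_zder, cst_rStrip_eq_cst_lStrip, ← lZero_succ', map_smul, smul_eq_mul] at h1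
    have h2 : ((n : ℚ) + 1) * cst (lZero Γ (n + 1) ψ) = 0 := by linear_combination h1
    exact (mul_eq_zero.1 h2).resolve_left (by positivity)

/-- The symmetry between the ends of words, after removal of letters `x₀`. -/
theorem rSum_rZero (h : zder Γ ψ = 0) (hψ : ∀ g, endDefect ψ g = 0) (n : ℕ) (g : Γ) :
    rSum g (rZero Γ n ψ) = tAct g (lSum g⁻¹ (lZero Γ n ψ)) := by
  induction n with
  | zero => exact sub_eq_zero.1 (hψ g)
  | succ n ih =>
    -- Up to the same factor −(n + 1) on both sides, `zder` removes one more x₀ at the end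
    -- concerned.
    have h1 := congrArg (zder Γ) ih
    rw [zder_tAct, rSum_apply, lSum_apply, map_add, map_add, zder_rStrip_rZero h,
      zder_rStrip_rZero h, zder_lStrip_lZero h, zder_lStrip_lZero h, ← smul_add, ← smul_add,
      ← rSum_apply, ← lSum_apply, map_smul] at h1
    have h2 : -((n : ℚ) + 1) ≠ 0 := neg_ne_zero.2 (by positivity)
    exact smul_right_injective _ h2 h1

theorem exists_rZero_eq_zero (v : QX Γ) : ∃ N, ∀ n, N ≤ n → rZero Γ n v = 0 := by
  induction v using right_induction with
  | one =>
    refine ⟨1, fun n hn => ?_⟩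
    obtain ⟨n, rfl⟩ := Nat.exists_eq_add_of_le' hn
    simp [rZero_succ]
  | mul_ι a v hv =>
    classical
    obtain ⟨N, hN⟩ := hv
    refine ⟨N + 1, fun n hn => ?_⟩
    obtain ⟨n, rfl⟩ := Nat.exists_eq_add_of_le' (Nat.le_of_add_left_le hn)
    rw [rZero_succ, rStrip_mul_ι]
    split_ifs
    · exact hN _ (by omega)
    · exact map_zero _
  | add x y hx hy =>
    obtain ⟨M, hM⟩ := hx
    obtain ⟨N, hN⟩ := hy
    refine ⟨max M N, fun n hn => ?_⟩
    rw [map_add, hM n (le_trans (le_max_left _ _) hn), hN n (le_trans (le_max_right _ _) hn),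
      add_zero]
  | smul c x hx =>
    obtain ⟨N, hN⟩ := hx
    exact ⟨N, fun n hn => by rw [map_smul, hN n hn, smul_zero]⟩

theorem exists_lZero_eq_zero (v : QX Γ) : ∃ N, ∀ n, N ≤ n → lZero Γ n v = 0 := by
  induction v using left_induction with
  | one =>
    refine ⟨1, fun n hn => ?_⟩
    obtain ⟨n, rfl⟩ := Nat.exists_eq_add_of_le' hn
    simp [lZero_succ]
  | ι_mul a v hv =>
    classical
    obtain ⟨N, hN⟩ := hv
    refine ⟨N + 1, fun n hn => ?_⟩
    obtain ⟨n, rfl⟩ := Nat.exists_eq_add_of_le' (Nat.le_of_add_left_le hn)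
    rw [lZero_succ, lStrip_ι_mul]
    split_ifs
    · exact hN _ (by omega)
    · exact map_zero _
  | add x y hx hy =>
    obtain ⟨M, hM⟩ := hx
    obtain ⟨N, hN⟩ := hy
    refine ⟨max M N, fun n hn => ?_⟩
    rw [map_add, hM n (le_trans (le_max_left _ _) hn), hN n (le_trans (le_max_right _ _) hn),
      add_zero]
  | smul c x hx =>
    obtain ⟨N, hN⟩ := hx
    exact ⟨N, fun n hn => by rw [map_smul, hN n hn, smul_zero]⟩

theorem eq_sum_rZero (v : QX Γ) (h : ∀ n, cst (rZero Γ n v) = 0) (N : ℕ)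
    (hN : rZero Γ N v = 0) :
    v = ∑ i ∈ Finset.range N, ∑ a : Γ, rStrip (some a) (rZero Γ i v) *
      FreeAlgebra.ι ℚ (some a) * FreeAlgebra.ι ℚ none ^ i := by
  induction N generalizing v with
  | zero => exact hN
  | succ N ih =>
    have h1 := ih (rStrip none v) (fun n => by rw [← rZero_succ, h]) (by rw [← rZero_succ, hN])
    have h0 : cst v = 0 := h 0
    rw [Finset.sum_range_succ']
    nth_rewrite 1 [eq_sum_rStrip v]
    rw [Fintype.sum_option, h1, h0, map_zero, add_zero]
    simp only [Finset.sum_mul, mul_assoc, ← pow_succ, rZero_succ, rZero_zero, pow_zero, mul_one]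

theorem eq_sum_lZero (v : QX Γ) (h : ∀ n, cst (lZero Γ n v) = 0) (N : ℕ)
    (hN : lZero Γ N v = 0) :
    v = ∑ i ∈ Finset.range N, ∑ a : Γ, FreeAlgebra.ι ℚ none ^ i *
      (FreeAlgebra.ι ℚ (some a) * lStrip (some a) (lZero Γ i v)) := by
  induction N generalizing v with
  | zero => exact hN
  | succ N ih =>
    have h1 := ih (lStrip none v) (fun n => by rw [← lZero_succ, h]) (by rw [← lZero_succ, hN])
    have h0 : cst v = 0 := h 0
    rw [Finset.sum_range_succ']
    nth_rewrite 1 [eq_sum_lStrip v]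
    rw [Fintype.sum_option, h1, h0, map_zero, add_zero]
    simp only [Finset.mul_sum, ← mul_assoc, ← pow_succ', lZero_succ, lZero_zero, pow_zero, one_mul]

end Iterates

/-! ### The grading of ℚ⟨Y⟩ by Γ. -/

section Grading

variable {Γ : Type*} [CommGroup Γ]

open Classical in
/-- The projection of `ℚ⟨Y⟩` onto its component of degree `a`, where `y_{n,σ}` has degree `σ`. -/
def degProj (a : Γ) : QY Γ →ₗ[ℚ] QY Γ :=
  onWords fun w => if (w.map Prod.snd).prod = a then word w else 0

theorem degProj_one [DecidableEq Γ] (a : Γ) : degProj a 1 = if a = 1 then 1 else 0 := by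
  rw [← word_nil, degProj, onWords_word, word_nil]
  simp [eq_comm]

theorem degProj_ι_mul (a : Γ) (y : YLetter Γ) (v : QY Γ) :
    degProj a (FreeAlgebra.ι ℚ y * v) = FreeAlgebra.ι ℚ y * degProj (y.2⁻¹ * a) v := by
  induction v using induction_words with
  | word_mem w =>
    rw [← word_cons, degProj, onWords_word, degProj, onWords_word, List.map_cons, List.prod_cons,
      mul_ite, mul_zero, ← word_cons]
    congr 1
    rw [eq_inv_mul_iff_mul_eq]
  | add x y hx hy => simp only [map_add, mul_add, hx, hy]
  | smul c x hx => simp only [map_smul, mul_smul_comm, hx]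

/-- The product of the successive quotients telescopes to the last group element. -/
theorem degProj_theta [DecidableEq Γ] (a σ : Γ) (v : QX Γ) :
    degProj a (theta Γ (v * FreeAlgebra.ι ℚ (some σ))) =
      if a = σ then theta Γ (v * FreeAlgebra.ι ℚ (some σ)) else 0 := by
  induction v using block_induction generalizing σ a with
  | pow n =>
    rw [theta_pow_mul, ← mul_one (FreeAlgebra.ι ℚ _), degProj_ι_mul, degProj_one, mul_ite, mul_zero]
    simp only [inv_mul_eq_one, eq_comm]
  | block n g v hv =>
    have h := theta_block n g (v * FreeAlgebra.ι ℚ (some (g⁻¹ * σ)))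
    rw [map_mul (tAct g), tAct_some, mul_inv_cancel_left, ← mul_assoc] at h
    rw [h, degProj_ι_mul, hv, mul_ite, mul_zero]
    simp
  | add x y hx hy => simp only [map_add, add_mul, hx, hy]; split_ifs <;> simp
  | smul c x hx => simp only [map_smul, smul_mul_assoc, hx]; split_ifs <;> simp

variable [Fintype Γ]

/-- The projection of `ℚ⟨Y⟩ ⊗ ℚ⟨Y⟩` onto its component of total degree `a`. -/
def degProj₂ (a : Γ) : QY Γ ⊗[ℚ] QY Γ →ₗ[ℚ] QY Γ ⊗[ℚ] QY Γ :=
  ∑ b : Γ, TensorProduct.map (degProj b) (degProj (b⁻¹ * a))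

theorem degProj₂_tmul (a : Γ) (u v : QY Γ) :
    degProj₂ a (u ⊗ₜ[ℚ] v) = ∑ b : Γ, degProj b u ⊗ₜ[ℚ] degProj (b⁻¹ * a) v := by
  simp [degProj₂]

theorem degProj₂_ι_left (a : Γ) (y : YLetter Γ) (T : QY Γ ⊗[ℚ] QY Γ) :
    degProj₂ a (FreeAlgebra.ι ℚ y ⊗ₜ[ℚ] 1 * T) =
      FreeAlgebra.ι ℚ y ⊗ₜ[ℚ] 1 * degProj₂ (y.2⁻¹ * a) T := by
  induction T using TensorProduct.induction_on with
  | zero => simp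
  | tmul u v =>
    rw [Algebra.TensorProduct.tmul_mul_tmul, degProj₂_tmul, degProj₂_tmul, Finset.mul_sum]
    refine Fintype.sum_equiv (Equiv.mulLeft y.2⁻¹) _ _ fun b => ?_
    rw [Algebra.TensorProduct.tmul_mul_tmul, one_mul, one_mul, degProj_ι_mul]
    simp [mul_assoc]
  | add S T hS hT => simp only [mul_add, map_add, hS, hT]

theorem degProj₂_ι_right (a : Γ) (y : YLetter Γ) (T : QY Γ ⊗[ℚ] QY Γ) :
    degProj₂ a (1 ⊗ₜ[ℚ] FreeAlgebra.ι ℚ y * T) =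
      1 ⊗ₜ[ℚ] FreeAlgebra.ι ℚ y * degProj₂ (y.2⁻¹ * a) T := by
  induction T using TensorProduct.induction_on with
  | zero => simp
  | tmul u v =>
    rw [Algebra.TensorProduct.tmul_mul_tmul, degProj₂_tmul, degProj₂_tmul, Finset.mul_sum]
    refine Finset.sum_congr rfl fun b _ => ?_
    rw [Algebra.TensorProduct.tmul_mul_tmul, one_mul, one_mul, degProj_ι_mul, mul_left_comm]
  | add S T hS hT => simp only [mul_add, map_add, hS, hT]

theorem degProj₂_ι_ι (a : Γ) (y z : YLetter Γ) (T : QY Γ ⊗[ℚ] QY Γ) :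
    degProj₂ a (FreeAlgebra.ι ℚ y ⊗ₜ[ℚ] FreeAlgebra.ι ℚ z * T) =
      FreeAlgebra.ι ℚ y ⊗ₜ[ℚ] FreeAlgebra.ι ℚ z * degProj₂ ((y.2 * z.2)⁻¹ * a) T := by
  have h : (FreeAlgebra.ι ℚ y ⊗ₜ[ℚ] FreeAlgebra.ι ℚ z : QY Γ ⊗[ℚ] QY Γ) =
      FreeAlgebra.ι ℚ y ⊗ₜ[ℚ] 1 * 1 ⊗ₜ[ℚ] FreeAlgebra.ι ℚ z := by simp
  rw [h, mul_assoc, degProj₂_ι_left, degProj₂_ι_right, mul_inv_rev, mul_assoc, mul_assoc]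

theorem harmonicCoproduct_degProj (a : Γ) (v : QY Γ) :
    harmonicCoproduct (degProj a v) = degProj₂ a (harmonicCoproduct v) := by
  classical
  induction v using left_induction generalizing a with
  | one =>
    rw [map_one harmonicCoproduct, degProj_one, Algebra.TensorProduct.one_def, degProj₂_tmul]
    have h : ∀ b : Γ, (degProj b 1 : QY Γ) ⊗ₜ[ℚ] (degProj (b⁻¹ * a) 1 : QY Γ) =
        if b = 1 then (1 ⊗ₜ[ℚ] (if a = 1 then 1 else 0) : QY Γ ⊗[ℚ] QY Γ) else 0 := by
      intro b
      by_cases hb : b = 1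
      · subst hb
        simp [degProj_one]
      · simp [degProj_one, hb]
    simp only [h, Finset.sum_ite_eq', Finset.mem_univ, if_true]
    split_ifs <;> simp [Algebra.TensorProduct.one_def]
  | ι_mul y v hv =>
    obtain ⟨n, g⟩ := y
    obtain ⟨m, rfl⟩ : ∃ m : ℕ, n = m.succPNat := ⟨n.natPred, (PNat.succPNat_natPred n).symm⟩
    rw [degProj_ι_mul, map_mul, map_mul, hv, harmonicCoproduct_ι]
    simp only [add_mul, Finset.sum_mul, map_add, map_sum, degProj₂_ι_left, degProj₂_ι_right,
      degProj₂_ι_ι, mul_inv_cancel_left]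
  | add x y hx hy => simp only [map_add, hx, hy]
  | smul c x hx => simp only [map_smul, hx]

theorem HarmonicPrimitive.degProj {v : QY Γ} (hv : HarmonicPrimitive v) (a : Γ) :
    HarmonicPrimitive (degProj a v) := by
  classical
  rw [HarmonicPrimitive, harmonicCoproduct_degProj, hv, map_add, degProj₂_tmul, degProj₂_tmul]
  congr 1
  · rw [Finset.sum_eq_single a]
    · simp [degProj_one]
    · intro b _ hb
      rw [degProj_one, if_neg, TensorProduct.tmul_zero]
      rw [inv_mul_eq_one]
      exact hb
    · simp
  · rw [Finset.sum_eq_single 1]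
    · simp [degProj_one]
    · intro b _ hb
      rw [degProj_one, if_neg hb, TensorProduct.zero_tmul]
    · simp

/-- The words of `v` ending in x_a make up the component of degree a, and components of a primitive
element are primitive since Δ_* respects the grading. -/
theorem HarmonicPrimitive.theta_rStrip {v : QX Γ} (hv : HarmonicPrimitive (theta Γ v))
    (hc : cst v = 0) (a : Γ) :
    HarmonicPrimitive (theta Γ (rStrip (some a) v * FreeAlgebra.ι ℚ (some a))) := by
  classical
  have h := hv.degProj a
  rw [theta_eq_sum v, hc, map_zero, add_zero, map_sum] at h
  simpa only [degProj_theta, Finset.sum_ite_eq, Finset.mem_univ, if_true] using h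

end Grading

/-! ### Operations which preserve primitivity. -/

section PrimitiveOperations

variable {Γ : Type*} [CommGroup Γ] [Fintype Γ]

theorem HarmonicPrimitive.neg {v : QY Γ} (hv : HarmonicPrimitive v) : HarmonicPrimitive (-v) := by
  rw [HarmonicPrimitive, map_neg, hv, neg_add, TensorProduct.neg_tmul, TensorProduct.tmul_neg]

theorem HarmonicPrimitive.add {u v : QY Γ} (hu : HarmonicPrimitive u) (hv : HarmonicPrimitive v) :
    HarmonicPrimitive (u + v) := by
  rw [HarmonicPrimitive, map_add, hu, hv, TensorProduct.add_tmul, TensorProduct.tmul_add]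
  abel

theorem HarmonicPrimitive.smul {v : QY Γ} (hv : HarmonicPrimitive v) (c : ℚ) :
    HarmonicPrimitive (c • v) := by
  rw [HarmonicPrimitive, map_smul, hv, smul_add, TensorProduct.smul_tmul',
    TensorProduct.tmul_smul]

theorem HarmonicPrimitive.commutator {u v : QY Γ} (hu : HarmonicPrimitive u)
    (hv : HarmonicPrimitive v) : HarmonicPrimitive (u * v - v * u) := by
  rw [HarmonicPrimitive, map_sub, map_mul, map_mul, hu, hv, TensorProduct.sub_tmul,
    TensorProduct.tmul_sub]
  simp only [add_mul, mul_add, Algebra.TensorProduct.tmul_mul_tmul, one_mul, mul_one]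
  abel

theorem map_tau_mul (S T : QY Γ ⊗[ℚ] QY Γ) :
    TensorProduct.map (tau Γ) (tau Γ) (S * T) =
      TensorProduct.map (tau Γ) (tau Γ) T * TensorProduct.map (tau Γ) (tau Γ) S := by
  induction S using TensorProduct.induction_on with
  | zero => simp
  | tmul u v =>
    induction T using TensorProduct.induction_on with
    | zero => simp
    | tmul u' v' =>
      simp only [Algebra.TensorProduct.tmul_mul_tmul, TensorProduct.map_tmul, tau_mul]
    | add S T hS hT => simp only [mul_add, add_mul, map_add, hS, hT]
  | add S T hS hT => simp only [mul_add, add_mul, map_add, hS, hT]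

theorem tau_one : tau Γ 1 = 1 := antiLift_one _

theorem tau_ι (m : ℕ) (g : Γ) : tau Γ (FreeAlgebra.ι ℚ (m.succPNat, g)) =
    (-1 : ℚ) ^ (m + 1) • FreeAlgebra.ι ℚ (m.succPNat, g⁻¹) := by
  rw [tau, antiLift_ι]
  rfl

theorem harmonicCoproduct_tau (v : QY Γ) :
    harmonicCoproduct (tau Γ v) = TensorProduct.map (tau Γ) (tau Γ) (harmonicCoproduct v) := by
  induction v using left_induction with
  | one => rw [tau_one, map_one harmonicCoproduct, Algebra.TensorProduct.one_def, TensorProduct.map_tmul,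
      tau_one]
  | ι_mul y v hv =>
    obtain ⟨n, g⟩ := y
    obtain ⟨m, rfl⟩ : ∃ m : ℕ, n = m.succPNat := ⟨n.natPred, (PNat.succPNat_natPred n).symm⟩
    rw [tau_mul, map_mul, map_mul, map_tau_mul, hv, tau_ι, map_smul, harmonicCoproduct_ι,
      harmonicCoproduct_ι]
    congr 1
    simp only [map_add, map_sum, TensorProduct.map_tmul, tau_ι, tau_one, smul_add, Finset.smul_sum]
    congr 1
    · simp only [TensorProduct.smul_tmul', TensorProduct.tmul_smul]
    · refine Finset.sum_congr rfl fun j hj => Fintype.sum_equiv (Equiv.inv Γ) _ _ fun c => ?_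
      rw [Finset.mem_range] at hj
      rw [TensorProduct.smul_tmul_smul, ← pow_add,
        show j + 1 + (m - 1 - j + 1) = m + 1 by omega]
      simp [mul_comm]
  | add x y hx hy => simp only [map_add, hx, hy]
  | smul c x hx => simp only [map_smul, hx]

theorem HarmonicPrimitive.tau {v : QY Γ} (hv : HarmonicPrimitive v) :
    HarmonicPrimitive (tau Γ v) := by
  rw [HarmonicPrimitive, harmonicCoproduct_tau, hv, map_add, TensorProduct.map_tmul,
    TensorProduct.map_tmul, tau_one]

end PrimitiveOperations

/-! ### Derivations which are coderivations. -/

section Coderivation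

variable {Γ : Type*} [CommGroup Γ] [Fintype Γ]

/-- The property `Δ ∘ D = (D ⊗ 1 + 1 ⊗ D) ∘ Δ` for an element of `ℚ⟨Y⟩`. -/
def CoderivationAt (D : QY Γ →ₗ[ℚ] QY Γ) (v : QY Γ) : Prop :=
  harmonicCoproduct (D v) =
    D.rTensor (QY Γ) (harmonicCoproduct v) + D.lTensor (QY Γ) (harmonicCoproduct v)

theorem rTensor_der_mul (D : YLetter Γ → QY Γ) (S T : QY Γ ⊗[ℚ] QY Γ) :
    (der D).rTensor (QY Γ) (S * T) =
      (der D).rTensor (QY Γ) S * T + S * (der D).rTensor (QY Γ) T := by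
  induction S using TensorProduct.induction_on with
  | zero => simp
  | tmul u v =>
    induction T using TensorProduct.induction_on with
    | zero => simp
    | tmul u' v' =>
      simp only [Algebra.TensorProduct.tmul_mul_tmul, LinearMap.rTensor_tmul, der_mul,
        TensorProduct.add_tmul]
    | add S T hS hT => simp only [mul_add, map_add, hS, hT]; abel
  | add S T hS hT => simp only [add_mul, map_add, hS, hT]; abel

theorem lTensor_der_mul (D : YLetter Γ → QY Γ) (S T : QY Γ ⊗[ℚ] QY Γ) :
    (der D).lTensor (QY Γ) (S * T) =
      (der D).lTensor (QY Γ) S * T + S * (der D).lTensor (QY Γ) T := by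
  induction S using TensorProduct.induction_on with
  | zero => simp
  | tmul u v =>
    induction T using TensorProduct.induction_on with
    | zero => simp
    | tmul u' v' =>
      simp only [Algebra.TensorProduct.tmul_mul_tmul, LinearMap.lTensor_tmul, der_mul,
        TensorProduct.tmul_add]
    | add S T hS hT => simp only [mul_add, map_add, hS, hT]; abel
  | add S T hS hT => simp only [add_mul, map_add, hS, hT]; abel

theorem der_one {A : Type*} (D : A → FreeAlgebra ℚ A) : der D 1 = 0 := by
  rw [← map_one (algebraMap ℚ _), der_algebraMap]

theorem coderivationAt_of_ι {D : YLetter Γ → QY Γ}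
    (h : ∀ y, CoderivationAt (der D) (FreeAlgebra.ι ℚ y)) (v : QY Γ) :
    CoderivationAt (der D) v := by
  unfold CoderivationAt at *
  induction v using left_induction with
  | one => simp [der_one, Algebra.TensorProduct.one_def]
  | ι_mul y v hv =>
    rw [der_mul, map_add, map_mul, map_mul, map_mul, h, hv, rTensor_der_mul, lTensor_der_mul]
    noncomm_ring
  | add x y hx hy => simp only [map_add, hx, hy]; abel
  | smul c x hx => simp only [map_smul, hx, smul_add]

theorem HarmonicPrimitive.der {D : YLetter Γ → QY Γ}
    (h : ∀ y, CoderivationAt (der D) (FreeAlgebra.ι ℚ y)) {v : QY Γ} (hv : HarmonicPrimitive v) :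
    HarmonicPrimitive (der D v) := by
  have h1 := coderivationAt_of_ι h v
  rw [CoderivationAt, hv] at h1
  rw [HarmonicPrimitive, h1]
  simp [der_one]

end Coderivation

/-! ### The lowering derivation, image of ∂/∂x₀ under θ. -/

section Lowering

variable {Γ : Type*} [CommGroup Γ] [Fintype Γ]

variable (Γ) in
/-- The derivation of `ℚ⟨Y⟩` with `y_{n,σ} ↦ (n - 1) y_{n-1,σ}`. -/
def lowering : QY Γ →ₗ[ℚ] QY Γ :=
  der fun y => (y.1.natPred : ℚ) • FreeAlgebra.ι ℚ ((y.1.natPred - 1).succPNat, y.2)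

/-- The truncated `m - 1` is harmless at m = 0, where the factor vanishes. -/
theorem lowering_ι (m : ℕ) (g : Γ) : lowering Γ (FreeAlgebra.ι ℚ (m.succPNat, g)) =
    (m : ℚ) • FreeAlgebra.ι ℚ ((m - 1).succPNat, g) := by
  rw [lowering, der_ι]
  simp

theorem lowering_mul (u v : QY Γ) :
    lowering Γ (u * v) = lowering Γ u * v + u * lowering Γ v := der_mul _ _ _

/-- A term y_j ⊗ y_l with j + l = n − 1 arises from y_{j+1} ⊗ y_l and from y_j ⊗ y_{l+1}, with
weights j and l. Their sum n − 1 does not depend on j. -/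
theorem coderivationAt_lowering (y : YLetter Γ) :
    CoderivationAt (lowering Γ) (FreeAlgebra.ι ℚ y) := by
  obtain ⟨n, g⟩ := y
  obtain ⟨m, rfl⟩ : ∃ m : ℕ, n = m.succPNat := ⟨n.natPred, (PNat.succPNat_natPred n).symm⟩
  have h1 : lowering Γ 1 = 0 := der_one _
  rw [CoderivationAt, lowering_ι, map_smul, harmonicCoproduct_ι, harmonicCoproduct_ι]
  simp only [map_add, map_sum, LinearMap.rTensor_tmul, LinearMap.lTensor_tmul, lowering_ι, h1,
    TensorProduct.zero_tmul, TensorProduct.tmul_zero, add_zero, zero_add]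
  rcases m with _ | n
  · simp
  have h2 : (((n + 1 : ℕ) : ℚ) • ∑ j ∈ Finset.range n, ∑ c : Γ,
      FreeAlgebra.ι ℚ (j.succPNat, c) ⊗ₜ[ℚ] FreeAlgebra.ι ℚ ((n - 1 - j).succPNat, c⁻¹ * g) :
        QY Γ ⊗[ℚ] QY Γ) =
      ∑ j ∈ Finset.range (n + 1), ∑ c : Γ, ((j : ℚ) • FreeAlgebra.ι ℚ ((j - 1).succPNat, c)) ⊗ₜ[ℚ]
        FreeAlgebra.ι ℚ ((n - j).succPNat, c⁻¹ * g) +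
      ∑ j ∈ Finset.range (n + 1), ∑ c : Γ, FreeAlgebra.ι ℚ (j.succPNat, c) ⊗ₜ[ℚ]
        (((n - j : ℕ) : ℚ) • FreeAlgebra.ι ℚ ((n - j - 1).succPNat, c⁻¹ * g)) := by
    rw [Finset.sum_range_succ', Finset.sum_range_succ]
    simp only [Nat.cast_zero, zero_smul, TensorProduct.zero_tmul, Nat.sub_self,
      TensorProduct.tmul_zero, Finset.sum_const_zero, add_zero, Nat.add_sub_cancel]
    rw [← Finset.sum_add_distrib, Finset.smul_sum]
    refine Finset.sum_congr rfl fun j hj => ?_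
    rw [Finset.mem_range] at hj
    rw [← Finset.sum_add_distrib, Finset.smul_sum]
    refine Finset.sum_congr rfl fun c _ => ?_
    rw [← TensorProduct.smul_tmul', TensorProduct.tmul_smul, show n - (j + 1) = n - 1 - j by omega,
      show n - j - 1 = n - 1 - j by omega, ← add_smul]
    congr 1
    rw [Nat.cast_sub hj.le]
    push_cast
    ring
  simp only [Nat.add_sub_cancel, smul_add]
  rw [h2, TensorProduct.smul_tmul', TensorProduct.tmul_smul]
  abel

theorem zder_pow (n : ℕ) :
    zder Γ (FreeAlgebra.ι ℚ none ^ n) = (n : ℚ) • FreeAlgebra.ι ℚ none ^ (n - 1) := by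
  have h : zder Γ (Polynomial.aeval (FreeAlgebra.ι ℚ none) (Polynomial.X ^ n)) = _ :=
    (sder_aeval _ _ _).trans (one_smul _ _)
  simpa [Polynomial.derivative_X_pow, Algebra.smul_def] using h

theorem theta_zder (v : QX Γ) (a : Γ) :
    theta Γ (zder Γ v * FreeAlgebra.ι ℚ (some a)) =
      lowering Γ (theta Γ (v * FreeAlgebra.ι ℚ (some a))) := by
  induction v using block_induction generalizing a with
  | pow n => rw [zder_pow, smul_mul_assoc, map_smul, theta_pow_mul, theta_pow_mul, lowering_ι]
  | block n g v hv =>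
    have h1 : ∀ (k : ℕ) (u : QX Γ), theta Γ (FreeAlgebra.ι ℚ none ^ k * FreeAlgebra.ι ℚ (some g) *
        tAct g u * FreeAlgebra.ι ℚ (some a)) =
        FreeAlgebra.ι ℚ (k.succPNat, g) * theta Γ (u * FreeAlgebra.ι ℚ (some (g⁻¹ * a))) := by
      intro k u
      have h := theta_block k g (u * FreeAlgebra.ι ℚ (some (g⁻¹ * a)))
      rwa [map_mul (tAct g), tAct_some, mul_inv_cancel_left, ← mul_assoc] at h
    have h2 : zder Γ (FreeAlgebra.ι ℚ none ^ n * FreeAlgebra.ι ℚ (some g) * tAct g v) =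
        (n : ℚ) • (FreeAlgebra.ι ℚ none ^ (n - 1) * FreeAlgebra.ι ℚ (some g) * tAct g v) +
          FreeAlgebra.ι ℚ none ^ n * FreeAlgebra.ι ℚ (some g) * tAct g (zder Γ v) := by
      have h3 := zder_pow (Γ := Γ) n
      rw [← zder_tAct]
      unfold zder at *
      rw [sder_mul, sder_mul, h3, sder_ι]
      simp
    rw [h2, add_mul, map_add, smul_mul_assoc, map_smul, h1, h1, h1, hv, lowering_mul, lowering_ι,
      smul_mul_assoc]
  | add x y hx hy => simp only [map_add, add_mul, hx, hy]
  | smul c x hx => simp only [map_smul, smul_mul_assoc, hx]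

end Lowering

/-! ### Balanced elements and the primitive pieces at their ends. -/

section Balanced

variable {Γ : Type*} [CommGroup Γ] [Fintype Γ]

/-- The properties of `ψ` which make the Ihara derivation of `ψ` correspond to a coderivation for
the harmonic coproduct. -/
structure Balanced (ψ : QX Γ) : Prop where
  cst_eq : cst ψ = 0
  antipode_eq : antipode ψ = -ψ
  zder_eq : zder Γ ψ = 0
  endDefect_eq : ∀ g, endDefect ψ g = 0
  primitive : HarmonicPrimitive (theta Γ ψ)

namespace Balanced

variable {ψ : QX Γ}

/-- The grading gives i = 0. From i to i + 1 one applies the lowering coderivation, which matches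
`zder` and hence strips one more x₀ up to a nonzero factor. -/
theorem primitive_right (h : Balanced ψ) (i : ℕ) (a : Γ) :
    HarmonicPrimitive (theta Γ (rStrip (some a) (rZero Γ i ψ) * FreeAlgebra.ι ℚ (some a))) := by
  induction i with
  | zero => exact h.primitive.theta_rStrip h.cst_eq a
  | succ i ih =>
    have h1 := (HarmonicPrimitive.der coderivationAt_lowering ih).smul (-((i : ℚ) + 1))⁻¹
    change HarmonicPrimitive (_ • lowering Γ _) at h1
    rw [← theta_zder, zder_rStrip_rZero h.zder_eq, smul_mul_assoc, map_smul, smul_smul,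
      inv_mul_cancel₀ (neg_ne_zero.2 (by positivity)), one_smul] at h1
    exact h1

/-- For i = 0, τ carries last letters to first letters because the antipode sends ψ to −ψ; then
lowering applies as on the right. -/
theorem primitive_left (h : Balanced ψ) (i : ℕ) (a : Γ) :
    HarmonicPrimitive
      (theta Γ (tAct a (lStrip (some a⁻¹) (lZero Γ i ψ)) * FreeAlgebra.ι ℚ (some a))) := by
  induction i with
  | zero =>
    have h1 := (h.primitive_right 0 a⁻¹).tau.neg
    have h2 := lStrip_antipode (some a⁻¹) ψ
    rw [h.antipode_eq, map_neg, neg_inj] at h2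
    rwa [tau_theta, neg_neg, rZero_zero, ← h2, inv_inv] at h1
  | succ i ih =>
    have h1 := (HarmonicPrimitive.der coderivationAt_lowering ih).smul (-((i : ℚ) + 1))⁻¹
    change HarmonicPrimitive (_ • lowering Γ _) at h1
    rw [← theta_zder, zder_tAct, zder_lStrip_lZero h.zder_eq, map_smul, smul_mul_assoc, map_smul,
      smul_smul, inv_mul_cancel₀ (neg_ne_zero.2 (by positivity)), one_smul] at h1
    exact h1

end Balanced

end Balanced

/-! ### Letters y_{n,g} for all integers n. -/

section IntegerLetters

variable {Γ : Type*} [CommGroup Γ] [Fintype Γ]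

open Classical in
/-- The letter `y_{n,g}`, extended to integers `n`: for `n = 0` it is `1` if `g = 1` and `0`
otherwise, and for `n < 0` it is `0`. -/
def yInt : ℤ → Γ → QY Γ
  | Int.ofNat 0, g => if g = 1 then 1 else 0
  | Int.ofNat (n + 1), g => FreeAlgebra.ι ℚ (n.succPNat, g)
  | Int.negSucc _, _ => 0

theorem yInt_zero [DecidableEq Γ] (g : Γ) : yInt 0 g = if g = 1 then 1 else 0 := by
  have h : yInt 0 g = @ite (QY Γ) (g = 1) (Classical.propDecidable _) 1 0 := rfl
  rw [h]
  congr

theorem yInt_succ (n : ℕ) (g : Γ) : yInt ((n : ℤ) + 1) g = FreeAlgebra.ι ℚ (n.succPNat, g) := rfl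

theorem yInt_of_neg {n : ℤ} (hn : n < 0) (g : Γ) : yInt n g = 0 := by
  obtain ⟨k, rfl⟩ := Int.eq_negSucc_of_lt_zero hn
  rfl

/-- The terms k = 0 and k = n absorb the two primitive terms. Any bound K above n will do, as the
terms with k > n vanish. -/
theorem harmonicCoproduct_yInt (n : ℤ) (K : ℕ) (hK : n < K) (g : Γ) :
    harmonicCoproduct (yInt n g) =
      ∑ k ∈ Finset.range K, ∑ c : Γ, yInt k c ⊗ₜ[ℚ] yInt (n - k) (c⁻¹ * g) := by
  classical
  rcases lt_or_ge n 0 with hn | hn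
  · rw [yInt_of_neg hn, map_zero]
    refine (Finset.sum_eq_zero fun k _ => Finset.sum_eq_zero fun c _ => ?_).symm
    rw [yInt_of_neg (by omega) (c⁻¹ * g), TensorProduct.tmul_zero]
  obtain ⟨m, rfl⟩ := Int.eq_ofNat_of_zero_le hn
  have hsub : ∑ k ∈ Finset.range (m + 1), ∑ c : Γ, yInt k c ⊗ₜ[ℚ] yInt (m - k) (c⁻¹ * g) =
      ∑ k ∈ Finset.range K, ∑ c : Γ, yInt k c ⊗ₜ[ℚ] yInt (m - k) (c⁻¹ * g) := by
    refine Finset.sum_subset (Finset.range_subset_range.2 (by omega)) fun k _ hk => ?_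
    rw [Finset.mem_range] at hk
    refine Finset.sum_eq_zero fun c _ => ?_
    rw [yInt_of_neg (n := m - k) (by omega), TensorProduct.tmul_zero]
  have hzero : ∀ (j : ℤ) (h : Γ), ∑ c : Γ, yInt 0 c ⊗ₜ[ℚ] yInt j (c⁻¹ * h) =
      (1 ⊗ₜ[ℚ] yInt j h : QY Γ ⊗[ℚ] QY Γ) := by
    intro j h
    rw [Finset.sum_eq_single 1]
    · simp [yInt_zero]
    · intro c _ hc
      rw [yInt_zero, if_neg hc, TensorProduct.zero_tmul]
    · simp
  rw [← hsub]
  rcases m with _ | m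
  · rw [Finset.sum_range_one]
    simp only [Nat.cast_zero, sub_zero, hzero]
    rw [yInt_zero]
    split_ifs <;> simp [Algebra.TensorProduct.one_def]
  · rw [Finset.sum_range_succ', Finset.sum_range_succ]
    simp only [Nat.cast_zero, sub_zero, hzero]
    have hlast : ∑ c : Γ, yInt ((m + 1 : ℕ) : ℤ) c ⊗ₜ[ℚ]
        yInt (((m + 1 : ℕ) : ℤ) - ((m + 1 : ℕ) : ℤ)) (c⁻¹ * g) =
        (yInt ((m + 1 : ℕ) : ℤ) g ⊗ₜ[ℚ] 1 : QY Γ ⊗[ℚ] QY Γ) := by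
      rw [Finset.sum_eq_single g]
      · simp [yInt_zero]
      · intro c _ hc
        rw [sub_self, yInt_zero, if_neg, TensorProduct.tmul_zero]
        rw [inv_mul_eq_one]
        exact hc
      · simp
    rw [hlast, Nat.cast_succ, yInt_succ, harmonicCoproduct_ι]
    have hmid : ∀ k ∈ Finset.range m, (∑ c : Γ, yInt ((k + 1 : ℕ) : ℤ) c ⊗ₜ[ℚ]
        yInt ((m : ℤ) + 1 - ((k + 1 : ℕ) : ℤ)) (c⁻¹ * g) : QY Γ ⊗[ℚ] QY Γ) =
        ∑ c : Γ, FreeAlgebra.ι ℚ (k.succPNat, c) ⊗ₜ[ℚ]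
          FreeAlgebra.ι ℚ ((m - 1 - k).succPNat, c⁻¹ * g) := by
      intro k hk
      rw [Finset.mem_range] at hk
      refine Finset.sum_congr rfl fun c _ => ?_
      rw [← yInt_succ, ← yInt_succ]
      congr 2
      omega
    rw [Finset.sum_congr rfl hmid]
    abel

theorem comm_harmonicCoproduct (v : QY Γ) :
    Algebra.TensorProduct.comm ℚ (QY Γ) (QY Γ) (harmonicCoproduct v) = harmonicCoproduct v := by
  have h : (Algebra.TensorProduct.comm ℚ (QY Γ) (QY Γ)).toAlgHom.comp harmonicCoproduct =
      harmonicCoproduct := by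
    refine FreeAlgebra.hom_ext (funext fun y => ?_)
    obtain ⟨n, g⟩ := y
    obtain ⟨m, rfl⟩ : ∃ m : ℕ, n = m.succPNat := ⟨n.natPred, (PNat.succPNat_natPred n).symm⟩
    change Algebra.TensorProduct.comm ℚ (QY Γ) (QY Γ)
      (harmonicCoproduct (FreeAlgebra.ι ℚ (m.succPNat, g))) =
      harmonicCoproduct (FreeAlgebra.ι ℚ (m.succPNat, g))
    rw [harmonicCoproduct_ι]
    simp only [map_add, map_sum, Algebra.TensorProduct.comm_tmul]
    rw [add_comm (1 ⊗ₜ[ℚ] _)]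
    congr 1
    rw [← Finset.sum_range_reflect]
    refine Finset.sum_congr rfl fun j hj => ?_
    rw [Finset.mem_range] at hj
    refine Fintype.sum_equiv ((Equiv.inv Γ).trans (Equiv.mulRight g)) _ _ fun c => ?_
    rw [show m - 1 - (m - 1 - j) = j by omega]
    simp
  exact DFunLike.congr_fun h v

theorem harmonicCoproduct_yInt' (n : ℤ) (K : ℕ) (hK : n < K) (g : Γ) :
    harmonicCoproduct (yInt n g) =
      ∑ k ∈ Finset.range K, ∑ c : Γ, yInt (n - k) (c⁻¹ * g) ⊗ₜ[ℚ] yInt k c := by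
  rw [← comm_harmonicCoproduct, harmonicCoproduct_yInt n K hK]
  simp only [map_sum, Algebra.TensorProduct.comm_tmul]

end IntegerLetters

/-! ### The Ihara derivation of ℚ⟨Y⟩ is a coderivation. -/

section IharaCoderivation

variable {Γ : Type*} [CommGroup Γ]

/-- The derivation of `ℚ⟨Y⟩` induced by the Ihara action of `ψ`. -/
def iharaDer (ψ : QX Γ) : QY Γ →ₗ[ℚ] QY Γ :=
  der fun y =>
    theta Γ (ψ * FreeAlgebra.ι ℚ none ^ y.1.natPred * FreeAlgebra.ι ℚ (some y.2)) -
      theta Γ (FreeAlgebra.ι ℚ none ^ y.1.natPred * tAct y.2 ψ * FreeAlgebra.ι ℚ (some y.2))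

theorem iharaDer_ι (ψ : QX Γ) (m : ℕ) (g : Γ) :
    iharaDer ψ (FreeAlgebra.ι ℚ (m.succPNat, g)) =
      theta Γ (ψ * FreeAlgebra.ι ℚ none ^ m * FreeAlgebra.ι ℚ (some g)) -
        theta Γ (FreeAlgebra.ι ℚ none ^ m * tAct g ψ * FreeAlgebra.ι ℚ (some g)) := by
  rw [iharaDer, der_ι]
  simp

theorem iharaDer_mul (ψ : QX Γ) (u v : QY Γ) :
    iharaDer ψ (u * v) = iharaDer ψ u * v + u * iharaDer ψ v := der_mul _ _ _

theorem iharaDer_one (ψ : QX Γ) : iharaDer ψ 1 = 0 := der_one _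

theorem dDer_pow_none (ψ : QX Γ) (n : ℕ) : dDer ψ (FreeAlgebra.ι ℚ none ^ n) = 0 := by
  induction n with
  | zero => exact der_one _
  | succ n ih => rw [pow_succ, dDer_mul, ih, dDer_none]; simp

theorem sAct_apply (ψ v : QX Γ) : sAct ψ v = ψ * v + dDer ψ v := rfl

/-- On a block x₀^n x_g, the term x_g t_g(ψ) of d_ψ(x_g) joins the derivation of the rest to form
s_ψ of the rest. So s_ψ passes along the blocks like a derivation and leaves ψ at the end. -/
theorem theta_sAct (ψ v : QX Γ) :
    theta Γ (sAct ψ v) = iharaDer ψ (theta Γ v) + theta Γ v * theta Γ ψ := by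
  induction v using block_induction with
  | pow n =>
    rw [sAct_apply, dDer_pow_none, add_zero]
    rcases n with _ | n
    · simp [theta_one, iharaDer_one]
    · rw [theta_pow, pow_succ, ← mul_assoc, theta_mul_none]
      simp
  | block n g v hv =>
    have h1 : sAct ψ (FreeAlgebra.ι ℚ none ^ n * FreeAlgebra.ι ℚ (some g) * tAct g v) =
        ψ * FreeAlgebra.ι ℚ none ^ n * FreeAlgebra.ι ℚ (some g) * tAct g v -
          FreeAlgebra.ι ℚ none ^ n * tAct g ψ * FreeAlgebra.ι ℚ (some g) * tAct g v +
          FreeAlgebra.ι ℚ none ^ n * FreeAlgebra.ι ℚ (some g) * tAct g (sAct ψ v) := by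
      rw [sAct_apply, sAct_apply, dDer_mul, dDer_mul, dDer_pow_none, dDer_some, map_add,
        tAct_dDer, map_mul]
      noncomm_ring
    rw [h1, map_add, map_sub, theta_block, hv, theta_mul_some_mul, theta_mul_some_mul,
      tAct_inv_self, theta_block, iharaDer_mul, iharaDer_ι]
    noncomm_ring
  | add x y hx hy => simp only [map_add, add_mul, hx, hy]; abel
  | smul c x hx => simp only [map_smul, smul_mul_assoc, hx, smul_add]

theorem theta_ihara (ψ φ : QX Γ) :
    theta Γ (ihara ψ φ) = iharaDer ψ (theta Γ φ) - iharaDer φ (theta Γ ψ) -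
      (theta Γ ψ * theta Γ φ - theta Γ φ * theta Γ ψ) := by
  rw [ihara, map_sub, theta_sAct, theta_sAct]
  abel

variable [Fintype Γ]

/-- Words of `v` are sorted by their last letter x_a and the number i of letters x₀ after it, which
merge with x₀^k x_g into one block. -/
theorem theta_mul_eq_sum (v : QX Γ) (h : ∀ n, cst (rZero Γ n v) = 0) (N : ℕ)
    (hN : rZero Γ N v = 0) (k : ℕ) (g : Γ) :
    theta Γ (v * FreeAlgebra.ι ℚ none ^ k * FreeAlgebra.ι ℚ (some g)) =
      ∑ i ∈ Finset.range N, ∑ a : Γ,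
        theta Γ (rStrip (some a) (rZero Γ i v) * FreeAlgebra.ι ℚ (some a)) *
          yInt ((k : ℤ) + 1 + i) (a⁻¹ * g) := by
  conv_lhs => rw [eq_sum_rZero v h N hN]
  simp only [Finset.sum_mul, map_sum]
  refine Finset.sum_congr rfl fun i _ => Finset.sum_congr rfl fun a _ => ?_
  rw [mul_assoc (_ * _), mul_assoc (_ * _), ← mul_assoc (_ ^ _), ← pow_add, theta_mul_some_mul,
    map_mul (tAct _),
    map_pow, tAct_none, tAct_some, theta_pow_mul, ← yInt_succ]
  congr 2
  push_cast
  ring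

theorem theta_mul_tAct_eq_sum (v : QX Γ) (h : ∀ n, cst (lZero Γ n v) = 0) (N : ℕ)
    (hN : lZero Γ N v = 0) (k : ℕ) (g : Γ) :
    theta Γ (FreeAlgebra.ι ℚ none ^ k * tAct g v * FreeAlgebra.ι ℚ (some g)) =
      ∑ i ∈ Finset.range N, ∑ a : Γ, yInt ((k : ℤ) + 1 + i) (a⁻¹ * g) *
        theta Γ (tAct a (lStrip (some a⁻¹) (lZero Γ i v)) * FreeAlgebra.ι ℚ (some a)) := by
  conv_lhs => rw [eq_sum_lZero v h N hN]
  simp only [Finset.sum_mul, Finset.mul_sum, map_sum]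
  refine Finset.sum_congr rfl fun i _ => Fintype.sum_equiv (Equiv.inv Γ) _ _ fun b => ?_
  have h1 := theta_block (k + i) (g * b)
    (tAct b⁻¹ (lStrip (some b) (lZero Γ i v)) * FreeAlgebra.ι ℚ (some b⁻¹))
  rw [map_mul (tAct _), tAct_tAct, tAct_some, mul_inv_cancel_right] at h1
  rw [map_mul (tAct g), map_mul (tAct g), map_pow, tAct_none, tAct_some, ← mul_assoc, ← mul_assoc,
    ← pow_add, mul_assoc (_ * _), h1, ← yInt_succ, Equiv.inv_apply, inv_inv, mul_comm g b]
  congr 2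
  push_cast
  ring

/-- Terms with i < M have negative index and vanish, i = M survives only for a = g, and i > M is
reindexed by j = i − M − 1. -/
theorem sum_yInt_neg (L : ℕ → Γ → QY Γ →ₗ[ℚ] QY Γ) (N : ℕ) (hL : ∀ i, N ≤ i → ∀ a, L i a = 0)
    (M : ℕ) (g : Γ) :
    ∑ i ∈ Finset.range N, ∑ a : Γ, L i a (yInt (-(M : ℤ) + i) (a⁻¹ * g)) =
      L M g 1 + ∑ j ∈ Finset.range N, ∑ a : Γ, L (M + 1 + j) a (yInt ((0 : ℕ) + 1 + j) (a⁻¹ * g)) := by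
  classical
  have h1 : ∑ i ∈ Finset.range N, ∑ a : Γ, L i a (yInt (-(M : ℤ) + i) (a⁻¹ * g)) =
      ∑ i ∈ Finset.range (M + 1 + N), ∑ a : Γ, L i a (yInt (-(M : ℤ) + i) (a⁻¹ * g)) := by
    refine Finset.sum_subset (Finset.range_subset_range.2 (by omega)) fun k _ hk => ?_
    rw [Finset.mem_range, not_lt] at hk
    refine Finset.sum_eq_zero fun a _ => ?_
    rw [hL k hk, LinearMap.zero_apply]
  have h2 : ∑ i ∈ Finset.range M, ∑ a : Γ, L i a (yInt (-(M : ℤ) + i) (a⁻¹ * g)) = 0 := by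
    refine Finset.sum_eq_zero fun i hi => Finset.sum_eq_zero fun a _ => ?_
    rw [Finset.mem_range] at hi
    rw [yInt_of_neg (by omega), map_zero]
  rw [h1, Finset.sum_range_add, Finset.sum_range_succ, h2, zero_add]
  congr 1
  · rw [Finset.sum_eq_single g]
    · simp [yInt_zero]
    · intro a _ ha
      rw [neg_add_cancel, yInt_zero, if_neg, map_zero]
      rw [inv_mul_eq_one]
      exact ha
    · simp
  · refine Finset.sum_congr rfl fun j _ => Finset.sum_congr rfl fun a _ => ?_
    congr 2
    push_cast
    ring

/-- For m > 0 this is the expansion of both terms of the derivation. For m = −M ≤ 0 the left side is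
zero, and the right side is the θ-image of the difference of the two sides of `rSum_rZero`, times
x_g: here the end symmetry enters. -/
theorem Balanced.iharaDer_yInt {ψ : QX Γ} (h : Balanced ψ) (N : ℕ)
    (hr : ∀ n, N ≤ n → rZero Γ n ψ = 0) (hl : ∀ n, N ≤ n → lZero Γ n ψ = 0) (m : ℤ) (g : Γ) :
    iharaDer ψ (yInt m g) = ∑ i ∈ Finset.range N, ∑ a : Γ,
      (theta Γ (rStrip (some a) (rZero Γ i ψ) * FreeAlgebra.ι ℚ (some a)) *
          yInt (m + i) (a⁻¹ * g) -
        yInt (m + i) (a⁻¹ * g) *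
          theta Γ (tAct a (lStrip (some a⁻¹) (lZero Γ i ψ)) * FreeAlgebra.ι ℚ (some a))) := by
  classical
  simp only [Finset.sum_sub_distrib]
  have hcr := cst_rZero h.cst_eq h.zder_eq
  have hcl := cst_lZero h.cst_eq h.zder_eq
  rcases lt_or_ge 0 m with hm | hm
  · obtain ⟨k, rfl⟩ : ∃ k : ℕ, m = k + 1 := ⟨(m - 1).toNat, by omega⟩
    rw [yInt_succ, iharaDer_ι, theta_mul_eq_sum ψ hcr N (hr N le_rfl),
      theta_mul_tAct_eq_sum ψ hcl N (hl N le_rfl)]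
  · obtain ⟨M, rfl⟩ : ∃ M : ℕ, m = -(M : ℤ) := ⟨(-m).toNat, by omega⟩
    have h0 : iharaDer ψ (yInt (-(M : ℤ)) g) = 0 := by
      rcases M with _ | M
      · rw [Nat.cast_zero, neg_zero, yInt_zero]
        split_ifs
        · exact iharaDer_one ψ
        · exact map_zero _
      · rw [yInt_of_neg (by omega), map_zero]
    have hrr : ∀ n, rZero Γ n (rZero Γ (M + 1) ψ) = rZero Γ (M + 1 + n) ψ := by
      intro n
      induction n with
      | zero => rfl
      | succ n ih => rw [rZero_succ', ih, ← rZero_succ', add_assoc]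
    have hll : ∀ n, lZero Γ n (lZero Γ (M + 1) ψ) = lZero Γ (M + 1 + n) ψ := by
      intro n
      induction n with
      | zero => rfl
      | succ n ih => rw [lZero_succ', ih, ← lZero_succ', add_assoc]
    have h1 := sum_yInt_neg (fun i a => LinearMap.mulLeft ℚ
      (theta Γ (rStrip (some a) (rZero Γ i ψ) * FreeAlgebra.ι ℚ (some a)))) N
      (fun i hi a => by simp [hr i hi]) M g
    have h2 := sum_yInt_neg (fun i a => LinearMap.mulRight ℚ
      (theta Γ (tAct a (lStrip (some a⁻¹) (lZero Γ i ψ)) * FreeAlgebra.ι ℚ (some a)))) N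
      (fun i hi a => by simp [hl i hi]) M g
    have h3 := theta_mul_eq_sum (rZero Γ (M + 1) ψ) (fun n => by rw [hrr, hcr]) N
      (by rw [hrr, hr _ (by omega)]) 0 g
    have h4 := theta_mul_tAct_eq_sum (lZero Γ (M + 1) ψ) (fun n => by rw [hll, hcl]) N
      (by rw [hll, hl _ (by omega)]) 0 g
    simp only [hrr, hll, pow_zero, mul_one, one_mul] at h3 h4
    simp only [LinearMap.mulLeft_apply, LinearMap.mulRight_apply, mul_one, one_mul] at h1 h2
    rw [h0, h1, h2, ← h3, ← h4, ← map_add, ← map_add, ← add_mul, ← add_mul, rZero_succ',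
      lZero_succ', ← map_add, ← rSum_apply, ← lSum_apply, rSum_rZero h.zder_eq h.endDefect_eq,
      sub_self]

theorem sum_comm₄ {ι₁ ι₂ ι₃ ι₄ M : Type*} [AddCommMonoid M] (s : Finset ι₁) (t : Finset ι₂)
    (u : Finset ι₃) (w : Finset ι₄) (F : ι₁ → ι₂ → ι₃ → ι₄ → M) :
    ∑ i ∈ s, ∑ a ∈ t, ∑ k ∈ u, ∑ c ∈ w, F i a k c =
      ∑ k ∈ u, ∑ c ∈ w, ∑ i ∈ s, ∑ a ∈ t, F i a k c :=
  calc
    _ = ∑ p ∈ s ×ˢ t, ∑ q ∈ u ×ˢ w, F p.1 p.2 q.1 q.2 := by simp only [Finset.sum_product]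
    _ = _ := by rw [Finset.sum_comm]; simp only [Finset.sum_product]

/-- Since the formula of `iharaDer_yInt` holds for all integers, it applies to every tensor factor
of Δ_* y_n, and the shifted factors reassemble into Δ_* y_{n+i}. The P and Q are primitive, so the
two sides agree. -/
theorem Balanced.coderivationAt_ι {ψ : QX Γ} (h : Balanced ψ) (y : YLetter Γ) :
    CoderivationAt (iharaDer ψ) (FreeAlgebra.ι ℚ y) := by
  obtain ⟨n, g⟩ := y
  obtain ⟨m, rfl⟩ : ∃ m : ℕ, n = m.succPNat := ⟨n.natPred, (PNat.succPNat_natPred n).symm⟩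
  obtain ⟨N₁, hN₁⟩ := exists_rZero_eq_zero ψ
  obtain ⟨N₂, hN₂⟩ := exists_lZero_eq_zero ψ
  set N := max N₁ N₂ with hN
  have hr : ∀ n, N ≤ n → rZero Γ n ψ = 0 := fun n hn => hN₁ n (by omega)
  have hl : ∀ n, N ≤ n → lZero Γ n ψ = 0 := fun n hn => hN₂ n (by omega)
  have hA := h.iharaDer_yInt N hr hl
  set P : ℕ → Γ → QY Γ := fun i a =>
    theta Γ (rStrip (some a) (rZero Γ i ψ) * FreeAlgebra.ι ℚ (some a)) with hP
  set Q : ℕ → Γ → QY Γ := fun i a =>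
    theta Γ (tAct a (lStrip (some a⁻¹) (lZero Γ i ψ)) * FreeAlgebra.ι ℚ (some a)) with hQ
  have hPp : ∀ i a, harmonicCoproduct (P i a) = P i a ⊗ₜ[ℚ] 1 + 1 ⊗ₜ[ℚ] P i a :=
    h.primitive_right
  have hQp : ∀ i a, harmonicCoproduct (Q i a) = Q i a ⊗ₜ[ℚ] 1 + 1 ⊗ₜ[ℚ] Q i a :=
    h.primitive_left
  change ∀ m g, iharaDer ψ (yInt m g) = ∑ i ∈ Finset.range N, ∑ a : Γ,
    (P i a * yInt (m + i) (a⁻¹ * g) - yInt (m + i) (a⁻¹ * g) * Q i a) at hA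
  rw [← yInt_succ]
  set n : ℤ := (m : ℤ) + 1 with hn
  have hleft : (iharaDer ψ).rTensor (QY Γ) (harmonicCoproduct (yInt n g)) =
      ∑ i ∈ Finset.range N, ∑ a : Γ,
        (P i a ⊗ₜ[ℚ] 1 * harmonicCoproduct (yInt (n + i) (a⁻¹ * g)) -
          harmonicCoproduct (yInt (n + i) (a⁻¹ * g)) * Q i a ⊗ₜ[ℚ] 1) := by
    have h1 : ∀ i ∈ Finset.range N, ∑ a : Γ,
        (P i a ⊗ₜ[ℚ] 1 * harmonicCoproduct (yInt (n + i) (a⁻¹ * g)) -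
          harmonicCoproduct (yInt (n + i) (a⁻¹ * g)) * Q i a ⊗ₜ[ℚ] 1) =
        ∑ a : Γ, ∑ k ∈ Finset.range (m + 2 + N), ∑ c : Γ,
          (P i a * yInt (n - k + i) (a⁻¹ * (c⁻¹ * g)) -
            yInt (n - k + i) (a⁻¹ * (c⁻¹ * g)) * Q i a) ⊗ₜ[ℚ] yInt k c := by
      intro i hi
      rw [Finset.mem_range] at hi
      refine Finset.sum_congr rfl fun a _ => ?_
      -- A bound above n + i = m + 1 + i for every i < N, so that all sums share one range.
      rw [harmonicCoproduct_yInt' _ (m + 2 + N) (by push_cast; omega)]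
      simp only [Finset.mul_sum, Finset.sum_mul, Algebra.TensorProduct.tmul_mul_tmul, one_mul,
        mul_one, ← Finset.sum_sub_distrib, TensorProduct.sub_tmul, mul_left_comm,
        show ∀ k : ℕ, n - (k : ℤ) + i = n + i - k from fun k => by ring]
    rw [Finset.sum_congr rfl h1, sum_comm₄,
      harmonicCoproduct_yInt' n (m + 2 + N) (by push_cast; omega)]
    simp only [map_sum, LinearMap.rTensor_tmul, hA, TensorProduct.sum_tmul]
  have hright : (iharaDer ψ).lTensor (QY Γ) (harmonicCoproduct (yInt n g)) =
      ∑ i ∈ Finset.range N, ∑ a : Γ,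
        (1 ⊗ₜ[ℚ] P i a * harmonicCoproduct (yInt (n + i) (a⁻¹ * g)) -
          harmonicCoproduct (yInt (n + i) (a⁻¹ * g)) * 1 ⊗ₜ[ℚ] Q i a) := by
    have h1 : ∀ i ∈ Finset.range N, ∑ a : Γ,
        (1 ⊗ₜ[ℚ] P i a * harmonicCoproduct (yInt (n + i) (a⁻¹ * g)) -
          harmonicCoproduct (yInt (n + i) (a⁻¹ * g)) * 1 ⊗ₜ[ℚ] Q i a) =
        ∑ a : Γ, ∑ k ∈ Finset.range (m + 2 + N), ∑ c : Γ,
          yInt k c ⊗ₜ[ℚ] (P i a * yInt (n - k + i) (a⁻¹ * (c⁻¹ * g)) -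
            yInt (n - k + i) (a⁻¹ * (c⁻¹ * g)) * Q i a) := by
      intro i hi
      rw [Finset.mem_range] at hi
      refine Finset.sum_congr rfl fun a _ => ?_
      rw [harmonicCoproduct_yInt _ (m + 2 + N) (by push_cast; omega)]
      simp only [Finset.mul_sum, Finset.sum_mul, Algebra.TensorProduct.tmul_mul_tmul, one_mul,
        mul_one, ← Finset.sum_sub_distrib, TensorProduct.tmul_sub, mul_left_comm,
        show ∀ k : ℕ, n - (k : ℤ) + i = n + i - k from fun k => by ring]
    rw [Finset.sum_congr rfl h1, sum_comm₄,
      harmonicCoproduct_yInt n (m + 2 + N) (by push_cast; omega)]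
    simp only [map_sum, LinearMap.lTensor_tmul, hA, TensorProduct.tmul_sum]
  rw [CoderivationAt, hleft, hright, hA, map_sum, ← Finset.sum_add_distrib]
  refine Finset.sum_congr rfl fun i _ => ?_
  rw [map_sum, ← Finset.sum_add_distrib]
  refine Finset.sum_congr rfl fun a _ => ?_
  rw [map_sub, map_mul, map_mul, hPp, hQp, add_mul, mul_add]
  abel

theorem Balanced.primitive_ihara {ψ φ : QX Γ} (hψ : Balanced ψ) (hφ : Balanced φ) :
    HarmonicPrimitive (theta Γ (ihara ψ φ)) := by
  have h1 : HarmonicPrimitive (iharaDer ψ (theta Γ φ)) := .der hψ.coderivationAt_ι hφ.primitive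
  have h2 : HarmonicPrimitive (iharaDer φ (theta Γ ψ)) := .der hφ.coderivationAt_ι hψ.primitive
  rw [theta_ihara, sub_eq_add_neg, sub_eq_add_neg]
  exact (h1.add h2.neg).add (hψ.primitive.commutator hφ.primitive).neg

end IharaCoderivation

/-! ### Absorbing the correction into ψ. -/

section Correction

open Polynomial

variable {Γ : Type*} [CommGroup Γ]

/-- The correction of `ψ` by a polynomial in `x₁`, for which `θ` is `ψ_*`. -/
def corrected (ψ : QX Γ) : QX Γ := ψ + aeval (FreeAlgebra.ι ℚ (some (1 : Γ))) (corrPoly ψ)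

theorem theta_corrected (ψ : QX Γ) : theta Γ (corrected ψ) = lowerStar ψ := by
  rw [corrected, map_add, theta_aeval, lowerStar_eq]

theorem dDer_aeval (ψ : QX Γ) (f : ℚ[X]) :
    dDer ψ (aeval (FreeAlgebra.ι ℚ (some (1 : Γ))) f) =
      aeval (FreeAlgebra.ι ℚ (some (1 : Γ))) f * tAct 1 ψ -
        tAct 1 ψ * aeval (FreeAlgebra.ι ℚ (some (1 : Γ))) f := by
  induction f using Polynomial.induction_on with
  | C a => rw [aeval_C, dDer_algebraMap, Algebra.commutes, sub_self]
  | add p q hp hq => simp only [map_add, hp, hq]; noncomm_ring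
  | monomial n a ih =>
    rw [pow_succ, ← mul_assoc, map_mul, aeval_X, dDer_mul, ih, dDer_some]
    noncomm_ring

/-- t_σ f(x₁) = f(x_σ) commutes with x_σ. -/
theorem dDer_aeval_left (f : ℚ[X]) (v : QX Γ) :
    dDer (aeval (FreeAlgebra.ι ℚ (some (1 : Γ))) f) v = 0 := by
  have h1 : ∀ σ : Γ, tAct σ (aeval (FreeAlgebra.ι ℚ (some (1 : Γ))) f) =
      aeval (FreeAlgebra.ι ℚ (some σ)) f := by
    intro σ
    rw [← aeval_algHom_apply, tAct_some, mul_one]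
  have h2 : ∀ σ : Γ, FreeAlgebra.ι ℚ (some σ) * aeval (FreeAlgebra.ι ℚ (some σ)) f =
      aeval (FreeAlgebra.ι ℚ (some σ)) f * FreeAlgebra.ι ℚ (some σ) := by
    intro σ
    have h := congrArg (aeval (FreeAlgebra.ι ℚ (some σ))) (mul_comm X f)
    rwa [map_mul, map_mul, aeval_X] at h
  induction v using left_induction with
  | one => exact der_one _
  | ι_mul a v hv =>
    rw [dDer_mul, hv, mul_zero, add_zero]
    cases a with
    | none => rw [dDer_none, zero_mul]
    | some σ => rw [dDer_some, h1, h2, sub_self, zero_mul]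
  | add x y hx hy => rw [map_add, hx, hy, add_zero]
  | smul c x hx => rw [map_smul, hx, smul_zero]

/-- For a polynomial f in x₁, d_ψ(f) = [f, ψ] cancels the commutator [ψ, f], the derivation attached
to f is zero, and two such polynomials commute. -/
theorem ihara_corrected (ψ φ : QX Γ) : ihara (corrected ψ) (corrected φ) = ihara ψ φ := by
  have h : aeval (FreeAlgebra.ι ℚ (some (1 : Γ))) (corrPoly ψ) *
      aeval (FreeAlgebra.ι ℚ (some (1 : Γ))) (corrPoly φ) =
      aeval (FreeAlgebra.ι ℚ (some (1 : Γ))) (corrPoly φ) *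
        aeval (FreeAlgebra.ι ℚ (some (1 : Γ))) (corrPoly ψ) := by
    rw [← map_mul, mul_comm, map_mul]
  simp only [ihara_eq, corrected, map_add, dDer_add_left, dDer_aeval_left, dDer_aeval, add_mul,
    mul_add, h, tAct_one_left]
  abel

variable [Fintype Γ]

/-- The correction is odd, hence changes sign under the antipode; it is free of x₀, and its strips
at the two ends agree. -/
theorem balanced_corrected {ψ : IharaLib Γ} (hψ : ψ ∈ dmr₀ Γ) :
    Balanced (corrected (incl Γ ψ)) := by
  obtain ⟨-, hodd, hend⟩ := ends_of_mem_dmr₀ hψ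
  obtain ⟨⟨hx0, -, hprim⟩, -⟩ := hψ
  have hL : incl Γ ψ ∈ Lib Γ := ψ.2
  refine ⟨?_, ?_, ?_, fun g => ?_, ?_⟩
  · rw [corrected, map_add, cst_of_mem_Lib hL, ← aeval_algHom_apply, cst_ι,
      ← coeff_zero_eq_aeval_zero, corrPoly_coeff_zero, add_zero]
  · rw [corrected, map_add, antipode_of_mem_Lib hL, antipode_aeval, hodd, map_neg, neg_add]
  · rw [corrected, map_add, zder_eq_zero hL hx0, zder, sder_aeval, zero_smul, add_zero]
  · have h := hend g
    rw [endDefect, rSum_apply, lSum_apply] at h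
    rw [endDefect, corrected, rSum_apply, lSum_apply]
    simp only [map_add] at h ⊢
    rw [rStrip_aeval_of_ne (b := none) (by simp), lStrip_aeval_of_ne (b := none) (by simp)]
    by_cases hg : g = 1
    · subst hg
      rw [inv_one] at h ⊢
      rw [rStrip_aeval_self, lStrip_aeval_self]
      simp only [tAct_one_left, map_zero, add_zero] at h ⊢
      rw [← h]
      abel
    · rw [rStrip_aeval_of_ne (by simpa using hg), lStrip_aeval_of_ne (by simpa using hg)]
      simpa using h
  · rw [theta_corrected]
    exact hprim

end Correction

/-! ### The bracket has no words x₀^n or x₀^n x_g. -/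

section Depth

variable {Γ : Type*} [CommGroup Γ] [Fintype Γ] {ψ : QX Γ}

/-- The coefficients of `v` at the words `x₀^n` and `x₀^n x_g` vanish. -/
def Deep (v : QX Γ) : Prop :=
  ∀ n, cst (lZero Γ n v) = 0 ∧ ∀ g, cst (lStrip (some g) (lZero Γ n v)) = 0

theorem Deep.add {u v : QX Γ} (hu : Deep u) (hv : Deep v) : Deep (u + v) := fun n =>
  ⟨by rw [map_add, map_add, (hu n).1, (hv n).1, add_zero],
    fun g => by rw [map_add, map_add, map_add, (hu n).2, (hv n).2, add_zero]⟩

theorem Deep.smul {v : QX Γ} (c : ℚ) (hv : Deep v) : Deep (c • v) := fun n =>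
  ⟨by rw [map_smul, map_smul, (hv n).1, smul_zero],
    fun g => by rw [map_smul, map_smul, map_smul, (hv n).2, smul_zero]⟩

theorem Deep.neg {v : QX Γ} (hv : Deep v) : Deep (-v) := by
  rw [← neg_one_smul ℚ]
  exact hv.smul _

theorem deep_zero : Deep (0 : QX Γ) := fun n => ⟨by simp, fun g => by simp⟩

theorem lZero_mul {u : QX Γ} (hu : ∀ n, cst (lZero Γ n u) = 0) (v : QX Γ) (n : ℕ) :
    lZero Γ n (u * v) = lZero Γ n u * v := by
  induction n with
  | zero => rfl
  | succ n ih => rw [lZero_succ', ih, lStrip_mul, hu, zero_smul, add_zero, lZero_succ']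

/-- Every word of the product has some x_σ, from `u`, followed by at least one letter, from `v`. -/
theorem deep_mul {u v : QX Γ} (hu : ∀ n, cst (lZero Γ n u) = 0) (hv : cst v = 0) :
    Deep (u * v) := fun n => by
  rw [lZero_mul hu]
  exact ⟨by rw [map_mul, hv, mul_zero],
    fun g => by rw [lStrip_mul, hu, zero_smul, add_zero, map_mul, hv, mul_zero]⟩

theorem lZero_some_mul (g : Γ) (v : QX Γ) (n : ℕ) :
    cst (lZero Γ n (FreeAlgebra.ι ℚ (some g) * v)) = 0 := by
  cases n with
  | zero => simp
  | succ n => rw [lZero_succ, lStrip_mul, lStrip_ι]; simp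

theorem Deep.none_mul {v : QX Γ} (hv : Deep v) : Deep (FreeAlgebra.ι ℚ none * v) := by
  classical
  intro n
  cases n with
  | zero => simp [lStrip_ι_mul]
  | succ n =>
    rw [lZero_succ, lStrip_ι_mul, if_pos rfl]
    exact hv n

theorem lZero_tAct (σ : Γ) (v : QX Γ) (n : ℕ) : lZero Γ n (tAct σ v) = tAct σ (lZero Γ n v) := by
  induction n with
  | zero => rfl
  | succ n ih => rw [lZero_succ', ih, lStrip_tAct_none, lZero_succ']

theorem deep_dDer (hψ : ∀ n, cst (lZero Γ n ψ) = 0) (v : QX Γ) : Deep (dDer ψ v) := by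
  induction v using left_induction with
  | one => rw [dDer, der_one]; exact deep_zero
  | ι_mul a v hv =>
    rw [dDer_mul]
    cases a with
    | none =>
      rw [dDer_none, zero_mul, zero_add]
      exact hv.none_mul
    | some g =>
      rw [dDer_some, sub_mul, mul_assoc, mul_assoc, sub_eq_add_neg]
      have hg : ∀ n, cst (lZero Γ n (FreeAlgebra.ι ℚ (some g))) = 0 := fun n => by
        simpa using lZero_some_mul g 1 n
      have ht : ∀ n, cst (lZero Γ n (tAct g ψ)) = 0 := fun n => by
        rw [lZero_tAct, cst_tAct, hψ]
      have h0 : cst (dDer ψ v) = 0 := (hv 0).1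
      have h1 : cst ψ = 0 := hψ 0
      exact ((deep_mul hg (by rw [map_mul, cst_tAct, h1, zero_mul])).add
        (deep_mul ht (by simp)).neg).add (deep_mul hg h0)
  | add x y hx hy => rw [map_add]; exact hx.add hy
  | smul c x hx => rw [map_smul]; exact hx.smul c

theorem deep_ihara {φ : QX Γ} (hψ : ∀ n, cst (lZero Γ n ψ) = 0)
    (hφ : ∀ n, cst (lZero Γ n φ) = 0) : Deep (ihara ψ φ) := by
  rw [ihara_eq, sub_eq_add_neg, sub_eq_add_neg]
  exact ((deep_mul hψ (hφ 0)).add (deep_mul hφ (hψ 0)).neg).add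
    ((deep_dDer hψ φ).add (deep_dDer hφ ψ).neg)

theorem Deep.coeff_replicate {v : QX Γ} (hv : Deep v) (n : ℕ) (g : Γ) :
    coeff (List.replicate n none ++ [some g]) v = 0 := by
  rw [DoubleShuffle.coeff_replicate, (hv n).2]

theorem Deep.coeff_none {v : QX Γ} (hv : Deep v) : coeff [none] v = 0 := by
  rw [coeff_cons, coeff_nil]
  exact (hv 1).1

theorem Deep.corrPoly_eq_zero {v : QX Γ} (hv : Deep v) : corrPoly v = 0 := by
  ext n
  cases n with
  | zero => rw [corrPoly_coeff_zero, Polynomial.coeff_zero]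
  | succ n => rw [corrPoly_coeff_succ, hv.coeff_replicate, mul_zero, Polynomial.coeff_zero]

end Depth

/-! ### Closure under the Ihara bracket. -/

section Closure

variable {Γ : Type*} [CommGroup Γ] [Fintype Γ]

theorem lie_mem_dmr₀ {ψ φ : IharaLib Γ} (hψ : ψ ∈ dmr₀ Γ) (hφ : φ ∈ dmr₀ Γ) :
    ⁅ψ, φ⁆ ∈ dmr₀ Γ := by
  have hdeep : Deep (incl Γ ⁅ψ, φ⁆) := by
    rw [incl_lie]
    exact deep_ihara
      (cst_lZero (cst_of_mem_Lib ψ.2) (zder_eq_zero ψ.2 hψ.1.1))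
      (cst_lZero (cst_of_mem_Lib φ.2) (zder_eq_zero φ.2 hφ.1.1))
  have h1 : coeff [some (1 : Γ)] (incl Γ ⁅ψ, φ⁆) = 0 := hdeep.coeff_replicate 0 1
  refine ⟨⟨hdeep.coeff_none, h1, ?_⟩, fun _ σ => ?_, fun _ => ?_⟩
  · have h2 : lowerStar (incl Γ ⁅ψ, φ⁆) = theta Γ (incl Γ ⁅ψ, φ⁆) := by
      rw [lowerStar_eq, hdeep.corrPoly_eq_zero, map_zero, add_zero]
    rw [h2, incl_lie, ← ihara_corrected]
    exact (balanced_corrected hψ).primitive_ihara (balanced_corrected hφ)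
  · have h2 : ∀ g : Γ, coeff [some g] (incl Γ ⁅ψ, φ⁆) = 0 := hdeep.coeff_replicate 0
    rw [ParityCondition, coeff_lowerStar_one _ _ h1, coeff_lowerStar_one _ _ h1, h2, h2, mul_zero,
      add_zero]
  · rw [ParityCondition, inv_one, show (2 : ℕ+) = (0 + 1).succPNat from rfl,
      coeff_lowerStar_succ, hdeep.coeff_replicate, mul_zero, add_zero]

end Closure

end

end DoubleShuffle

theorem mainTheorem3 (Γ : Type*) [CommGroup Γ] [Fintype Γ] :
    ∃ L : LieSubalgebra ℚ (DoubleShuffle.IharaLib Γ), L.toSubmodule = DoubleShuffle.dmr₀ Γ :=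
  ⟨{ DoubleShuffle.dmr₀ Γ with lie_mem' := DoubleShuffle.lie_mem_dmr₀ }, rfl⟩
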